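/- Let $h,k\in\mathbb C$, $q=e^{h}$, $q^x=e^{hx}$, $[x]=\frac{q^x-q^{-x}}{q-q^{-1}}$, and assume $|q|<1$ and $|q^{k}|<1$. Let $\alpha_m,\bar\alpha_m,\beta_m$ ($m\in\mathbb Z$) be three mutually commuting families of bosons with, for $m>0$, $$[\alpha_m,\alpha_{-m}]=\tfrac{[2m][km]}{m},\qquad [\bar\alpha_m,\bar\alpha_{-m}]=-\tfrac{[2m][km]}{m},\qquad [\beta_m,\beta_{-m}]=\tfrac{[2m][(k+2)m]}{m}$$ (other commutators zero), acting on the Fock modules $F_{l,m_1,m_2}$ ($l,m_1,m_2\in\mathbb C$), which are free of rank one over the polynomial algebra in the negative modes, on a vacuum $|l,m_1,m_2\rangle$ killed by the positive modes, with $\beta_0=2l$, $\alpha_0=2m_1$, $\bar\alpha_0=-2m_2$. The operator $e^{2r\beta+2s_1\alpha+2s_2\bar\alpha}$ maps $|l,m_1,m_2\rangle$ to $|l+r,m_1+s_1,m_2+s_2\rangle$ and commutes with all nonzero modes. Normal ordering $:\ :$ puts negative modes to the left of positive modes and the exponentials $e^{2r\beta+\cdots}$ to the left of the zero modes $\alpha_0,\bar\alpha_0,\beta_0$.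 Put $$\bar Y^{\pm}(z)=\exp\Big\{\pm\sum_{m\ge1}q^{\mp km/2}\tfrac{z^m}{[km]}\bar\alpha_{-m}\Big\}e^{\pm2\bar\alpha}z^{\pm\bar\alpha_0/k}\exp\Big\{\mp\sum_{m\ge1}q^{\mp km/2}\tfrac{z^{-m}}{[km]}\bar\alpha_m\Big\},$$ $$Z_\pm(z)=\exp\Big\{\mp(q-q^{-1})\sum_{m\ge1}z^{\mp m}\tfrac{[m]}{[2m]}\bar\alpha_{\pm m}\Big\}q^{\mp\bar\alpha_0/2},\qquad W_\pm(z)=\exp\Big\{\mp(q-q^{-1})\sum_{m\ge1}z^{\mp m}\tfrac{[m]}{[2m]}\beta_{\pm m}\Big\}q^{\mp\beta_0/2},$$ $$\Phi^{+}(z)=\tfrac1{q-q^{-1}}:\bar Y^+(z)\{Z_+(q^{-\frac{k+2}2}z)W_+(q^{-\frac k2}z)-W_-(q^{\frac k2}z)Z_-(q^{\frac{k+2}2}z)\}:,$$ $$\Phi^{-}(z)=\tfrac1{q-q^{-1}}:\bar Y^-(z)\{Z_+(q^{\frac{k+2}2}z)W_+(q^{\frac k2}z)^{-1}-W_-(q^{-\frac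 k2}z)^{-1}Z_-(q^{-\frac{k+2}2}z)\}:,$$ $$S^{\pm}(z)=\exp\Big\{\sum_{m\ge1}\tfrac{z^m}{[2m]}\big(q^{\pm\frac k2m}\beta_{-m}\pm q^{\pm\frac{k+2}2m}\bar\alpha_{-m}\big)\Big\}e^{(k+2)\beta\pm k\bar\alpha}z^{\frac12(\beta_0\pm\bar\alpha_0)}\exp\Big\{-\sum_{m\ge1}\tfrac{z^{-m}}{[2m]}\big(q^{\pm\frac k2m}\beta_{m}\pm q^{\pm\frac{k+2}2m}\bar\alpha_{m}\big)\Big\}.$$ Let $$\lambda_2(z)=\tfrac{-1}{(q-q^{-1})^2}:\bar Y^-(q^{k+2}z)W_-(q^{\frac{k+4}2}z)^{-1}Z_-(q^{\frac{k+2}2}z)\,\bar Y^+(z)Z_+(q^{-\frac{k+2}2}z)W_+(q^{-\frac k2}z):,$$ $$\lambda_3(z)=\tfrac{-1}{(q-q^{-1})^2}:\bar Y^-(q^{k+2}z)Z_+(q^{\frac{3k+6}2}z)W_+(q^{\frac{3k+4}2}z)^{-1}\,\bar Y^+(z)W_-(q^{\frac k2}z)Z_-(q^{\frac{k+2}2}z):,$$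 $$L(z)=\frac1{2\pi i}\oint_{C}\Phi^-(w)\Phi^+(z)\,dw,$$ where $C$ is a small circle around $w=q^{k+2}z$. The integral is taken for each matrix element in the monomial bases of the Fock modules, $\Phi^-(w)\Phi^+(z)$ being continued meromorphically in $w$ from the region $|w|\gg|z|$, with the branch of the fractional powers of $w$ given by $\log w=\log z+(k+2)h$ at $w=q^{k+2}z$. Then, as identities of formal series of operators on all $F_{l,m_1,m_2}$: (i) $\lambda_3(z)S^-(w)=\,:\lambda_3(z)S^-(w):\,=S^-(w)\lambda_3(z)$ and $\lambda_2(z)S^+(w)=\,:\lambda_2(z)S^+(w):\,=S^+(w)\lambda_2(z)$. (ii) $L(z)$ is a well-defined formal series of operators (it exists and is unique, each of its matrix elements being a finite sum of complex powers of $z$), and it commutes with each of $S^+$ and $S^-$ up to a total difference: for each sign there are nonzero constants $r$, $r_1=e^{\rho_1}$, $r_2=e^{\rho_2}$ with $r_1\ne r_2$, and a current $A(z)$ of the form $z^{\kappa}V(z)$ with $\kappa\in\mathbb C$ and $V(z)$ a vertex operator, all independent of the Fock module, such that $$[L(z),S^{\pm}(w)]=\frac{r}{w}\Big(\delta\big(\tfrac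 zw r_1\big)-\delta\big(\tfrac zw r_2\big)\Big)A(z).$$ Here $\delta(x)=\sum_{n\in\mathbb Z}x^n$ on the modules $F_{l,m_1,m_2}$ on which $S^\pm(w)$ has integral powers of $w$, i.e. $e:=l\mp m_2\in\mathbb Z$. On the other modules $\delta(\tfrac zw r_i)$ stands for $\sum_{s\in -e+\mathbb Z}e^{\rho_i s}(z/w)^s$, to which it reduces for $e\in\mathbb Z$. -/

import Mathlib

/-! Three commuting families of bosons, their Fock modules, vertex operators, the bosonized quantum
parafermion currents of `U_q(sl_2^)`, the current `L(z)` and the screening currents `S^±(z)`.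

Throughout `q = exp h`, `q ^ x = exp (h * x)`, and `k` is the level. -/

namespace QParafermion

noncomputable section

/-! ### q-numbers, bosons and Fock modules -/

/-- `q ^ x`. -/
def qPow (h x : ℂ) : ℂ := Complex.exp (h * x)

/-- `[x] = (q ^ x - q ^ (-x)) / (q - q⁻¹)`. -/
def qNum (h x : ℂ) : ℂ := (qPow h x - qPow h (-x)) / (qPow h 1 - qPow h (-1))

/-- The labels of the three Heisenberg algebras `α`, `ᾱ`, `β`. -/
inductive Boson
  | alpha
  | alphaBar
  | beta
  deriving DecidableEq

instance : Fintype Boson where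
  elems := {.alpha, .alphaBar, .beta}
  complete b := by cases b <;> simp

/-- The value of the commutator `[b_m, b_{-m}]`, `m > 0`. -/
def bracket (h k : ℂ) : Boson → ℕ+ → ℂ
  | .alpha, m => qNum h (2 * (m : ℂ)) * qNum h (k * (m : ℂ)) / (m : ℂ)
  | .alphaBar, m => -(qNum h (2 * (m : ℂ)) * qNum h (k * (m : ℂ)) / (m : ℂ))
  | .beta, m => qNum h (2 * (m : ℂ)) * qNum h ((k + 2) * (m : ℂ)) / (m : ℂ)

/-- A charge `μ` labels the vacuum `|l, m₁, m₂>` with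
`l = μ .beta`, `m₁ = μ .alpha`, `m₂ = μ .alphaBar`. -/
abbrev Charge := Boson → ℂ

/-- The direct sum over all charges of the Fock modules `F_{l,m₁,m₂}`. Each of them is free of rank
one over the polynomial ring `N_-`, whose variable `X (b, m)` is the creation operator `b_{-m}`. -/
abbrev Fock := Charge →₀ MvPolynomial (Boson × ℕ+) ℂ

/-- The operator `b_{-m}`, `m > 0`. -/
def creation (b : Boson) (m : ℕ+) : Module.End ℂ Fock :=
  Finsupp.mapRange.linearMap (LinearMap.mulLeft ℂ (MvPolynomial.X (b, m)))

/-- The operator `b_m`, `m > 0`: it kills the vacua and satisfies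
`[b_m, b_{-m}] = bracket h k b m`. -/
def annihilation (h k : ℂ) (b : Boson) (m : ℕ+) : Module.End ℂ Fock :=
  Finsupp.mapRange.linearMap
    (bracket h k b m • (MvPolynomial.pderiv (R := ℂ) (b, m)).toLinearMap)

/-- The eigenvalues of the zero modes: `β_0 = 2 l`, `α_0 = 2 m₁`, `ᾱ_0 = -2 m₂`. -/
def zeroMode (μ : Charge) : Boson → ℂ
  | .alpha => 2 * μ .alpha
  | .alphaBar => -2 * μ .alphaBar
  | .beta => 2 * μ .beta

/-- The operator that acts by the scalar `g μ` on the Fock module of charge `μ`. -/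
def diagonal (g : Charge → ℂ) : Module.End ℂ Fock :=
  Finsupp.lsum ℂ fun μ => g μ • Finsupp.lsingle μ

/-- The operator `e^{2 r β + 2 s₁ α + 2 s₂ ᾱ}`, where `σ .beta = r`, `σ .alpha = s₁`,
`σ .alphaBar = s₂`. It maps `|l, m₁, m₂>` to `|l + r, m₁ + s₁, m₂ + s₂>` and commutes with all
nonzero modes. -/
def chargeShift (σ : Charge) : Module.End ℂ Fock :=
  Finsupp.lmapDomain _ ℂ fun μ => μ + σ

/-! ### Formal series of operators -/

/-- A formal series `A(z) = ∑_a A_a z ^ a` with complex exponents and operator coefficients. -/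
abbrev Current := ℂ → Module.End ℂ Fock

/-- The coefficient of `x ^ n` in `exp (∑_{m ≥ 1} p_m x ^ m)`. (The `j`-th power of the exponent
starts in degree `j`, so only `j ≤ n` contribute.) -/
def expCoeff (p : ℕ+ → Module.End ℂ Fock) (n : ℕ) : Module.End ℂ Fock :=
  ∑ j ∈ Finset.range (n + 1), ((j.factorial : ℂ)⁻¹) •
    PowerSeries.coeff n
      ((PowerSeries.mk fun i => if hi : 0 < i then p ⟨i, hi⟩ else 0) ^ j)

open Classical in
/-- The sum of a family of operators only finitely many of which are nonzero on any given vector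
(and `0` for all other families). -/
def operatorSum {ι : Type} (T : ι → Module.End ℂ Fock) : Module.End ℂ Fock :=
  if hT : ∀ v, (Function.support fun i => T i v).Finite then
    { toFun := fun v => ∑ᶠ i, T i v
      map_add' := fun v w => by
        simp only [map_add]
        exact finsum_add_distrib (hT v) (hT w)
      map_smul' := fun c v => by
        simp only [map_smul, RingHom.id_apply]
        exact (smul_finsum' c (hT v)).symm }
  else 0

/-! ### Vertex operators -/

/-- The data of a normally ordered vertex operator
`scalar · exp (∑_{b, m ≥ 1} create b m · z ^ m · b_{-m}) · e^{shift} · z ^ {∑_b zExp b · b_0}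
  · q ^ {∑_b qExp b · b_0} · exp (∑_{b, m ≥ 1} annih b m · z ^ {-m} · b_m)`. -/
@[ext]
structure VertexOp where
  scalar : ℂ
  create : Boson → ℕ+ → ℂ
  annih : Boson → ℕ+ → ℂ
  shift : Charge
  zExp : Boson → ℂ
  qExp : Boson → ℂ

namespace VertexOp

/-- The exponent of `z` in `z ^ {∑_b zExp b · b_0}` on the Fock module of charge `μ`. -/
def zExponent (V : VertexOp) (μ : Charge) : ℂ := ∑ b, V.zExp b * zeroMode μ b

/-- The coefficient of `z ^ s` in `z ^ {∑_b zExp b · b_0}`. -/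
def zPart (V : VertexOp) (s : ℂ) : Module.End ℂ Fock :=
  open Classical in diagonal fun μ => if V.zExponent μ = s then 1 else 0

/-- The operator `q ^ {∑_b qExp b · b_0}`. -/
def qPart (h : ℂ) (V : VertexOp) : Module.End ℂ Fock :=
  diagonal fun μ => qPow h (∑ b, V.qExp b * zeroMode μ b)

/-- The coefficient of `z ^ n` in the creation part. -/
def createCoeff (V : VertexOp) (n : ℕ) : Module.End ℂ Fock :=
  expCoeff (fun m => ∑ b, V.create b m • creation b m) n

/-- The coefficient of `z ^ (-n)` in the annihilation part. -/
def annihCoeff (h k : ℂ) (V : VertexOp) (n : ℕ) : Module.End ℂ Fock :=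
  expCoeff (fun m => ∑ b, V.annih b m • annihilation h k b m) n

/-- The formal series `V(z)` of a vertex operator. -/
def current (h k : ℂ) (V : VertexOp) : Current := fun a =>
  V.scalar • operatorSum fun n : ℕ × ℕ =>
    V.createCoeff n.1 * chargeShift V.shift * V.zPart (a - n.1 + n.2) * V.qPart h *
      V.annihCoeff h k n.2

/-- The coefficient of `z ^ a * w ^ b` in the normally ordered product `: V(z) W(w) :`. -/
def normalProduct (h k : ℂ) (V W : VertexOp) (a b : ℂ) : Module.End ℂ Fock :=
  (V.scalar * W.scalar) • operatorSum fun n : (ℕ × ℕ) × (ℕ × ℕ) =>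
    V.createCoeff n.1.1 * W.createCoeff n.2.1 * chargeShift (V.shift + W.shift) *
      V.zPart (a - n.1.1 + n.1.2) * W.zPart (b - n.2.1 + n.2.2) * V.qPart h * W.qPart h *
      V.annihCoeff h k n.1.2 * W.annihCoeff h k n.2.2

/-- The vertex operator `: V(z) W(z) :`. -/
instance : Mul VertexOp where
  mul V W :=
    { scalar := V.scalar * W.scalar
      create := V.create + W.create
      annih := V.annih + W.annih
      shift := V.shift + W.shift
      zExp := V.zExp + W.zExp
      qExp := V.qExp + W.qExp }

/-- The inverse of `V(z)` under the normally ordered product. -/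
instance : Inv VertexOp where
  inv V :=
    { scalar := V.scalar⁻¹
      create := -V.create
      annih := -V.annih
      shift := -V.shift
      zExp := -V.zExp
      qExp := -V.qExp }

/-- The vertex operator `c · V(z)`. -/
def scale (c : ℂ) (V : VertexOp) : VertexOp := { V with scalar := c * V.scalar }

/-- The vertex operator `V(q ^ x · z)`. -/
def at_qPow (h x : ℂ) (V : VertexOp) : VertexOp :=
  { scalar := V.scalar
    create := fun b m => qPow h (x * (m : ℂ)) * V.create b m
    annih := fun b m => qPow h (-(x * (m : ℂ))) * V.annih b m
    shift := V.shift
    zExp := V.zExp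
    qExp := fun b => V.qExp b + x * V.zExp b }

end VertexOp

/-! ### The bosonized parafermion currents -/

/-- `Ȳ^+(z)`. -/
def YbarPlus (h k : ℂ) : VertexOp where
  scalar := 1
  create
    | .alphaBar, m => qPow h (-(k * (m : ℂ) / 2)) / qNum h (k * (m : ℂ))
    | _, _ => 0
  annih
    | .alphaBar, m => -(qPow h (-(k * (m : ℂ) / 2)) / qNum h (k * (m : ℂ)))
    | _, _ => 0
  shift
    | .alphaBar => 1
    | _ => 0
  zExp
    | .alphaBar => 1 / k
    | _ => 0
  qExp _ := 0

/-- `Ȳ^-(z)`. -/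
def YbarMinus (h k : ℂ) : VertexOp where
  scalar := 1
  create
    | .alphaBar, m => -(qPow h (k * (m : ℂ) / 2) / qNum h (k * (m : ℂ)))
    | _, _ => 0
  annih
    | .alphaBar, m => qPow h (k * (m : ℂ) / 2) / qNum h (k * (m : ℂ))
    | _, _ => 0
  shift
    | .alphaBar => -1
    | _ => 0
  zExp
    | .alphaBar => -(1 / k)
    | _ => 0
  qExp _ := 0

/-- `exp (-(q - q⁻¹) ∑ z ^ (-m) [m]/[2m] b_m) · q ^ (-b_0 / 2)`;
this is `Z_+(z)` for `b = ᾱ` and `W_+(z)` for `b = β`. -/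
def plusPart (h : ℂ) (b : Boson) : VertexOp where
  scalar := 1
  create _ _ := 0
  annih b' m := if b' = b then
    -((qPow h 1 - qPow h (-1)) * (qNum h (m : ℂ) / qNum h (2 * (m : ℂ)))) else 0
  shift _ := 0
  zExp _ := 0
  qExp b' := if b' = b then -(1 / 2) else 0

/-- `exp ((q - q⁻¹) ∑ z ^ m [m]/[2m] b_{-m}) · q ^ (b_0 / 2)`;
this is `Z_-(z)` for `b = ᾱ` and `W_-(z)` for `b = β`. -/
def minusPart (h : ℂ) (b : Boson) : VertexOp where
  scalar := 1
  create b' m := if b' = b then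
    (qPow h 1 - qPow h (-1)) * (qNum h (m : ℂ) / qNum h (2 * (m : ℂ))) else 0
  annih _ _ := 0
  shift _ := 0
  zExp _ := 0
  qExp b' := if b' = b then 1 / 2 else 0

def Zplus (h : ℂ) : VertexOp := plusPart h .alphaBar
def Zminus (h : ℂ) : VertexOp := minusPart h .alphaBar
def Wplus (h : ℂ) : VertexOp := plusPart h .beta
def Wminus (h : ℂ) : VertexOp := minusPart h .beta

/-- `: Ȳ^+(z) Z_+(q^{-(k+2)/2} z) W_+(q^{-k/2} z) :` -/
def phiPlus₁ (h k : ℂ) : VertexOp :=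
  YbarPlus h k * (Zplus h).at_qPow h (-((k + 2) / 2)) * (Wplus h).at_qPow h (-(k / 2))

/-- `: Ȳ^+(z) W_-(q^{k/2} z) Z_-(q^{(k+2)/2} z) :` -/
def phiPlus₂ (h k : ℂ) : VertexOp :=
  YbarPlus h k * (Wminus h).at_qPow h (k / 2) * (Zminus h).at_qPow h ((k + 2) / 2)

/-- `: Ȳ^-(z) Z_+(q^{(k+2)/2} z) W_+(q^{k/2} z)⁻¹ :` -/
def phiMinus₁ (h k : ℂ) : VertexOp :=
  YbarMinus h k * (Zplus h).at_qPow h ((k + 2) / 2) * ((Wplus h).at_qPow h (k / 2))⁻¹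

/-- `: Ȳ^-(z) W_-(q^{-k/2} z)⁻¹ Z_-(q^{-(k+2)/2} z) :` -/
def phiMinus₂ (h k : ℂ) : VertexOp :=
  YbarMinus h k * ((Wminus h).at_qPow h (-(k / 2)))⁻¹ * (Zminus h).at_qPow h (-((k + 2) / 2))

/-- The parafermion current `Φ^+(z)`. -/
def PhiPlus (h k : ℂ) : Current := fun a =>
  (1 / (qPow h 1 - qPow h (-1))) • ((phiPlus₁ h k).current h k a - (phiPlus₂ h k).current h k a)

/-- The parafermion current `Φ^-(z)`. -/
def PhiMinus (h k : ℂ) : Current := fun a =>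
  (1 / (qPow h 1 - qPow h (-1))) • ((phiMinus₁ h k).current h k a - (phiMinus₂ h k).current h k a)

/-! ### The current `L(z)` and its components -/

/-- The matrix element of `v` at the monomial `d` in the Fock module of charge `ν`. -/
def matrixElement (ν : Charge) (d : (Boson × ℕ+) →₀ ℕ) (v : Fock) : ℂ :=
  MvPolynomial.coeff d (v ν)

/-- `L(z) = (2πi)⁻¹ ∮ A(w) B(z) dw`, the contour being a small circle around `w = e ^ c * z`.

Matrix element by matrix element: `A(w) B(z)` is the analytic continuation in `w` of the sum of the
series, which converges for `|w|` large, and `L(z)` is a finite sum of powers of `z`. As fractional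
powers occur, everything is written in `ω = log w` and `ζ = log z`, so that `dw = e ^ ω dω`, and the
point `w = e ^ c * z` is `ω = ζ + c`. The function of `ω` is meromorphic on a half plane that
contains this point and overlaps the region of convergence, hence is unique. -/
def IsContourIntegral (A B : Current) (c : ℂ) (L : Current) : Prop :=
  ∀ (v : Fock) (ν : Charge) (d : (Boson × ℕ+) →₀ ℕ),
    {a : ℂ | matrixElement ν d (L a v) ≠ 0}.Finite ∧
    ∀ ζ : ℂ, ∃ (f : ℂ → ℂ) (η R : ℝ), 0 < η ∧
      MeromorphicOn f {ω : ℂ | (ζ + c).re - η < ω.re} ∧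
      (∀ ω : ℂ, R < ω.re → HasSum
        (fun p : ℂ × ℂ => matrixElement ν d (A p.1 (B p.2 v)) * Complex.exp (p.1 * ω + p.2 * ζ))
        (f ω)) ∧
      ∀ᶠ ε : ℝ in nhdsWithin 0 (Set.Ioi 0),
        (2 * (Real.pi : ℂ) * Complex.I)⁻¹ * (∮ ω in C(ζ + c, ε), f ω * Complex.exp ω) =
          ∑ᶠ a : ℂ, matrixElement ν d (L a v) * Complex.exp (a * ζ)

/-- `L(z)` is the integral of `Φ^-(w) Φ^+(z) dw` around `w = q ^ (k + 2) z`. -/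
def IsL (h k : ℂ) (L : Current) : Prop :=
  IsContourIntegral (PhiMinus h k) (PhiPlus h k) (h * (k + 2)) L

/-- `λ_2(z)`, the vertex operator coming from
`: Ȳ^-(w) W_-(q^{-k/2} w)⁻¹ Z_-(q^{-(k+2)/2} w) Ȳ^+(z) Z_+(q^{-(k+2)/2} z) W_+(q^{-k/2} z) :`
at `w = q ^ (k + 2) z`. -/
def lambda₂ (h k : ℂ) : VertexOp :=
  ((phiMinus₂ h k).at_qPow h (k + 2) * phiPlus₁ h k).scale
    (-(1 / (qPow h 1 - qPow h (-1)) ^ 2))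

/-- `λ_3(z)`, the vertex operator coming from
`: Ȳ^-(w) Z_+(q^{(k+2)/2} w) W_+(q^{k/2} w)⁻¹ Ȳ^+(z) W_-(q^{k/2} z) Z_-(q^{(k+2)/2} z) :`
at `w = q ^ (k + 2) z`. -/
def lambda₃ (h k : ℂ) : VertexOp :=
  ((phiMinus₁ h k).at_qPow h (k + 2) * phiPlus₂ h k).scale
    (-(1 / (qPow h 1 - qPow h (-1)) ^ 2))

/-! ### Screening currents -/

/-- The screening current `S^+(z)`. -/
def Splus (h k : ℂ) : VertexOp where
  scalar := 1
  create
    | .beta, m => qPow h (k / 2 * (m : ℂ)) / qNum h (2 * (m : ℂ))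
    | .alphaBar, m => qPow h ((k + 2) / 2 * (m : ℂ)) / qNum h (2 * (m : ℂ))
    | .alpha, _ => 0
  annih
    | .beta, m => -(qPow h (k / 2 * (m : ℂ)) / qNum h (2 * (m : ℂ)))
    | .alphaBar, m => -(qPow h ((k + 2) / 2 * (m : ℂ)) / qNum h (2 * (m : ℂ)))
    | .alpha, _ => 0
  shift
    | .beta => (k + 2) / 2
    | .alphaBar => k / 2
    | .alpha => 0
  zExp
    | .beta => 1 / 2
    | .alphaBar => 1 / 2
    | .alpha => 0
  qExp _ := 0

/-- The screening current `S^-(z)`. -/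
def Sminus (h k : ℂ) : VertexOp where
  scalar := 1
  create
    | .beta, m => qPow h (-(k / 2 * (m : ℂ))) / qNum h (2 * (m : ℂ))
    | .alphaBar, m => -(qPow h (-((k + 2) / 2 * (m : ℂ))) / qNum h (2 * (m : ℂ)))
    | .alpha, _ => 0
  annih
    | .beta, m => -(qPow h (-(k / 2 * (m : ℂ))) / qNum h (2 * (m : ℂ)))
    | .alphaBar, m => qPow h (-((k + 2) / 2 * (m : ℂ))) / qNum h (2 * (m : ℂ))
    | .alpha, _ => 0
  shift
    | .beta => (k + 2) / 2
    | .alphaBar => -(k / 2)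
    | .alpha => 0
  zExp
    | .beta => 1 / 2
    | .alphaBar => -(1 / 2)
    | .alpha => 0
  qExp _ := 0

/-! ### Trivial contraction and commutation up to a total difference -/

/-- `V(z) W(w) = : V(z) W(w) : = W(w) V(z)`. -/
def TrivialContraction (h k : ℂ) (V W : VertexOp) : Prop :=
  ∀ a b : ℂ,
    V.current h k a * W.current h k b = V.normalProduct h k W a b ∧
    W.current h k b * V.current h k a = V.normalProduct h k W a b

open Classical in
/-- The coefficient of `x ^ s` in `∑_{s ∈ e + ℤ} (exp ρ · x) ^ s`, where `(exp ρ) ^ s = exp (ρ s)`.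
For `e ∈ ℤ` the series is `δ(exp ρ · x)` with `δ(x) = ∑_{n ∈ ℤ} x ^ n`. -/
def deltaCoeff (e ρ s : ℂ) : ℂ := if ∃ n : ℤ, s = e + n then Complex.exp (ρ * s) else 0

/-- `A(z)` is of the form `z ^ κ V(z)` with a vertex operator `V(z)`. -/
def IsVertexCurrent (h k : ℂ) (A : Current) : Prop :=
  ∃ (V : VertexOp) (κ : ℂ), ∀ a, A a = V.current h k (a - κ)

/-- `[L(z), S(w)] = r w⁻¹ (δ(r₁ z / w) - δ(r₂ z / w)) A(z)` with nonzero constants `r`,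
`r₁ = exp ρ₁ ≠ r₂ = exp ρ₂` and a vertex operator current `A(z)`. The identity is read off at
`z ^ a w ^ b`. On a Fock module where `S(w)` has exponents in `e + ℤ` (possibly non-integral), the
delta functions have exponents in `-e + ℤ`; for `e ∈ ℤ` they are the usual ones. -/
def CommutesUpToTotalDifference (h k : ℂ) (L : Current) (S : VertexOp) : Prop :=
  ∃ (r ρ₁ ρ₂ : ℂ) (A : Current), r ≠ 0 ∧ Complex.exp ρ₁ ≠ Complex.exp ρ₂ ∧
    IsVertexCurrent h k A ∧
    ∀ (μ : Charge) (p : MvPolynomial (Boson × ℕ+) ℂ) (a b : ℂ),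
      L a (S.current h k b (Finsupp.single μ p)) - S.current h k b (L a (Finsupp.single μ p)) =
        (r * (deltaCoeff (-S.zExponent μ) ρ₁ (-(b + 1)) -
              deltaCoeff (-S.zExponent μ) ρ₂ (-(b + 1)))) •
          A (a + (b + 1)) (Finsupp.single μ p)

end

end QParafermion

/-! The product of two vertex operators `V(z) W(w)` equals a scalar contraction, a power series in
`w / z`, times `: V(z) W(w) :`. This is the exchange rule for exponentials whose exponents have
scalar commutators (`expSeries_exchange`, `mode_mode`, `current_current_single`). The theorem
thereby reduces to explicit contractions and to coincidences between normally ordered products.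

Let Λ_ij(z) be `: Φ^-_i(q^{k+2} z) Φ^+_j(z) :`, where the indices number the two terms of each
current and scalar prefactors are dropped. With `x = z / w`, the contraction of `Φ^-_i(w) Φ^+_j(z)`
is the function f(x) coming from `Ȳ^- Ȳ^+`, times (1 - q^{-k-2} x)/(1 - q^{-k} x) for 11, times 1
for 12 and 21, and times (1 - q^{k+2} x)/(1 - q^k x) for 22. Since f(x)(1 - q^{k+2} x) = f(q^{2k}
x)(1 - q^{k-2} x) and |q^{2k}| < 1, f continues beyond |x| < |q^{-k-2}|, with at most a simple pole
at x = q^{-k-2}, that is, at w = q^{k+2} z. The zero of the 22 factor cancels that pole, and the 11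
factor takes there the value κ = (1 - q^{-2k-4})/(1 - q^{-2k-2}). Hence L(z) = R z^{1+2/k} (qκ Λ_11
- q Λ_12 - q⁻¹ Λ_21) for a constant R (`isL_lCurrent`). It is unique, because the identity theorem
determines the continuation and the functions e^{aζ} are linearly independent
(`IsContourIntegral.unique`).

Up to scalars Λ_12 is λ_3 and Λ_21 is λ_2. All contractions of Λ_12 with S^- and of Λ_21 with S^+
vanish, which is (i), and these terms drop out of the respective commutators. For each remaining
pair, the products in the two orders expand one rational function with a single simple pole w = q^τ
z in opposite regions, so the commutator is a delta function times `: Λ(z) S(q^τ z) :`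
(`commutator_single`). Here τ = k+1 for Λ_11 and k+3 for Λ_21 with S^-, and τ = 1 for Λ_11 and -1
for Λ_12 with S^+.

Two coincidences produce the total difference. The normally ordered products at the two poles are
the same vertex operator (`lambda_mul_Sminus`, `lambda_mul_Splus`). And κ adjusts the coefficients:
for S^-, qκ(q^{-2k-2} - 1) = -q(1 - q^{-2k-4}) stands against q⁻¹(1 - q^{-2k-4}), with ratio -q²,
exactly the one forced by the prefactor 1/w. The same κ works for S^+. -/

namespace QParafermion

noncomputable section

/-! ### Exponentials of power series over a possibly noncommutative algebra -/

section ExpSeries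

open PowerSeries

variable {A : Type*} [Ring A] [Algebra ℂ A]

/-- The derivation `x d/dx` of formal power series. -/
def euler (F : PowerSeries A) : PowerSeries A := PowerSeries.mk fun n => (n : ℂ) • coeff n F

@[simp] theorem coeff_euler (F : PowerSeries A) (n : ℕ) :
    coeff n (euler F) = (n : ℂ) • coeff n F := by simp [euler]

theorem euler_add (F G : PowerSeries A) : euler (F + G) = euler F + euler G := by
  ext n; simp

theorem euler_one : euler (1 : PowerSeries A) = 0 := by
  ext n; rcases n with _ | n <;> simp [coeff_one]

theorem euler_C (a : A) : euler (C a) = 0 := by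
  ext n; rcases n with _ | n <;> simp [coeff_C]

theorem euler_mul (F G : PowerSeries A) : euler (F * G) = euler F * G + F * euler G := by
  ext n
  simp only [coeff_euler, coeff_mul, map_add, Finset.smul_sum, ← Finset.sum_add_distrib]
  refine Finset.sum_congr rfl fun x hx => ?_
  rw [← Finset.HasAntidiagonal.mem_antidiagonal.1 hx]
  push_cast
  rw [add_smul, smul_mul_assoc, mul_smul_comm]

/-- Since `Q` has no constant term, the `n`-th coefficient of `Q * F` involves only lower
coefficients of `F`, and `n` is invertible in `ℂ`. Most identities between exponentials below are
proved by checking that both sides solve the same equation. -/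
theorem eq_of_euler_eq {Q F G : PowerSeries A} (hQ : coeff 0 Q = 0) (hF : euler F = Q * F)
    (hG : euler G = Q * G) (h0 : coeff 0 F = coeff 0 G) : F = G := by
  ext n
  induction n using Nat.strong_induction_on with
  | _ n ih =>
    rcases Nat.eq_zero_or_pos n with rfl | hn
    · exact h0
    have h1 : (n : ℂ) • coeff n F = (n : ℂ) • coeff n G := by
      rw [← coeff_euler, ← coeff_euler, hF, hG, coeff_mul, coeff_mul]
      refine Finset.sum_congr rfl fun x hx => ?_
      rcases Nat.eq_zero_or_pos x.1 with h | h
      · rw [h, hQ, zero_mul, zero_mul]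
      · rw [ih x.2 (by have := Finset.HasAntidiagonal.mem_antidiagonal.1 hx; omega)]
    exact smul_right_injective A (Nat.cast_ne_zero.2 hn.ne') h1

omit [Algebra ℂ A] in
theorem commute_of_coeff {P Q : PowerSeries A} (hPQ : ∀ i j, Commute (coeff i P) (coeff j Q)) :
    Commute P Q := by
  ext n
  rw [coeff_mul, coeff_mul, ← Finset.Nat.sum_antidiagonal_swap]
  exact Finset.sum_congr rfl fun x _ => (hPQ _ _).eq

/-- The formal series `∑_j P ^ j / j!`, for `P` without constant term. -/
def expSeries (P : PowerSeries A) : PowerSeries A := PowerSeries.mk fun n =>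
  ∑ j ∈ Finset.range (n + 1), ((j.factorial : ℂ)⁻¹) • coeff n (P ^ j)

theorem coeff_zero_expSeries (P : PowerSeries A) : coeff 0 (expSeries P) = 1 := by
  simp [expSeries]

@[simp] theorem constantCoeff_expSeries (P : PowerSeries A) :
    constantCoeff (expSeries P) = 1 := by
  rw [← coeff_zero_eq_constantCoeff_apply, coeff_zero_expSeries]

omit [Algebra ℂ A] in
theorem coeff_pow_eq_zero {P : PowerSeries A} (h0 : coeff 0 P = 0) {n j : ℕ} (hnj : n < j) :
    coeff n (P ^ j) = 0 := by
  induction j generalizing n with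
  | zero => omega
  | succ j ih =>
    rw [pow_succ', coeff_mul]
    refine Finset.sum_eq_zero fun x hx => ?_
    have := Finset.HasAntidiagonal.mem_antidiagonal.1 hx
    rcases Nat.eq_zero_or_pos x.1 with h | h
    · rw [h, h0, zero_mul]
    · rw [ih (by omega), mul_zero]

/-- Powers beyond the `n`-th do not reach degree `n`, so the sum may be cut off at any larger bound.
All coefficients in a convolution can then share one range. -/
theorem coeff_expSeries {P : PowerSeries A} (h0 : coeff 0 P = 0) {n N : ℕ} (hN : n ≤ N) :
    coeff n (expSeries P) = ∑ j ∈ Finset.range (N + 1), ((j.factorial : ℂ)⁻¹) • coeff n (P ^ j) :=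
        by
  rw [expSeries, coeff_mk]
  refine Finset.sum_subset (by simpa using hN) fun j _ hj => ?_
  rw [coeff_pow_eq_zero h0 (by simpa using hj), smul_zero]

theorem euler_pow {P : PowerSeries A} (hP : Commute P (euler P)) (j : ℕ) :
    euler (P ^ (j + 1)) = ((j : ℂ) + 1) • (euler P * P ^ j) := by
  induction j with
  | zero => simp
  | succ j ih =>
    rw [pow_succ', euler_mul, ih, mul_smul_comm, ← mul_assoc, hP.eq, mul_assoc, ← pow_succ']
    push_cast
    rw [add_smul ((j : ℂ) + 1), one_smul, add_comm]

/-- Commuting coefficients make `P` commute with `euler P`, so the commutative power rule for `P ^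
(j + 1)` applies term by term. -/
theorem euler_expSeries {P : PowerSeries A} (h0 : coeff 0 P = 0)
    (hP : ∀ i j, Commute (coeff i P) (coeff j P)) :
    euler (expSeries P) = euler P * expSeries P := by
  have hc : Commute P (euler P) := commute_of_coeff fun i j => by
    rw [coeff_euler]; exact (hP i j).smul_right _
  ext n
  rcases n with _ | n
  · simp [coeff_mul, h0]
  have h1 : ∀ j : ℕ, ((j + 1).factorial : ℂ)⁻¹ * ((j : ℂ) + 1) = (j.factorial : ℂ)⁻¹ := fun j => by
    have h2 : (j.factorial : ℂ) ≠ 0 := Nat.cast_ne_zero.2 j.factorial_ne_zero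
    have h3 : (j : ℂ) + 1 ≠ 0 := Nat.cast_add_one_ne_zero j
    rw [Nat.factorial_succ]; push_cast; field_simp
  calc coeff (n + 1) (euler (expSeries P))
      = ∑ j ∈ Finset.range (n + 2), ((j.factorial : ℂ)⁻¹) • coeff (n + 1) (euler (P ^ j)) := by
        rw [coeff_euler, expSeries, coeff_mk, Finset.smul_sum]
        exact Finset.sum_congr rfl fun j _ => by rw [coeff_euler, smul_comm]
    _ = ∑ j ∈ Finset.range (n + 1), ((j.factorial : ℂ)⁻¹) • coeff (n + 1) (euler P * P ^ j) := by
        rw [Finset.sum_range_succ', pow_zero, euler_one, map_zero, smul_zero, add_zero]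
        refine Finset.sum_congr rfl fun j _ => ?_
        rw [euler_pow hc, ← h1 j, mul_smul]; rfl
    _ = coeff (n + 1) (euler P * expSeries P) := by
        simp only [coeff_mul, Finset.smul_sum]
        rw [Finset.sum_comm]
        refine Finset.sum_congr rfl fun x hx => ?_
        rcases Nat.eq_zero_or_pos x.1 with h | h
        · simp [h]
        · have hx2 := Finset.HasAntidiagonal.mem_antidiagonal.1 hx
          rw [coeff_expSeries h0 (N := n) (by omega),
            Finset.mul_sum]
          exact Finset.sum_congr rfl fun j _ => by rw [mul_smul_comm]

theorem coeff_zero_euler (P : PowerSeries A) : coeff 0 (euler P) = 0 := by simp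

theorem eq_expSeries {P F : PowerSeries A} (h0 : coeff 0 P = 0)
    (hP : ∀ i j, Commute (coeff i P) (coeff j P)) (hF0 : coeff 0 F = 1)
    (hF : euler F = euler P * F) : F = expSeries P :=
  eq_of_euler_eq (coeff_zero_euler P) hF (euler_expSeries h0 hP)
    (by rw [hF0, coeff_zero_expSeries])

theorem map_expSeries {B : Type*} [Ring B] [Algebra ℂ B] (f : A →ₐ[ℂ] B) (P : PowerSeries A)
    (n : ℕ) : f (coeff n (expSeries P)) = coeff n (expSeries (PowerSeries.map (f : A →+* B) P)) :=
        by
  simp only [expSeries, coeff_mk, map_sum, map_smul]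
  refine Finset.sum_congr rfl fun j _ => ?_
  rw [← map_pow, coeff_map]
  rfl

theorem commute_expSeries {P : PowerSeries A} {x : A} (hx : ∀ i, Commute x (coeff i P)) (n : ℕ) :
    Commute x (coeff n (expSeries P)) := by
  have h : ∀ j n, Commute x (coeff n (P ^ j)) := fun j => by
    induction j with
    | zero => intro n; rw [pow_zero, coeff_one]; split_ifs <;> simp
    | succ j ih =>
      intro n
      rw [pow_succ', coeff_mul]
      exact Commute.sum_right _ _ _ fun y _ => (hx _).mul_right (ih _)
  rw [expSeries, coeff_mk]
  exact Commute.sum_right _ _ _ fun j _ => (h _ _).smul_right _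

theorem expSeries_add {P Q : PowerSeries A} (hP0 : coeff 0 P = 0) (hQ0 : coeff 0 Q = 0)
    (hP : ∀ i j, Commute (coeff i P) (coeff j P)) (hQ : ∀ i j, Commute (coeff i Q) (coeff j Q))
    (hPQ : ∀ i j, Commute (coeff i P) (coeff j Q)) :
    expSeries (P + Q) = expSeries P * expSeries Q := by
  symm
  refine eq_expSeries (by rw [map_add, hP0, hQ0, add_zero]) (fun i j => ?_)
    (by simp) ?_
  · simp only [map_add]
    exact ((hP i j).add_right (hPQ i j)).add_left ((hPQ j i).symm.add_right (hQ i j))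
  · have h : Commute (expSeries P) (euler Q) := commute_of_coeff fun i j => by
      rw [coeff_euler]
      exact ((commute_expSeries (fun i => (hPQ i j).symm) i).symm).smul_right _
    rw [euler_mul, euler_expSeries hP0 hP, euler_expSeries hQ0 hQ, euler_add, add_mul,
      ← mul_assoc (expSeries P), h.eq, mul_assoc, mul_assoc]

/-- If the commutators of `x` with the coefficients of `P` are scalars `s_n`, then
`[x, exp P] = s · exp P`. -/
theorem bracket_expSeries {P : PowerSeries A} (h0 : coeff 0 P = 0)
    (hP : ∀ i j, Commute (coeff i P) (coeff j P)) {x : A} {s : ℕ → ℂ}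
    (hs : ∀ n, x * coeff n P - coeff n P * x = algebraMap ℂ A (s n)) (hs0 : s 0 = 0) (n : ℕ) :
    x * coeff n (expSeries P) - coeff n (expSeries P) * x =
      ∑ y ∈ Finset.HasAntidiagonal.antidiagonal n, s y.1 • coeff y.2 (expSeries P) := by
  set E := expSeries P with hE
  set S : PowerSeries A := PowerSeries.mk fun n => algebraMap ℂ A (s n) with hS
  have hcen : ∀ F : PowerSeries A, Commute F S := fun F => commute_of_coeff fun i j => by
    rw [hS, coeff_mk]; exact Algebra.commutes' _ _ |>.symm
  have hxP : C x * euler P - euler P * C x = euler S := by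
    ext n
    simp only [map_sub, coeff_C_mul, coeff_mul_C, coeff_euler, hS, coeff_mk, ← hs]
    rw [mul_smul_comm, smul_mul_assoc, smul_sub]
  have hEe := euler_expSeries h0 hP
  -- The defect solves the homogeneous equation `euler D = euler P * D` with zero constant term,
  -- because `S` is central and `euler S` is the commutator of `x` with `euler P`.
  have key : C x * E - E * C x - S * E = 0 := by
    refine eq_of_euler_eq (coeff_zero_euler P) ?_ (by simp [euler, PowerSeries.ext_iff]) ?_
    · have e1 : ∀ F G : PowerSeries A, euler (F - G) = euler F - euler G := fun F G => by
        ext; simp [smul_sub]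
      rw [e1, e1, euler_mul, euler_mul, euler_mul, euler_C, hEe, ← hE, ← hxP]
      have := (hcen (euler P)).eq
      simp only [zero_mul, mul_zero, zero_add, add_zero, mul_sub, sub_mul, mul_assoc]
      rw [← mul_assoc S, ← this, mul_assoc]
      abel
    · simp [hS, hs0, hE]
  have := congrArg (coeff n) key
  rw [map_sub, map_sub, map_zero, sub_eq_zero, coeff_C_mul, coeff_mul_C, coeff_mul] at this
  rw [this]
  refine Finset.sum_congr rfl fun y _ => ?_
  rw [hS, coeff_mk, Algebra.smul_def]

/-- Normal ordering of a product of two exponentials. -/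
theorem expSeries_exchange {P Q : PowerSeries A} {γ : PowerSeries ℂ} (hP0 : coeff 0 P = 0)
    (hQ0 : coeff 0 Q = 0) (hγ0 : coeff 0 γ = 0)
    (hP : ∀ i j, Commute (coeff i P) (coeff j P)) (hQ : ∀ i j, Commute (coeff i Q) (coeff j Q))
    (hPQ : ∀ i j, coeff i P * coeff j Q - coeff j Q * coeff i P =
      algebraMap ℂ A (if i = j then coeff i γ else 0)) (n l : ℕ) :
    coeff n (expSeries P) * coeff l (expSeries Q) =
      ∑ x ∈ Finset.HasAntidiagonal.antidiagonal n, (if x.1 ≤ l then coeff x.1 (expSeries γ) else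
          0) •
        (coeff (l - x.1) (expSeries Q) * coeff x.2 (expSeries P)) := by
  -- `K` is the expected value of `exp P` conjugating the `l`-th coefficient of `exp Q`. It
  -- satisfies `[euler P, K] = euler K`, so `K * exp P` solves the same equation as `exp P` times
  -- that coefficient.
  set K : PowerSeries A := PowerSeries.mk fun j =>
    (if j ≤ l then coeff j (expSeries γ) else 0) • coeff (l - j) (expSeries Q) with hK
  have hbr : ∀ i m, coeff i P * coeff m (expSeries Q) - coeff m (expSeries Q) * coeff i P =
      if i ≤ m then coeff i γ • coeff (m - i) (expSeries Q) else 0 := fun i m => by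
    rw [bracket_expSeries hQ0 hQ (x := coeff i P) (s := fun j => if i = j then coeff i γ else 0)
      (hPQ i) (by by_cases h : i = 0 <;> simp [h, hγ0])]
    split_ifs with him
    · rw [Finset.sum_eq_single (i, m - i)]
      · simp
      · rintro ⟨a, b⟩ hab hne
        have := Finset.HasAntidiagonal.mem_antidiagonal.1 hab
        have : i ≠ a := fun h => hne (by ext <;> simp_all; omega)
        simp [this]
      · intro h; simp at h; omega
    · refine Finset.sum_eq_zero fun y hy => ?_
      have := Finset.HasAntidiagonal.mem_antidiagonal.1 hy
      rw [if_neg (by omega), zero_smul]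
  have hγe := euler_expSeries hγ0 (fun i j => Commute.all _ _)
  have hKe : euler P * K - K * euler P = euler K := by
    ext n
    rw [map_sub, coeff_mul, coeff_mul, ← Finset.Nat.sum_antidiagonal_swap, ← Finset.sum_sub_distrib]
    have h1 : ∀ x ∈ Finset.HasAntidiagonal.antidiagonal n, coeff x.2 (euler P) * coeff x.1 K -
        coeff x.1 K * coeff x.2 (euler P) =
        (if n ≤ l then coeff x.1 (expSeries γ) * coeff x.2 (euler γ) else 0) •
          coeff (l - n) (expSeries Q) := fun x hx => by
      have hx := Finset.HasAntidiagonal.mem_antidiagonal.1 hx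
      rw [coeff_euler, coeff_euler, hK, coeff_mk, smul_mul_smul_comm, smul_mul_smul_comm,
        mul_comm (x.2 : ℂ), ← smul_sub, hbr]
      by_cases h : n ≤ l
      · rw [if_pos h, if_pos (by omega), if_pos (by omega), smul_smul,
          show l - x.1 - x.2 = l - n by omega, smul_eq_mul, mul_assoc]
      · rw [if_neg h, zero_smul]
        by_cases h2 : x.1 ≤ l
        · rw [if_neg (show ¬ x.2 ≤ l - x.1 by omega), smul_zero]
        · rw [if_neg h2, zero_mul, zero_smul]
    simp only [Prod.fst_swap, Prod.snd_swap]
    rw [Finset.sum_congr rfl h1, ← Finset.sum_smul,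
      coeff_euler, hK, coeff_mk, smul_smul]
    congr 1
    split_ifs with h
    · rw [← smul_eq_mul, ← coeff_euler, hγe, mul_comm (euler γ), coeff_mul]
    · simp
  have key : expSeries P * C (coeff l (expSeries Q)) = K * expSeries P := by
    refine eq_of_euler_eq (coeff_zero_euler P) ?_ ?_ ?_
    · rw [euler_mul, euler_C, mul_zero, add_zero, euler_expSeries hP0 hP, mul_assoc]
    · rw [euler_mul, ← hKe, euler_expSeries hP0 hP, sub_mul, mul_assoc, mul_assoc]
      abel
    · simp [hK]
  rw [← coeff_mul_C, key, coeff_mul]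
  exact Finset.sum_congr rfl fun x _ => by rw [hK, coeff_mk, smul_mul_assoc]

end ExpSeries

/-! ### The polynomial form of the creation and annihilation parts -/

open PowerSeries Finset.HasAntidiagonal

/-- The polynomial algebra in the creation operators. -/
abbrev Poly := MvPolynomial (Boson × ℕ+) ℂ

/-- An operator on polynomials acts on all Fock modules. -/
def liftEnd : Module.End ℂ Poly →ₐ[ℂ] Module.End ℂ Fock :=
  AlgHom.ofLinearMap
    { toFun := fun f => Finsupp.mapRange.linearMap f
      map_add' := fun f g => by ext; simp
      map_smul' := fun c f => by ext; simp }
    (by ext; simp) (fun f g => by ext; simp)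

theorem liftEnd_single (f : Module.End ℂ Poly) (μ : Charge) (p : Poly) :
    liftEnd f (Finsupp.single μ p) = Finsupp.single μ (f p) :=
  Finsupp.mapRange_single (hf := map_zero f)

/-- The power series `∑_{m ≥ 1} p_m x ^ m`. -/
def posSeries {R : Type*} [Semiring R] (p : ℕ+ → R) : PowerSeries R :=
  PowerSeries.mk fun i => if hi : 0 < i then p ⟨i, hi⟩ else 0

theorem coeff_posSeries {R : Type*} [Semiring R] (p : ℕ+ → R) (m : ℕ+) :
    coeff (m : ℕ) (posSeries p) = p m := by
  rw [posSeries, coeff_mk, dif_pos m.pos]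
  rfl

theorem coeff_zero_posSeries {R : Type*} [Semiring R] (p : ℕ+ → R) :
    coeff 0 (posSeries p) = 0 := by
  simp [posSeries]

theorem forall_coeff_posSeries {R : Type*} [Semiring R] {Q : ℕ → R → Prop} {p : ℕ+ → R}
    (h0 : Q 0 0) (h : ∀ m : ℕ+, Q m (p m)) (n : ℕ) : Q n (coeff n (posSeries p)) := by
  rcases Nat.eq_zero_or_pos n with rfl | hn
  · rwa [coeff_zero_posSeries]
  · have := h ⟨n, hn⟩
    rwa [← coeff_posSeries p ⟨n, hn⟩] at this

theorem posSeries_add {R : Type*} [Semiring R] (p p' : ℕ+ → R) :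
    posSeries (p + p') = posSeries p + posSeries p' := by
  ext n
  simp only [posSeries, coeff_mk, map_add]
  split_ifs
  · rfl
  · rw [add_zero]

theorem map_posSeries {R S : Type*} [Semiring R] [Semiring S] (f : R →+* S) (p : ℕ+ → R) :
    PowerSeries.map f (posSeries p) = posSeries fun m => f (p m) := by
  ext n
  simp only [posSeries, coeff_mk, coeff_map]
  split_ifs <;> simp

theorem posSeries_commute {R : Type*} [Semiring R] {p p' : ℕ+ → R}
    (hp : ∀ m m', Commute (p m) (p' m')) (i j : ℕ) :
    Commute (coeff i (posSeries p)) (coeff j (posSeries p')) :=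
  forall_coeff_posSeries (Q := fun _ a => Commute a (coeff j (posSeries p'))) (Commute.zero_left _)
    (fun m => forall_coeff_posSeries (Q := fun _ a => Commute (p m) a) (Commute.zero_right _)
      (fun m' => hp m m') j) i

theorem expSeries_zero {A : Type*} [Ring A] [Algebra ℂ A] :
    expSeries (0 : PowerSeries A) = 1 :=
  (eq_expSeries (by simp) (by simp) (by simp) (by rw [euler_one]; ext; simp)).symm

/-- Rescaling the variable of an exponential. -/
theorem coeff_expSeries_rescale {A : Type*} [Ring A] [Algebra ℂ A] {P Q : PowerSeries A}
    (h0 : coeff 0 P = 0) (hP : ∀ i j, Commute (coeff i P) (coeff j P)) (c : ℂ)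
    (hQ : ∀ n, coeff n Q = c ^ n • coeff n P) (n : ℕ) :
    coeff n (expSeries Q) = c ^ n • coeff n (expSeries P) := by
  rw [← eq_expSeries (P := Q) (F := PowerSeries.mk fun n => c ^ n • coeff n (expSeries P)),
    coeff_mk]
  · simp [hQ, h0]
  · intro i j
    rw [hQ, hQ]
    exact ((hP i j).smul_right _).smul_left _
  · simp
  · ext n
    rw [coeff_euler, coeff_mk, smul_comm, ← coeff_euler, euler_expSeries h0 hP, coeff_mul,
      coeff_mul, Finset.smul_sum]
    refine Finset.sum_congr rfl fun x hx => ?_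
    rw [coeff_euler, coeff_euler, coeff_mk, hQ, ← mem_antidiagonal.1 hx, smul_comm (x.1 : ℂ),
      smul_mul_smul_comm, pow_add]

namespace VertexOp

/-- The exponent of the creation part of a vertex operator. -/
def creSeries (V : VertexOp) : PowerSeries Poly :=
  posSeries fun m => ∑ b, V.create b m • MvPolynomial.X (b, m)

/-- The exponent of the annihilation part of a vertex operator. -/
def annSeries (h k : ℂ) (V : VertexOp) : PowerSeries (Module.End ℂ Poly) :=
  posSeries fun m => ∑ b, V.annih b m •
    (bracket h k b m • (MvPolynomial.pderiv (R := ℂ) (b, m)).toLinearMap)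

/-- The coefficient of `z ^ n` in the creation part, as a polynomial. -/
def cre (V : VertexOp) (n : ℕ) : Poly := coeff n (expSeries V.creSeries)

/-- The coefficient of `z ^ (-n)` in the annihilation part, as an operator on polynomials. -/
def lower (h k : ℂ) (V : VertexOp) (n : ℕ) : Module.End ℂ Poly :=
  coeff n (expSeries (V.annSeries h k))

/-- The exponent of the contraction of `V(z) W(w)`, as a series in `w / z`. -/
def contraction (h k : ℂ) (V W : VertexOp) : PowerSeries ℂ :=
  posSeries fun m => ∑ b, V.annih b m * bracket h k b m * W.create b m

theorem expCoeff_eq (p : ℕ+ → Module.End ℂ Fock) (n : ℕ) :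
    expCoeff p n = coeff n (expSeries (A := Module.End ℂ Fock) (posSeries p)) := by
  rw [expSeries, coeff_mk]
  rfl

/-- Exponentials commute with the algebra maps `Algebra.lmul` and `liftEnd`, so the computation can
be done with polynomials instead of operators on the direct sum. -/
theorem createCoeff_eq (V : VertexOp) (n : ℕ) :
    V.createCoeff n = liftEnd (Algebra.lmul ℂ Poly (V.cre n)) := by
  rw [cre, map_expSeries (A := Poly) (B := Module.End ℂ Poly) (Algebra.lmul ℂ Poly),
    map_expSeries (A := Module.End ℂ Poly) (B := Module.End ℂ Fock) liftEnd, creSeries,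
    map_posSeries, map_posSeries, createCoeff, expCoeff_eq]
  refine congrArg (fun p : ℕ+ → Module.End ℂ Fock =>
    coeff n (expSeries (A := Module.End ℂ Fock) (posSeries p))) (funext fun m => ?_)
  refine LinearMap.ext fun v => ?_
  change _ = liftEnd (Algebra.lmul ℂ Poly (∑ b, V.create b m • MvPolynomial.X (b, m))) v
  rw [map_sum, map_sum, LinearMap.sum_apply, LinearMap.sum_apply]
  refine Finset.sum_congr rfl fun b _ => ?_
  rw [map_smul, map_smul]
  rfl

theorem createCoeff_single (V : VertexOp) (n : ℕ) (μ : Charge) (p : Poly) :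
    V.createCoeff n (Finsupp.single μ p) = Finsupp.single μ (V.cre n * p) := by
  rw [createCoeff_eq, liftEnd_single]
  rfl

theorem annihCoeff_eq (h k : ℂ) (V : VertexOp) (n : ℕ) :
    V.annihCoeff h k n = liftEnd (V.lower h k n) := by
  rw [lower, map_expSeries (A := Module.End ℂ Poly) (B := Module.End ℂ Fock) liftEnd, annSeries,
    map_posSeries, annihCoeff, expCoeff_eq]
  refine congrArg (fun p : ℕ+ → Module.End ℂ Fock =>
    coeff n (expSeries (A := Module.End ℂ Fock) (posSeries p))) (funext fun m => ?_)
  refine LinearMap.ext fun v => ?_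
  change _ = liftEnd (∑ b, V.annih b m •
    (bracket h k b m • (MvPolynomial.pderiv (R := ℂ) (b, m)).toLinearMap)) v
  rw [map_sum, LinearMap.sum_apply, LinearMap.sum_apply]
  refine Finset.sum_congr rfl fun b _ => ?_
  rw [map_smul]
  rfl

theorem annihCoeff_single (h k : ℂ) (V : VertexOp) (n : ℕ) (μ : Charge) (p : Poly) :
    V.annihCoeff h k n (Finsupp.single μ p) = Finsupp.single μ (V.lower h k n p) := by
  rw [annihCoeff_eq, liftEnd_single]

variable (h k : ℂ)

/-- The commutator of two derivations is a derivation, so it suffices to evaluate it on the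
variables. -/
theorem pderiv_commute (i j : Boson × ℕ+) :
    Commute ((MvPolynomial.pderiv (R := ℂ) i).toLinearMap : Module.End ℂ Poly)
      ((MvPolynomial.pderiv (R := ℂ) j).toLinearMap) := by
  refine sub_eq_zero.1 ?_
  have : ⁅(MvPolynomial.pderiv (R := ℂ) i), (MvPolynomial.pderiv (R := ℂ) j)⁆ = 0 := by
    refine MvPolynomial.derivation_ext fun l => ?_
    rw [Derivation.commutator_apply]
    simp [MvPolynomial.pderiv_X, Pi.single_apply]
    split_ifs <;> simp
  refine LinearMap.ext fun p => ?_
  exact congrArg (fun D : Derivation ℂ Poly Poly => D p) this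

theorem annSeries_commute (V W : VertexOp) (i j : ℕ) :
    Commute (coeff i (V.annSeries h k)) (coeff j (W.annSeries h k)) :=
  posSeries_commute (fun m m' => Commute.sum_left _ _ _ fun b _ => Commute.sum_right _ _ _
    fun b' _ => ((((pderiv_commute (b, m) (b', m')).smul_right _).smul_right _).smul_left
        _).smul_left
      _) i j

theorem coeff_zero_annSeries (V : VertexOp) : coeff 0 (V.annSeries h k) = 0 :=
  coeff_zero_posSeries _

theorem coeff_zero_creSeries (V : VertexOp) : coeff 0 V.creSeries = 0 := coeff_zero_posSeries _

theorem coeff_zero_contraction (V W : VertexOp) : coeff 0 (contraction h k V W) = 0 :=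
  coeff_zero_posSeries _

theorem creSeries_mul (V W : VertexOp) : (V * W).creSeries = V.creSeries + W.creSeries := by
  rw [creSeries, creSeries, creSeries, ← posSeries_add]
  congr 1
  funext m
  change ∑ b, (V.create b m + W.create b m) • _ = _
  simp only [add_smul, Finset.sum_add_distrib]
  rfl

theorem annSeries_mul (V W : VertexOp) :
    (V * W).annSeries h k = V.annSeries h k + W.annSeries h k := by
  rw [annSeries, annSeries, annSeries, ← posSeries_add]
  congr 1
  funext m
  change ∑ b, (V.annih b m + W.annih b m) • _ = _
  simp only [add_smul, Finset.sum_add_distrib]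
  rfl

theorem cre_mul (V W : VertexOp) (n : ℕ) :
    (V * W).cre n = ∑ x ∈ antidiagonal n, V.cre x.1 * W.cre x.2 := by
  rw [cre, creSeries_mul, expSeries_add (coeff_zero_creSeries _) (coeff_zero_creSeries _)
    (fun _ _ => Commute.all _ _) (fun _ _ => Commute.all _ _) (fun _ _ => Commute.all _ _),
    coeff_mul]
  rfl

theorem lower_mul (V W : VertexOp) (n : ℕ) :
    (V * W).lower h k n = ∑ x ∈ antidiagonal n, V.lower h k x.1 * W.lower h k x.2 := by
  rw [lower, annSeries_mul, expSeries_add (coeff_zero_annSeries _ _ _)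
    (coeff_zero_annSeries _ _ _) (annSeries_commute h k V V) (annSeries_commute h k W W)
    (annSeries_commute h k V W), coeff_mul]
  rfl

theorem lower_commute (V W : VertexOp) (n m : ℕ) :
    Commute (V.lower h k n) (W.lower h k m) :=
  commute_expSeries (fun i => (commute_expSeries
    (fun j => annSeries_commute h k W V i j) n).symm) m

/-- The Euler equation writes `n` times the operator as a sum of products. After commuting the
factors, a first-order annihilation operator acts first and kills constants. -/
theorem lower_C (V : VertexOp) {n : ℕ} (hn : n ≠ 0) (c : ℂ) :
    V.lower h k n (MvPolynomial.C c) = 0 := by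
  have h1 : (n : ℂ) • V.lower h k n (MvPolynomial.C c) = 0 := by
    rw [← LinearMap.smul_apply, lower, ← coeff_euler, euler_expSeries (coeff_zero_annSeries h k V)
      (annSeries_commute h k V V), coeff_mul, LinearMap.sum_apply]
    refine Finset.sum_eq_zero fun x _ => ?_
    rw [coeff_euler, smul_mul_assoc, (commute_expSeries (fun j => annSeries_commute h k V V x.1 j)
      x.2).eq, LinearMap.smul_apply, Module.End.mul_apply]
    have : ∀ i, coeff i (V.annSeries h k) (MvPolynomial.C c) = 0 :=
      forall_coeff_posSeries (Q := fun _ (D : Module.End ℂ Poly) => D (MvPolynomial.C c) = 0) (by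
          simp)
        (fun m => by simp [LinearMap.sum_apply])
    rw [this, map_zero, smul_zero]
  exact (smul_eq_zero.1 h1).resolve_left (Nat.cast_ne_zero.2 hn)

/-- This is `expSeries_exchange` for the annihilation exponent of `V` and multiplication by the
creation exponent of `W`. The latter is linear in the variables, so the commutators are scalars,
which are the coefficients of `contraction`. -/
theorem lower_cre_mul (V W : VertexOp) (n l : ℕ) (r : Poly) :
    V.lower h k n (W.cre l * r) = ∑ x ∈ antidiagonal n,
      (if x.1 ≤ l then coeff x.1 (expSeries (contraction h k V W)) else 0) •
        (W.cre (l - x.1) * V.lower h k x.2 r) := by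
  set Q : PowerSeries (Module.End ℂ Poly) :=
    PowerSeries.map (Algebra.lmul ℂ Poly : Poly →+* Module.End ℂ Poly) W.creSeries with hQ
  have hQc : ∀ l, coeff l (expSeries Q) = Algebra.lmul ℂ Poly (W.cre l) := fun l => by
    rw [cre, map_expSeries (Algebra.lmul ℂ Poly)]
  have key := expSeries_exchange (P := V.annSeries h k) (Q := Q) (γ := contraction h k V W)
    (coeff_zero_annSeries h k V) (by rw [hQ, coeff_map, coeff_zero_creSeries, map_zero])
    (coeff_zero_contraction h k V W) (annSeries_commute h k V V)
    (fun i j => by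
      rw [hQ, coeff_map, coeff_map]
      exact (Commute.all _ _).map _) ?_ n l
  · have := congrArg (fun f : Module.End ℂ Poly => f r) key
    simp only [hQc, LinearMap.sum_apply, Module.End.mul_apply, LinearMap.smul_apply] at this
    exact this
  · intro i j
    rw [hQ, coeff_map]
    rcases Nat.eq_zero_or_pos i with rfl | hi
    · simp [coeff_zero_annSeries, coeff_zero_contraction]
    rcases Nat.eq_zero_or_pos j with rfl | hj
    · rw [coeff_zero_creSeries, map_zero, if_neg hi.ne', map_zero, mul_zero, zero_mul, sub_zero]
    obtain ⟨m, rfl⟩ : ∃ m : ℕ+, (m : ℕ) = i := ⟨⟨i, hi⟩, rfl⟩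
    obtain ⟨m', rfl⟩ : ∃ m : ℕ+, (m : ℕ) = j := ⟨⟨j, hj⟩, rfl⟩
    rw [annSeries, creSeries, contraction, coeff_posSeries, coeff_posSeries, coeff_posSeries]
    have h1 : ∀ b, (MvPolynomial.pderiv (R := ℂ) (b, m))
        (∑ b', W.create b' m' • MvPolynomial.X (b', m')) =
        MvPolynomial.C (if m = m' then W.create b m else 0) := fun b => by
      simp only [map_sum, Derivation.map_smul, MvPolynomial.pderiv_X, Pi.single_apply,
        Prod.mk.injEq]
      rw [Finset.sum_eq_single b (fun b' _ hb => by simp [hb]) (by simp)]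
      by_cases hm : m = m'
      · simp [hm, MvPolynomial.smul_eq_C_mul]
      · simp [hm, Ne.symm hm]
    refine LinearMap.ext fun p => ?_
    have h2 : ∀ x : Poly, (Algebra.lmul ℂ Poly : Poly →+* Module.End ℂ Poly) x p = x * p :=
      fun _ => rfl
    have h3 : ∀ x y : Poly, (Algebra.lmul ℂ Poly : Poly →+* Module.End ℂ Poly) x y = x * y :=
      fun _ _ => rfl
    simp only [LinearMap.sub_apply, Module.End.mul_apply, h2, h3, LinearMap.sum_apply,
      LinearMap.smul_apply, Derivation.coeFn_coe, Derivation.leibniz, h1,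
      Module.algebraMap_end_apply, PNat.coe_inj]
    simp only [smul_eq_mul, smul_add, Finset.sum_add_distrib, Finset.mul_sum, mul_smul_comm,
      add_sub_cancel_left]
    by_cases hm : m = m'
    · simp only [if_pos hm, Finset.sum_smul, MvPolynomial.smul_eq_C_mul, MvPolynomial.C_mul]
      exact Finset.sum_congr rfl fun b _ => by ring
    · simp [hm]

end VertexOp

/-! ### Modes of vertex operators on polynomials -/

/-- `operatorSum` defaults to `0` for families that are not locally finite. Finiteness on vectors of
a single charge extends to all vectors by linearity, so the default does not occur here. -/
theorem operatorSum_single {ι : Type} {T : ι → Module.End ℂ Fock} {σ : Charge}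
    {F : Charge → Poly → ι → Poly}
    (hT : ∀ i μ p, T i (Finsupp.single μ p) = Finsupp.single (μ + σ) (F μ p i))
    (hF : ∀ μ p, (Function.support (F μ p)).Finite) (μ : Charge) (p : Poly) :
    operatorSum T (Finsupp.single μ p) = Finsupp.single (μ + σ) (∑ᶠ i, F μ p i) := by
  have hfin : ∀ v, (Function.support fun i => T i v).Finite := fun v => by
    induction v using Finsupp.induction_linear with
    | zero => simp
    | add v w hv hw =>
      refine (hv.union hw).subset fun i hi => ?_
      by_contra h
      simp only [Set.mem_union, Function.mem_support, not_or, not_not] at h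
      exact hi (by simp only [map_add, h.1, h.2, add_zero])
    | single μ p =>
      refine (hF μ p).subset fun i hi h => hi ?_
      simp only
      rw [hT, h, Finsupp.single_zero]
  rw [operatorSum, dif_pos hfin]
  change ∑ᶠ i, T i (Finsupp.single μ p) = _
  simp only [hT]
  exact ((Finsupp.singleAddHom (μ + σ)).map_finsum (hF μ p)).symm

theorem finsum_antidiagonal {M : Type*} [AddCommMonoid M] {F : ℕ × ℕ → M}
    (hF : (Function.support F).Finite) :
    ∑ᶠ n : ℕ, ∑ x ∈ antidiagonal n, F x = ∑ᶠ x, F x := by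
  classical
  have h1 : ∀ n, ∑ x ∈ antidiagonal n, F x = ∑ x ∈ hF.toFinset with x.1 + x.2 = n, F x :=
    fun n => Eq.symm <| Finset.sum_subset
      (fun x hx => mem_antidiagonal.2 (Finset.mem_filter.1 hx).2)
      (fun x hx hx' => by
        by_contra h
        exact hx' (Finset.mem_filter.2 ⟨by simpa using h, mem_antidiagonal.1 hx⟩))
  rw [finsum_eq_sum_of_support_subset (s := hF.toFinset) F (by simp),
    finsum_eq_sum_of_support_subset (s := hF.toFinset.image fun x => x.1 + x.2)]
  · simp only [h1]
    exact Finset.sum_fiberwise_of_maps_to (fun x hx => Finset.mem_image_of_mem _ hx) F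
  · intro n hn
    obtain ⟨x, hx, hx'⟩ := Finset.exists_ne_zero_of_sum_ne_zero hn
    simp only [Finset.coe_image, Set.mem_image, Finset.mem_coe, Set.Finite.mem_toFinset]
    exact ⟨x, hx', mem_antidiagonal.1 hx⟩

namespace VertexOp

variable (h k : ℂ)

/-- This is `bracket_expSeries` with multiplication by one variable as the operator, whose
commutator with the annihilation exponent is a scalar in a single degree. It drives the finiteness
induction that follows. -/
theorem lower_X_mul (V : VertexOp) (i : Boson × ℕ+) (n : ℕ) (r : Poly) :
    V.lower h k n (MvPolynomial.X i * r) = MvPolynomial.X i * V.lower h k n r +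
      ∑ y ∈ antidiagonal n, (if y.1 = i.2 then V.annih i.1 i.2 * bracket h k i.1 i.2 else 0) •
        V.lower h k y.2 r := by
  have hs : ∀ n, (Algebra.lmul ℂ Poly (MvPolynomial.X i)) * coeff n (V.annSeries h k) -
      coeff n (V.annSeries h k) * (Algebra.lmul ℂ Poly (MvPolynomial.X i)) =
      algebraMap ℂ (Module.End ℂ Poly)
        (if n = i.2 then -(V.annih i.1 i.2 * bracket h k i.1 i.2) else 0) := by
    intro n
    rcases Nat.eq_zero_or_pos n with rfl | hn
    · rw [coeff_zero_annSeries, if_neg i.2.pos.ne, mul_zero, zero_mul, sub_zero, map_zero]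
    obtain ⟨m, rfl⟩ : ∃ m : ℕ+, (m : ℕ) = n := ⟨⟨n, hn⟩, rfl⟩
    obtain ⟨b, m'⟩ := i
    rw [annSeries, coeff_posSeries]
    refine LinearMap.ext fun p => ?_
    have h2 : ∀ x y : Poly, Algebra.lmul ℂ Poly x y = x * y := fun _ _ => rfl
    simp only [LinearMap.sub_apply, Module.End.mul_apply, h2, LinearMap.sum_apply,
      LinearMap.smul_apply, Derivation.coeFn_coe, Derivation.leibniz, MvPolynomial.pderiv_X,
      Module.algebraMap_end_apply, PNat.coe_inj, Pi.single_apply, Prod.mk.injEq]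
    simp only [smul_eq_mul, smul_add, Finset.sum_add_distrib, Finset.mul_sum, mul_smul_comm,
      sub_add_cancel_left]
    rw [Finset.sum_eq_single b (fun b' _ hb => by simp [hb.symm]) (by simp)]
    by_cases hm : m = m'
    · simp [hm, mul_smul]
    · simp [hm, Ne.symm hm]
  have key := congrArg (fun f : Module.End ℂ Poly => f r)
    (bracket_expSeries (coeff_zero_annSeries h k V) (annSeries_commute h k V V) hs
      (if_neg i.2.pos.ne) n)
  simp only [LinearMap.sub_apply, Module.End.mul_apply, LinearMap.sum_apply,
    LinearMap.smul_apply] at key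
  rw [sub_eq_iff_eq_add'] at key
  change MvPolynomial.X i * V.lower h k n r = V.lower h k n (MvPolynomial.X i * r) + _ at key
  rw [key, add_assoc, left_eq_add, ← Finset.sum_add_distrib]
  refine Finset.sum_eq_zero fun y _ => ?_
  rw [lower, ← add_smul]
  split_ifs <;> simp

/-- Multiplying by a variable of mode number `m` raises the vanishing bound by at most `m`. This is
the local finiteness that makes currents well defined. -/
theorem exists_lower_eq_zero (V : VertexOp) (p : Poly) :
    ∃ N, ∀ n ≥ N, V.lower h k n p = 0 := by
  induction p using MvPolynomial.induction_on with
  | C c => exact ⟨1, fun n hn => lower_C h k V (by omega) c⟩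
  | add p q hp hq =>
    obtain ⟨N, hN⟩ := hp
    obtain ⟨N', hN'⟩ := hq
    exact ⟨max N N', fun n hn => by
      rw [map_add, hN n (le_of_max_le_left hn), hN' n (le_of_max_le_right hn), add_zero]⟩
  | mul_X p i hp =>
    obtain ⟨N, hN⟩ := hp
    refine ⟨N + i.2, fun n hn => ?_⟩
    rw [mul_comm, lower_X_mul, hN n (by omega), mul_zero, zero_add]
    refine Finset.sum_eq_zero fun y hy => ?_
    have := mem_antidiagonal.1 hy
    split_ifs with hy'
    · rw [hN _ (by omega), smul_zero]
    · rw [zero_smul]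

theorem finite_support_lower (V : VertexOp) (p : Poly) :
    (Function.support fun n => V.lower h k n p).Finite := by
  obtain ⟨N, hN⟩ := exists_lower_eq_zero h k V p
  exact (Set.finite_Iio N).subset fun n hn => by
    by_contra hn'
    exact hn (hN n (by simpa using hn'))

theorem lower_lower_comm (V W : VertexOp) (n m : ℕ) (p : Poly) :
    V.lower h k n (W.lower h k m p) = W.lower h k m (V.lower h k n p) :=
  congrArg (fun f : Module.End ℂ Poly => f p) (lower_commute h k V W n m).eq

theorem finite_support_lower₂ (V W : VertexOp) (p : Poly) :
    (Function.support fun x : ℕ × ℕ => V.lower h k x.1 (W.lower h k x.2 p)).Finite := by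
  refine ((finite_support_lower h k V p).prod (finite_support_lower h k W p)).subset
    fun x hx => ⟨fun h1 => hx ?_, fun h1 => hx ?_⟩
  · simp only at h1 ⊢
    rw [lower_lower_comm, h1, map_zero]
  · simp only at h1 ⊢
    rw [h1, map_zero]

open Classical in
/-- The coefficient of `z ^ s` in the creation part, for a complex exponent `s`. -/
def creC (V : VertexOp) (s : ℂ) : Poly := if hs : ∃ n : ℕ, (n : ℂ) = s then V.cre hs.choose else 0

theorem creC_natCast (V : VertexOp) (n : ℕ) : V.creC n = V.cre n := by
  have hs : ∃ m : ℕ, (m : ℂ) = (n : ℂ) := ⟨n, rfl⟩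
  rw [creC, dif_pos hs, Nat.cast_injective hs.choose_spec]

theorem creC_eq_zero (V : VertexOp) {s : ℂ} (hs : ∀ n : ℕ, (n : ℂ) ≠ s) : V.creC s = 0 := by
  rw [creC, dif_neg (by push Not; exact hs)]

/-- As `creC` vanishes off the natural numbers, the side condition of `lower_cre_mul` disappears,
and the summations below need no case distinction. -/
theorem lower_creC_mul (V W : VertexOp) (n : ℕ) (s : ℂ) (r : Poly) :
    V.lower h k n (W.creC s * r) = ∑ x ∈ antidiagonal n,
      coeff x.1 (expSeries (contraction h k V W)) •
        (W.creC (s - x.1) * V.lower h k x.2 r) := by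
  by_cases hs : ∃ l : ℕ, (l : ℂ) = s
  · obtain ⟨l, rfl⟩ := hs
    rw [creC_natCast, lower_cre_mul]
    refine Finset.sum_congr rfl fun x _ => ?_
    split_ifs with hx
    · rw [← Nat.cast_sub hx, creC_natCast]
    · rw [zero_smul, creC_eq_zero, zero_mul, smul_zero]
      intro m hm
      rw [eq_sub_iff_add_eq, ← Nat.cast_add, Nat.cast_inj] at hm
      omega
  · push Not at hs
    rw [creC_eq_zero W hs, zero_mul, map_zero]
    refine (Finset.sum_eq_zero fun x _ => ?_).symm
    rw [creC_eq_zero, zero_mul, smul_zero]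
    intro m hm
    exact hs (m + x.1) (by push_cast; rw [hm]; ring)

/-- The grading of polynomials by the total mode number. -/
def modeWeight : Boson × ℕ+ → ℕ := fun i => i.2

theorem isWeightedHomogeneous_cre (V : VertexOp) (n : ℕ) :
    MvPolynomial.IsWeightedHomogeneous modeWeight (V.cre n) n := by
  have h1 : ∀ n, MvPolynomial.IsWeightedHomogeneous modeWeight (coeff n V.creSeries) n :=
    forall_coeff_posSeries
      (Q := fun n (p : Poly) => MvPolynomial.IsWeightedHomogeneous modeWeight p n)
      (MvPolynomial.isWeightedHomogeneous_zero _ _ _) fun m => by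
        refine MvPolynomial.IsWeightedHomogeneous.sum _ _ _ fun b _ => ?_
        rw [MvPolynomial.smul_eq_C_mul]
        exact (MvPolynomial.isWeightedHomogeneous_X ℂ modeWeight (b, m)).C_mul _
  have h2 : ∀ j n, MvPolynomial.IsWeightedHomogeneous modeWeight (coeff n (V.creSeries ^ j)) n := by
    intro j
    induction j with
    | zero =>
      intro n
      rw [pow_zero, coeff_one]
      split_ifs with hn
      · rw [hn]; exact MvPolynomial.isWeightedHomogeneous_one _ _
      · exact MvPolynomial.isWeightedHomogeneous_zero _ _ _
    | succ j ih =>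
      intro n
      rw [pow_succ', coeff_mul]
      refine MvPolynomial.IsWeightedHomogeneous.sum _ _ _ fun x hx => ?_
      rw [← mem_antidiagonal.1 hx]
      exact (h1 _).mul (ih _)
  rw [cre, expSeries, coeff_mk]
  refine MvPolynomial.IsWeightedHomogeneous.sum _ _ _ fun j _ => ?_
  rw [MvPolynomial.smul_eq_C_mul]
  exact (h2 _ _).C_mul _

/-- The creation coefficient is homogeneous of weight `n`, so it cannot divide into a monomial of
smaller weight. For a fixed matrix element this bounds the creation degrees. -/
theorem coeff_cre_mul_eq_zero (V : VertexOp) {n : ℕ} {d : (Boson × ℕ+) →₀ ℕ}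
    (hn : Finsupp.weight modeWeight d < n) (r : Poly) : MvPolynomial.coeff d (V.cre n * r) = 0 := by
  classical
  rw [MvPolynomial.coeff_mul]
  refine Finset.sum_eq_zero fun x hx => ?_
  have hx := mem_antidiagonal.1 hx
  have : MvPolynomial.coeff x.1 (V.cre n) = 0 := by
    by_contra h0
    have h1 := isWeightedHomogeneous_cre V n h0
    rw [← hx, map_add, h1] at hn
    omega
  rw [this, zero_mul]

/-- The coefficient of `z ^ s` in the product of the creation and the annihilation part. -/
def mode (V : VertexOp) (s : ℂ) (p : Poly) : Poly :=
  ∑ᶠ n : ℕ, V.creC (s + n) * V.lower h k n p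

/-- The coefficient of `z ^ s w ^ t` in the normally ordered product of the creation and the
annihilation parts of `V(z)` and `W(w)`. -/
def mode₂ (V W : VertexOp) (s t : ℂ) (p : Poly) : Poly :=
  ∑ᶠ x : ℕ × ℕ, V.creC (s + x.1) * W.creC (t + x.2) * V.lower h k x.1 (W.lower h k x.2 p)

/-- The exponent of `q` in `q ^ {∑_b qExp b · b_0}` on the Fock module of charge `μ`. -/
def qExponent (V : VertexOp) (μ : Charge) : ℂ := ∑ b, V.qExp b * zeroMode μ b

/-! ### Currents and normally ordered products in terms of modes on polynomials -/

theorem diagonal_single (g : Charge → ℂ) (μ : Charge) (p : Poly) :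
    diagonal g (Finsupp.single μ p) = Finsupp.single μ (g μ • p) := by
  simp [diagonal]

theorem chargeShift_single (σ μ : Charge) (p : Poly) :
    chargeShift σ (Finsupp.single μ p) = Finsupp.single (μ + σ) p := by
  simp [chargeShift]

theorem zPart_single (V : VertexOp) (s : ℂ) (μ : Charge) (p : Poly) [Decidable (V.zExponent μ =
    s)] :
    V.zPart s (Finsupp.single μ p) =
      Finsupp.single μ (if V.zExponent μ = s then p else 0) := by
  rw [zPart, diagonal_single]
  split_ifs <;> simp

theorem qPart_single (V : VertexOp) (μ : Charge) (p : Poly) :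
    V.qPart h (Finsupp.single μ p) = Finsupp.single μ (qPow h (V.qExponent μ) • p) :=
  diagonal_single _ _ _

theorem creC_mul_eq_finsum (V : VertexOp) (s : ℂ) (r : Poly) [∀ n : ℕ, Decidable ((n : ℂ) = s)] :
    V.creC s * r = ∑ᶠ n : ℕ, if (n : ℂ) = s then V.cre n * r else 0 := by
  by_cases hs : ∃ l : ℕ, (l : ℂ) = s
  · obtain ⟨l, rfl⟩ := hs
    rw [creC_natCast, finsum_eq_single _ l, if_pos rfl]
    intro n hn
    rw [if_neg (by exact_mod_cast hn)]
  · push Not at hs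
    rw [creC_eq_zero V hs, zero_mul]
    refine (finsum_eq_zero_of_forall_eq_zero fun n => ?_).symm
    rw [if_neg (hs n)]

theorem finite_support_cre (V : VertexOp) (s : ℂ) {f : ℕ → Poly}
    (hf : (Function.support f).Finite) [∀ x : ℕ × ℕ, Decidable ((x.1 : ℂ) = s + x.2)] :
    (Function.support fun x : ℕ × ℕ =>
      if (x.1 : ℂ) = s + x.2 then V.cre x.1 * f x.2 else 0).Finite := by
  have h1 : ∀ x ∈ (Function.support fun x : ℕ × ℕ =>
      if (x.1 : ℂ) = s + x.2 then V.cre x.1 * f x.2 else 0), (x.1 : ℂ) = s + x.2 :=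
    fun x hx => by
      by_contra h1
      exact hx (if_neg h1)
  refine Set.Finite.of_finite_image (f := Prod.snd) (hf.subset ?_) fun x hx y hy hxy => ?_
  · rintro _ ⟨x, hx, rfl⟩ h0
    refine hx ?_
    simp only
    rw [h0, mul_zero, ite_self]
  · refine Prod.ext ?_ hxy
    have := (h1 x hx).trans ((congrArg (fun n : ℕ => s + (n : ℂ)) hxy).trans (h1 y hy).symm)
    exact_mod_cast this

theorem finsum_cre (V : VertexOp) (s : ℂ) {f : ℕ → Poly}
    (hf : (Function.support f).Finite) [∀ x : ℕ × ℕ, Decidable ((x.1 : ℂ) = s + x.2)] :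
    ∑ᶠ x : ℕ × ℕ, (if (x.1 : ℂ) = s + x.2 then V.cre x.1 * f x.2 else 0) =
      ∑ᶠ n : ℕ, V.creC (s + n) * f n := by
  rw [← finsum_comp_equiv (Equiv.prodComm ℕ ℕ), finsum_curry]
  · refine finsum_congr fun n => ?_
    classical
    rw [creC_mul_eq_finsum]
    exact finsum_congr fun m => by
      simp only [Equiv.prodComm_apply, Prod.fst_swap, Prod.snd_swap]
      congr
  · exact (finite_support_cre V s hf).preimage (Equiv.prodComm ℕ ℕ).injective.injOn

/-- The charge enters only through the target module, a scalar power of `q` and a shift of the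
exponent of `z`. All the rest is the charge-independent `mode`. -/
theorem current_single (V : VertexOp) (a : ℂ) (μ : Charge) (p : Poly) :
    V.current h k a (Finsupp.single μ p) = Finsupp.single (μ + V.shift)
      ((V.scalar * qPow h (V.qExponent μ)) • mode h k V (a - V.zExponent μ) p) := by
  classical
  have hiff : ∀ (μ : Charge) (n : ℕ × ℕ),
      V.zExponent μ = a - n.1 + n.2 ↔ (n.1 : ℂ) = (a - V.zExponent μ) + n.2 :=
    fun μ n => ⟨fun e => by rw [e]; ring, fun e => by rw [e]; ring⟩
  have hfin : ∀ (c : ℂ) (p : Poly),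
      (Function.support fun n : ℕ => c • V.lower h k n p).Finite := fun c p =>
    (finite_support_lower h k V p).subset
      fun n hn h0 => hn (by simp only at h0 ⊢; rw [h0, smul_zero])
  rw [current, LinearMap.smul_apply, operatorSum_single (σ := V.shift)
    (F := fun μ p n => if (n.1 : ℂ) = (a - V.zExponent μ) + n.2 then
      V.cre n.1 * (qPow h (V.qExponent μ) • V.lower h k n.2 p) else 0),
      finsum_cre V (a - V.zExponent μ) (f := fun n => qPow h (V.qExponent μ) • V.lower h k n p)
        (hfin _ _), ← smul_smul, Finsupp.smul_single]
  · congr 2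
    rw [mode, smul_finsum' _ ((finite_support_lower h k V p).subset ?_)]
    · exact finsum_congr fun n => by rw [mul_smul_comm]
    · exact fun n hn h0 => hn (by simp only at h0 ⊢; rw [h0, mul_zero])
  · intro n μ p
    simp only [Module.End.mul_apply]
    rw [annihCoeff_single, qPart_single, zPart_single, chargeShift_single, createCoeff_single]
    simp only [hiff]
    split_ifs <;> simp
  · intro μ p
    exact finite_support_cre V _ (hfin _ _)

theorem finite_support_cre₂ (V W : VertexOp) (s t : ℂ) {f : ℕ × ℕ → Poly}
    (hf : (Function.support f).Finite)
    [∀ x : (ℕ × ℕ) × (ℕ × ℕ), Decidable ((x.1.1 : ℂ) = s + x.1.2 ∧ (x.2.1 : ℂ) = t + x.2.2)] :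
    (Function.support fun x : (ℕ × ℕ) × (ℕ × ℕ) =>
      if (x.1.1 : ℂ) = s + x.1.2 ∧ (x.2.1 : ℂ) = t + x.2.2 then
        V.cre x.1.1 * W.cre x.2.1 * f (x.1.2, x.2.2) else 0).Finite := by
  refine Set.Finite.of_finite_image (f := fun x => (x.1.2, x.2.2)) (hf.subset ?_)
    fun x hx y hy hxy => ?_
  · rintro _ ⟨x, hx, rfl⟩ h0
    refine hx ?_
    simp only at h0 ⊢
    rw [h0, mul_zero, ite_self]
  · have h1 := (ite_ne_right_iff.1 hx).1
    have h2 := (ite_ne_right_iff.1 hy).1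
    simp only [Prod.mk.injEq] at hxy
    have h3 : x.1.1 = y.1.1 := by
      have := h1.1.trans ((congrArg (fun n : ℕ => s + (n : ℂ)) hxy.1).trans h2.1.symm)
      exact_mod_cast this
    have h4 : x.2.1 = y.2.1 := by
      have := h1.2.trans ((congrArg (fun n : ℕ => t + (n : ℂ)) hxy.2).trans h2.2.symm)
      exact_mod_cast this
    exact Prod.ext (Prod.ext h3 hxy.1) (Prod.ext h4 hxy.2)

theorem creC_mul_creC_mul_eq_finsum (V W : VertexOp) (s t : ℂ) (r : Poly)
    [∀ n : ℕ × ℕ, Decidable ((n.1 : ℂ) = s ∧ (n.2 : ℂ) = t)] :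
    V.creC s * W.creC t * r = ∑ᶠ n : ℕ × ℕ,
      if (n.1 : ℂ) = s ∧ (n.2 : ℂ) = t then V.cre n.1 * W.cre n.2 * r else 0 := by
  by_cases hs : ∃ l : ℕ × ℕ, (l.1 : ℂ) = s ∧ (l.2 : ℂ) = t
  · obtain ⟨l, rfl, rfl⟩ := hs
    rw [creC_natCast, creC_natCast, finsum_eq_single _ l, if_pos ⟨rfl, rfl⟩]
    intro n hn
    rw [if_neg]
    rintro ⟨h1, h2⟩
    exact hn (Prod.ext (by exact_mod_cast h1) (by exact_mod_cast h2))
  · rw [finsum_eq_zero_of_forall_eq_zero fun n => if_neg fun hn => hs ⟨n, hn⟩]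
    by_cases h1 : ∃ n : ℕ, (n : ℂ) = s
    · rw [creC_eq_zero W fun m hm => hs ⟨(h1.choose, m), h1.choose_spec, hm⟩, mul_zero, zero_mul]
    · push Not at h1
      rw [creC_eq_zero V h1, zero_mul, zero_mul]

theorem finsum_cre₂ (V W : VertexOp) (s t : ℂ) {f : ℕ × ℕ → Poly}
    (hf : (Function.support f).Finite)
    [∀ x : (ℕ × ℕ) × (ℕ × ℕ), Decidable ((x.1.1 : ℂ) = s + x.1.2 ∧ (x.2.1 : ℂ) = t + x.2.2)] :
    ∑ᶠ x : (ℕ × ℕ) × (ℕ × ℕ), (if (x.1.1 : ℂ) = s + x.1.2 ∧ (x.2.1 : ℂ) = t + x.2.2 then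
        V.cre x.1.1 * W.cre x.2.1 * f (x.1.2, x.2.2) else 0) =
      ∑ᶠ x : ℕ × ℕ, V.creC (s + x.1) * W.creC (t + x.2) * f x := by
  rw [← finsum_comp_equiv ((Equiv.prodComm _ _).trans (Equiv.prodProdProdComm ℕ ℕ ℕ ℕ)),
    finsum_curry]
  · refine finsum_congr fun n => ?_
    classical
    rw [creC_mul_creC_mul_eq_finsum]
    exact finsum_congr fun m => by
      simp only [Equiv.trans_apply, Equiv.prodComm_apply, Prod.swap_prod_mk,
        Equiv.prodProdProdComm_apply]
  · exact (finite_support_cre₂ V W s t hf).preimage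
      (((Equiv.prodComm _ _).trans (Equiv.prodProdProdComm ℕ ℕ ℕ ℕ)).injective.injOn)

theorem normalProduct_single (V W : VertexOp) (a b : ℂ) (μ : Charge) (p : Poly) :
    V.normalProduct h k W a b (Finsupp.single μ p) = Finsupp.single (μ + (V.shift + W.shift))
      ((V.scalar * W.scalar * (qPow h (V.qExponent μ) * qPow h (W.qExponent μ))) •
        mode₂ h k V W (a - V.zExponent μ) (b - W.zExponent μ) p) := by
  classical
  have hiff : ∀ (U : VertexOp) (a : ℂ) (μ : Charge) (n : ℕ × ℕ),
      U.zExponent μ = a - n.1 + n.2 ↔ (n.1 : ℂ) = (a - U.zExponent μ) + n.2 :=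
    fun U a μ n => ⟨fun e => by rw [e]; ring, fun e => by rw [e]; ring⟩
  have hfin : ∀ (c : ℂ) (p : Poly),
      (Function.support fun n : ℕ × ℕ => c • V.lower h k n.1 (W.lower h k n.2 p)).Finite :=
    fun c p => (finite_support_lower₂ h k V W p).subset
      fun n hn h0 => hn (by simp only at h0 ⊢; rw [h0, smul_zero])
  rw [normalProduct, LinearMap.smul_apply, operatorSum_single (σ := V.shift + W.shift)
    (F := fun μ p n => if (n.1.1 : ℂ) = (a - V.zExponent μ) + n.1.2 ∧
        (n.2.1 : ℂ) = (b - W.zExponent μ) + n.2.2 then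
      V.cre n.1.1 * W.cre n.2.1 * ((qPow h (V.qExponent μ) * qPow h (W.qExponent μ)) •
        V.lower h k n.1.2 (W.lower h k n.2.2 p)) else 0),
      finsum_cre₂ V W (a - V.zExponent μ) (b - W.zExponent μ)
        (f := fun n => (qPow h (V.qExponent μ) * qPow h (W.qExponent μ)) •
          V.lower h k n.1 (W.lower h k n.2 p)) (hfin _ _),
      mul_smul (V.scalar * W.scalar), ← Finsupp.smul_single]
  · congr 2
    rw [mode₂, smul_finsum' _ ((finite_support_lower₂ h k V W p).subset ?_)]
    · exact finsum_congr fun n => by rw [mul_smul_comm]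
    · exact fun n hn h0 => hn (by simp only at h0 ⊢; rw [h0, mul_zero])
  · intro n μ p
    simp only [Module.End.mul_apply]
    rw [annihCoeff_single, annihCoeff_single, qPart_single, qPart_single, zPart_single,
      zPart_single, chargeShift_single, createCoeff_single, createCoeff_single]
    simp only [hiff]
    by_cases h1 : (n.1.1 : ℂ) = (a - V.zExponent μ) + n.1.2
    · by_cases h2 : (n.2.1 : ℂ) = (b - W.zExponent μ) + n.2.2
      · rw [if_pos h1, if_pos h2, if_pos ⟨h1, h2⟩, smul_smul, mul_assoc]
      · simp [h2]
    · simp [h1]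
  · intro μ p
    exact finite_support_cre₂ V W _ _ (hfin _ _)

end VertexOp

/-! ### Products of vertex operators -/

theorem finsum_comm_of_finite {α β M : Type*} [AddCommMonoid M] {f : α → β → M}
    (hf : (Function.support fun x : α × β => f x.1 x.2).Finite) :
    ∑ᶠ a, ∑ᶠ b, f a b = ∑ᶠ b, ∑ᶠ a, f a b := by
  rw [← finsum_curry (fun x : α × β => f x.1 x.2) hf, ← finsum_comp_equiv (Equiv.prodComm β α),
    finsum_curry]
  · rfl
  · exact hf.preimage (Equiv.prodComm β α).injective.injOn

namespace VertexOp

variable (h k : ℂ)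

theorem finite_support_mode₂ (V W : VertexOp) (s t : ℂ) (p : Poly) :
    (Function.support fun x : ℕ × ℕ =>
      V.creC (s + x.1) * W.creC (t + x.2) * V.lower h k x.1 (W.lower h k x.2 p)).Finite :=
  (finite_support_lower₂ h k V W p).subset fun x hx h0 => hx (by simp only at h0 ⊢; rw [h0,
      mul_zero])

theorem exists_creC_sub_eq_zero (W : VertexOp) (t : ℂ) :
    ∃ J, ∀ j : ℕ, J ≤ j → W.creC (t - j) = 0 := by
  obtain ⟨J, hJ⟩ := exists_nat_gt t.re
  refine ⟨J, fun j hj => creC_eq_zero W fun n hn => ?_⟩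
  have h1 := congrArg Complex.re hn
  simp only [Complex.natCast_re, Complex.sub_re] at h1
  have h2 : (J : ℝ) ≤ j := by exact_mod_cast hj
  have h3 : (0 : ℝ) ≤ n := n.cast_nonneg
  linarith

/-- The terms of the operator product expansion. -/
theorem finite_support_ope (V W : VertexOp) (g : ℕ → ℂ) (s t : ℂ) (p : Poly) :
    (Function.support fun y : ℕ × (ℕ × ℕ) => g y.1 • (V.creC (s + y.1 + y.2.1) *
      W.creC (t - y.1 + y.2.2) * V.lower h k y.2.1 (W.lower h k y.2.2 p))).Finite := by
  have hS := finite_support_lower₂ h k V W p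
  choose J hJ using fun m : ℕ => exists_creC_sub_eq_zero W (t + m)
  refine ((Set.Finite.biUnion hS fun x _ =>
    ((Set.finite_Iio (J x.2)).prod (Set.finite_singleton x)))).subset fun y hy => ?_
  have hy1 : V.lower h k y.2.1 (W.lower h k y.2.2 p) ≠ 0 := fun h0 => hy (by
    simp only; rw [h0, mul_zero, smul_zero])
  refine Set.mem_biUnion (x := y.2) hy1 ⟨?_, rfl⟩
  by_contra h0
  refine hy ?_
  have : t - y.1 + y.2.2 = t + y.2.2 - y.1 := by ring
  simp only
  rw [this, hJ y.2.2 y.1 (by simpa using h0), mul_zero, zero_mul, smul_zero]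

/-- Moving the annihilation part of `V` through the creation part of `W` gives the contraction. Its
term of degree `j` in `w / z` shifts the two exponents by `j` in opposite directions. What remains
is rearrangement of finite sums. -/
theorem mode_mode (V W : VertexOp) (s t : ℂ) (p : Poly) :
    mode h k V s (mode h k W t p) = ∑ᶠ j : ℕ,
      coeff j (expSeries (contraction h k V W)) • mode₂ h k V W (s + j) (t - j) p := by
  set g : ℕ → ℂ := fun j => coeff j (expSeries (contraction h k V W)) with hg
  set F : ℕ × (ℕ × ℕ) → Poly := fun y => g y.1 • (V.creC (s + y.1 + y.2.1) *
      W.creC (t - y.1 + y.2.2) * V.lower h k y.2.1 (W.lower h k y.2.2 p)) with hF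
  have hfin : (Function.support F).Finite := finite_support_ope h k V W g s t p
  have hR : ∑ᶠ j : ℕ, g j • mode₂ h k V W (s + j) (t - j) p = ∑ᶠ y, F y := by
    rw [finsum_curry F hfin]
    refine finsum_congr fun j => ?_
    rw [mode₂, smul_finsum' _ (finite_support_mode₂ h k V W _ _ p)]
  rw [hR]
  set e : (ℕ × ℕ) × ℕ ≃ ℕ × (ℕ × ℕ) := Equiv.prodAssoc ℕ ℕ ℕ with he
  have hfin' : (Function.support fun y : (ℕ × ℕ) × ℕ => F (e y)).Finite :=
    hfin.preimage e.injective.injOn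
  rw [← finsum_comp_equiv e, ← finsum_comp_equiv (Equiv.prodComm ℕ (ℕ × ℕ)), finsum_curry]
  swap
  · exact hfin'.preimage (Equiv.prodComm ℕ (ℕ × ℕ)).injective.injOn
  have hfm : ∀ m, (Function.support fun x : ℕ × ℕ => F (e (x, m))).Finite := fun m =>
    hfin'.preimage fun _ _ _ _ hxy => (Prod.mk.injEq _ _ _ _ ▸ hxy).1
  have hterm : ∀ n m : ℕ, V.creC (s + n) * V.lower h k n (W.creC (t + m) * W.lower h k m p) =
      ∑ x ∈ antidiagonal n, F (e (x, m)) := fun n m => by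
    rw [lower_creC_mul, Finset.mul_sum]
    refine Finset.sum_congr rfl fun x hx => ?_
    rw [← mem_antidiagonal.1 hx, mul_smul_comm, ← mul_assoc]
    simp only [hF, he, Equiv.prodAssoc_apply]
    push_cast
    rw [add_assoc s, show t - (x.1 : ℂ) + m = t + m - x.1 by ring]
  have hW : (Function.support fun m : ℕ => W.creC (t + m) * W.lower h k m p).Finite :=
    (finite_support_lower h k W p).subset fun x hx h0 => hx (by simp only at h0 ⊢; rw [h0,
        mul_zero])
  have hL : ∀ n : ℕ, V.creC (s + n) * V.lower h k n (mode h k W t p) =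
      ∑ᶠ m : ℕ, V.creC (s + n) * V.lower h k n (W.creC (t + m) * W.lower h k m p) := fun n => by
    rw [mode]
    exact (AddMonoidHom.mulLeft (V.creC (s + n)) |>.comp (V.lower h k n).toAddMonoidHom).map_finsum
      hW
  rw [mode, finsum_congr hL]
  rw [finsum_comm_of_finite]
  · refine finsum_congr fun m => ?_
    simp only [hterm]
    exact finsum_antidiagonal (hfm m)
  · simp only [hterm]
    refine (hfin'.image fun x => (x.1.1 + x.1.2, x.2)).subset fun x hx => ?_
    obtain ⟨y, hy, hy'⟩ := Finset.exists_ne_zero_of_sum_ne_zero hx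
    exact ⟨(y, x.2), hy', Prod.ext (mem_antidiagonal.1 hy) rfl⟩

theorem mode₂_comm (V W : VertexOp) (s t : ℂ) (p : Poly) :
    mode₂ h k V W s t p = mode₂ h k W V t s p := by
  rw [mode₂, mode₂, ← finsum_comp_equiv (Equiv.prodComm ℕ ℕ)]
  refine finsum_congr fun x => ?_
  simp only [Equiv.prodComm_apply, Prod.fst_swap, Prod.snd_swap]
  rw [lower_lower_comm, mul_comm (V.creC _)]

/-! ### Rescaling of the variable and normally ordered products at one point -/

theorem qPow_mul_natCast (x : ℂ) (n : ℕ) : qPow h (x * n) = qPow h x ^ n := by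
  rw [qPow, qPow, ← Complex.exp_nat_mul]
  ring_nf

theorem creC_at_qPow (V : VertexOp) (x s : ℂ) :
    (V.at_qPow h x).creC s = qPow h (x * s) • V.creC s := by
  by_cases hs : ∃ n : ℕ, (n : ℂ) = s
  · obtain ⟨n, rfl⟩ := hs
    rw [creC_natCast, creC_natCast, qPow_mul_natCast]
    refine coeff_expSeries_rescale (coeff_zero_creSeries V) (fun _ _ => Commute.all _ _) _
      (fun n => ?_) n
    rcases Nat.eq_zero_or_pos n with rfl | hn
    · simp only [coeff_zero_creSeries, smul_zero]
    obtain ⟨m, rfl⟩ : ∃ m : ℕ+, (m : ℕ) = n := ⟨⟨n, hn⟩, rfl⟩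
    rw [creSeries, creSeries, coeff_posSeries, coeff_posSeries, Finset.smul_sum,
      ← qPow_mul_natCast]
    exact Finset.sum_congr rfl fun b _ => mul_smul _ _ _
  · push Not at hs
    rw [creC_eq_zero _ hs, creC_eq_zero _ hs, smul_zero]

theorem lower_at_qPow (V : VertexOp) (x : ℂ) (n : ℕ) :
    (V.at_qPow h x).lower h k n = qPow h (-(x * n)) • V.lower h k n := by
  rw [← neg_mul, qPow_mul_natCast]
  refine coeff_expSeries_rescale (coeff_zero_annSeries h k V) (annSeries_commute h k V V) _
    (fun n => ?_) n
  rcases Nat.eq_zero_or_pos n with rfl | hn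
  · simp only [coeff_zero_annSeries, smul_zero]
  obtain ⟨m, rfl⟩ : ∃ m : ℕ+, (m : ℕ) = n := ⟨⟨n, hn⟩, rfl⟩
  rw [annSeries, annSeries, coeff_posSeries, coeff_posSeries, Finset.smul_sum,
    ← qPow_mul_natCast, neg_mul]
  exact Finset.sum_congr rfl fun b _ => mul_smul _ _ _

/-- The factor `q ^ (x (t + n))` from creation and `q ^ (-x n)` from annihilation combine to a
factor independent of the summation index. -/
theorem mode₂_at_qPow (V W : VertexOp) (x s t : ℂ) (p : Poly) :
    mode₂ h k V (W.at_qPow h x) s t p = qPow h (x * t) • mode₂ h k V W s t p := by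
  rw [mode₂, mode₂, smul_finsum' _ (finite_support_mode₂ h k V W s t p)]
  refine finsum_congr fun y => ?_
  rw [creC_at_qPow, lower_at_qPow, LinearMap.smul_apply, map_smul, mul_smul_comm, mul_smul_comm,
    smul_mul_assoc, smul_smul]
  congr 1
  rw [qPow, qPow, qPow, ← Complex.exp_add]
  ring_nf

theorem creC_sub_mul_creC_ne_zero {V W : VertexOp} {w : ℂ} {n : ℤ}
    (hn : V.creC (w - n) * W.creC n ≠ 0) : ∃ i j : ℕ, w = i + j ∧ n = j := by
  have h1 := left_ne_zero_of_mul hn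
  have h2 := right_ne_zero_of_mul hn
  obtain ⟨i, hi⟩ : ∃ i : ℕ, (i : ℂ) = w - n := by
    by_contra h0; push Not at h0; exact h1 (creC_eq_zero V h0)
  obtain ⟨j, hj⟩ : ∃ j : ℕ, (j : ℂ) = n := by
    by_contra h0; push Not at h0; exact h2 (creC_eq_zero W h0)
  refine ⟨i, j, ?_, by exact_mod_cast hj.symm⟩
  rw [hi, hj]; ring

theorem finite_support_creC_mul (V W : VertexOp) (w : ℂ) :
    (Function.support fun n : ℤ => V.creC (w - n) * W.creC n).Finite := by
  by_cases hw : ∃ N : ℕ, (N : ℂ) = w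
  · obtain ⟨N, rfl⟩ := hw
    refine (Set.finite_Icc (0 : ℤ) N).subset fun n hn => ?_
    obtain ⟨i, j, h1, rfl⟩ := creC_sub_mul_creC_ne_zero hn
    have : N = i + j := by exact_mod_cast h1
    constructor <;> omega
  · refine Set.finite_empty.subset fun n hn => hw ?_
    obtain ⟨i, j, h1, -⟩ := creC_sub_mul_creC_ne_zero hn
    exact ⟨i + j, by rw [h1]; push_cast; rfl⟩

theorem creC_mul (V W : VertexOp) (w : ℂ) :
    (V * W).creC w = ∑ᶠ n : ℤ, V.creC (w - n) * W.creC n := by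
  by_cases hw : ∃ N : ℕ, (N : ℂ) = w
  · obtain ⟨N, rfl⟩ := hw
    rw [creC_natCast, cre_mul, finsum_eq_sum_of_support_subset
      (s := (antidiagonal N).image fun x => (x.2 : ℤ))]
    · rw [Finset.sum_image]
      · refine Finset.sum_congr rfl fun x hx => ?_
        rw [← mem_antidiagonal.1 hx, Nat.cast_add, Int.cast_natCast, add_sub_cancel_right,
          creC_natCast, creC_natCast]
      · intro x hx y hy hxy
        have hx := mem_antidiagonal.1 hx
        have hy := mem_antidiagonal.1 hy
        simp only [Nat.cast_inj] at hxy
        exact Prod.ext (by omega) hxy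
    · intro n hn
      obtain ⟨i, j, h1, rfl⟩ := creC_sub_mul_creC_ne_zero hn
      have : N = i + j := by exact_mod_cast h1
      simp only [Finset.coe_image, Set.mem_image, Finset.mem_coe, mem_antidiagonal]
      exact ⟨(i, j), this.symm, rfl⟩
  · rw [creC_eq_zero _ (by push Not at hw; exact hw)]
    refine (finsum_eq_zero_of_forall_eq_zero fun n => ?_).symm
    by_contra hn
    obtain ⟨i, j, h1, -⟩ := creC_sub_mul_creC_ne_zero hn
    exact hw ⟨i + j, by rw [h1]; push_cast; rfl⟩

/-- Setting the two points equal collects all modes with a given total exponent. Integer second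
exponents suffice, because a nonzero creation coefficient forces integrality. -/
theorem mode_mul (V W : VertexOp) (u : ℂ) (p : Poly) :
    mode h k (V * W) u p = ∑ᶠ n : ℤ, mode₂ h k V W (u - n) n p := by
  set T : ℕ × ℕ → Poly := fun x => V.lower h k x.1 (W.lower h k x.2 p) with hT
  have hTfin : (Function.support T).Finite := finite_support_lower₂ h k V W p
  have h1 : ∀ N : ℕ, (V * W).creC (u + N) * (V * W).lower h k N p =
      ∑ x ∈ antidiagonal N, (V * W).creC (u + x.1 + x.2) * T x := fun N => by
    rw [lower_mul, LinearMap.sum_apply, Finset.mul_sum]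
    refine Finset.sum_congr rfl fun x hx => ?_
    rw [← mem_antidiagonal.1 hx, Nat.cast_add, add_assoc]
    rfl
  have h2 : ∀ x : ℕ × ℕ, (V * W).creC (u + x.1 + x.2) =
      ∑ᶠ n : ℤ, V.creC (u - n + x.1) * W.creC (n + x.2) := fun x => by
    rw [creC_mul, ← finsum_comp_equiv (Equiv.addRight (x.2 : ℤ))]
    refine finsum_congr fun n => ?_
    simp only [Equiv.coe_addRight]
    push_cast
    congr 2
    ring
  have h3 : ∀ x : ℕ × ℕ, (Function.support fun n : ℤ =>
      V.creC (u - n + x.1) * W.creC (n + x.2)).Finite := fun x => by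
    have := (finite_support_creC_mul V W (u + x.1 + x.2)).preimage
      ((Equiv.addRight (x.2 : ℤ)).injective.injOn)
    refine this.subset fun n hn h0 => hn ?_
    simp only [Equiv.coe_addRight] at h0 ⊢
    rw [← h0]
    push_cast
    congr 2
    ring
  rw [mode, finsum_congr h1, finsum_antidiagonal]
  swap
  · exact hTfin.subset fun x hx h0 => hx (by simp only; rw [h0, mul_zero])
  have h4 : ∀ x, (V * W).creC (u + x.1 + x.2) * T x =
      ∑ᶠ n : ℤ, V.creC (u - n + x.1) * W.creC (n + x.2) * T x := fun x => by
    rw [h2, finsum_mul' _ _ (h3 x)]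
  rw [finsum_congr h4, finsum_comm_of_finite]
  · rfl
  · refine (Set.Finite.biUnion hTfin fun x _ => (Set.finite_singleton x).prod (h3 x)).subset
      fun y hy => ?_
    exact Set.mem_biUnion (x := y.1) (right_ne_zero_of_mul hy)
      ⟨rfl, left_ne_zero_of_mul hy⟩

end VertexOp

/-! ### Contractions and commutators -/

theorem qPow_add (h x y : ℂ) : qPow h (x + y) = qPow h x * qPow h y := by
  rw [qPow, qPow, qPow, ← Complex.exp_add, mul_add]

theorem qPow_ne_zero (h x : ℂ) : qPow h x ≠ 0 := Complex.exp_ne_zero _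

theorem qPow_zero (h : ℂ) : qPow h 0 = 1 := by rw [qPow, mul_zero, Complex.exp_zero]

theorem qPow_neg (h x : ℂ) : qPow h (-x) = (qPow h x)⁻¹ := by
  rw [qPow, qPow, ← Complex.exp_neg, mul_neg]

theorem qPow_sub (h x y : ℂ) : qPow h (x - y) = qPow h x / qPow h y := by
  rw [sub_eq_add_neg, qPow_add, qPow_neg, div_eq_mul_inv]

/-- The series `-log (1 - t x)`. -/
def logSeries (t : ℂ) : PowerSeries ℂ := posSeries fun m => t ^ (m : ℕ) / (m : ℂ)

theorem coeff_zero_logSeries (t : ℂ) : coeff 0 (logSeries t) = 0 := coeff_zero_posSeries _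

theorem coeff_euler_logSeries (t : ℂ) (n : ℕ) :
    coeff n (euler (logSeries t)) = if n = 0 then 0 else t ^ n := by
  rcases Nat.eq_zero_or_pos n with rfl | hn
  · simp [coeff_zero_logSeries]
  obtain ⟨m, rfl⟩ : ∃ m : ℕ+, (m : ℕ) = n := ⟨⟨n, hn⟩, rfl⟩
  rw [coeff_euler, logSeries, coeff_posSeries, if_neg hn.ne', smul_eq_mul,
    mul_div_cancel₀ _ (by exact_mod_cast hn.ne')]

theorem expSeries_logSeries (t : ℂ) : expSeries (logSeries t) = PowerSeries.mk fun n => t ^ n := by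
  refine (eq_expSeries (coeff_zero_logSeries t) (fun _ _ => Commute.all _ _) (by simp) ?_).symm
  ext n
  rw [coeff_euler, coeff_mk, coeff_mul, Finset.Nat.sum_antidiagonal_eq_sum_range_succ
    (fun i j => coeff i (euler (logSeries t)) * coeff j (PowerSeries.mk fun n => t ^ n)),
    Finset.sum_range_succ', Finset.sum_congr rfl (g := fun _ => t ^ n)]
  · simp
  · intro i hi
    have := Finset.mem_range.1 hi
    rw [coeff_euler_logSeries, coeff_mk, if_neg (by omega), ← pow_add]
    congr 1; omega

theorem expSeries_neg_logSeries (s : ℂ) : expSeries (-logSeries s) = 1 - C s * X := by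
  refine (eq_expSeries (by rw [map_neg, coeff_zero_logSeries, neg_zero])
    (fun _ _ => Commute.all _ _) (by simp) ?_).symm
  have h1 : ∀ n, coeff n (euler (-logSeries s)) = if n = 0 then 0 else -s ^ n := fun n => by
    rw [coeff_euler, map_neg, smul_neg, ← coeff_euler, coeff_euler_logSeries]
    split_ifs <;> simp
  have h2 : euler (-logSeries s) * (1 - C s * X) =
      euler (-logSeries s) - C s * (euler (-logSeries s) * X) := by ring
  ext n
  rw [h2]
  rcases n with _ | _ | n
  · rw [coeff_zero_euler, map_sub, coeff_zero_euler, coeff_C_mul, coeff_zero_mul_X, mul_zero,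
        sub_zero]
  · simp [h1, coeff_one, coeff_succ_mul_X]
  · simp [h1, coeff_one, coeff_succ_mul_X, pow_succ']

/-- This is the expansion of (1 - s x)/(1 - t x), the form in which every contraction with a single
simple pole appears. -/
theorem expSeries_logSeries_sub (t s : ℂ) :
    expSeries (logSeries t - logSeries s) = (PowerSeries.mk fun n => t ^ n) * (1 - C s * X) := by
  rw [sub_eq_add_neg, expSeries_add (coeff_zero_logSeries t)
    (by rw [map_neg, coeff_zero_logSeries, neg_zero]) (fun _ _ => Commute.all _ _)
    (fun _ _ => Commute.all _ _) (fun _ _ => Commute.all _ _), expSeries_logSeries,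
    expSeries_neg_logSeries]

theorem coeff_succ_expSeries_logSeries_sub (t s : ℂ) (n : ℕ) :
    coeff (n + 1) (expSeries (logSeries t - logSeries s)) = t ^ (n + 1) - s * t ^ n := by
  rw [expSeries_logSeries_sub, mul_sub, mul_one, map_sub, coeff_mk, mul_left_comm, coeff_C_mul,
    coeff_succ_mul_X, coeff_mk]

namespace VertexOp

variable (h k : ℂ)

theorem zeroMode_add (μ ν : Charge) (b : Boson) :
    zeroMode (μ + ν) b = zeroMode μ b + zeroMode ν b := by
  cases b <;> simp only [zeroMode, Pi.add_apply] <;> ring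

theorem zExponent_add (V : VertexOp) (μ ν : Charge) :
    V.zExponent (μ + ν) = V.zExponent μ + V.zExponent ν := by
  simp only [zExponent, zeroMode_add, mul_add, Finset.sum_add_distrib]

theorem qExponent_add (V : VertexOp) (μ ν : Charge) :
    V.qExponent (μ + ν) = V.qExponent μ + V.qExponent ν := by
  simp only [qExponent, zeroMode_add, mul_add, Finset.sum_add_distrib]

theorem zExponent_mul (V W : VertexOp) (μ : Charge) :
    (V * W).zExponent μ = V.zExponent μ + W.zExponent μ := by
  simp only [zExponent, ← Finset.sum_add_distrib, ← add_mul]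
  rfl

theorem qExponent_mul (V W : VertexOp) (μ : Charge) :
    (V * W).qExponent μ = V.qExponent μ + W.qExponent μ := by
  simp only [qExponent, ← Finset.sum_add_distrib, ← add_mul]
  rfl

theorem zExponent_at_qPow (V : VertexOp) (x : ℂ) (μ : Charge) :
    (V.at_qPow h x).zExponent μ = V.zExponent μ := rfl

theorem qExponent_at_qPow (V : VertexOp) (x : ℂ) (μ : Charge) :
    (V.at_qPow h x).qExponent μ = V.qExponent μ + x * V.zExponent μ := by
  simp only [qExponent, zExponent, Finset.mul_sum, ← Finset.sum_add_distrib, ← mul_assoc,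
    ← add_mul]
  rfl

theorem mode_smul (V : VertexOp) (s c : ℂ) (p : Poly) :
    mode h k V s (c • p) = c • mode h k V s p := by
  rw [mode, mode, smul_finsum']
  · exact finsum_congr fun n => by rw [map_smul, mul_smul_comm]
  · exact (finite_support_lower h k V p).subset
      fun x hx h0 => hx (by simp only at h0 ⊢; rw [h0, mul_zero])

/-- `V` acts after `W` has shifted the charge. This is the origin of the extra power of `q` and of
the extra shift `V.zExponent W.shift`. -/
theorem current_current_single (V W : VertexOp) (a b : ℂ) (μ : Charge) (p : Poly) :
    V.current h k a (W.current h k b (Finsupp.single μ p)) =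
      Finsupp.single (μ + (V.shift + W.shift))
        ((V.scalar * W.scalar * (qPow h (V.qExponent μ) * qPow h (W.qExponent μ) *
          qPow h (V.qExponent W.shift))) • ∑ᶠ j : ℕ,
          coeff j (expSeries (contraction h k V W)) • mode₂ h k V W
            (a - V.zExponent μ - V.zExponent W.shift + j) (b - W.zExponent μ - j) p) := by
  rw [current_single, current_single, mode_smul, smul_smul, mode_mode, zExponent_add,
    qExponent_add, qPow_add, add_assoc, add_comm W.shift, sub_sub]
  congr 2
  ring

theorem trivialContraction {V W : VertexOp} (h1 : contraction h k V W = 0)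
    (h2 : contraction h k W V = 0) (h3 : V.zExponent W.shift = 0) (h4 : V.qExponent W.shift = 0)
    (h5 : W.zExponent V.shift = 0) (h6 : W.qExponent V.shift = 0) :
    TrivialContraction h k V W := by
  have key : ∀ V W : VertexOp, contraction h k V W = 0 → V.zExponent W.shift = 0 →
      V.qExponent W.shift = 0 → ∀ a b μ p, V.current h k a (W.current h k b (Finsupp.single μ p)) =
        V.normalProduct h k W a b (Finsupp.single μ p) := by
    intro V W h1 h3 h4 a b μ p
    rw [current_current_single, normalProduct_single, h1, h3, h4, expSeries_zero, qPow_zero,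
      finsum_eq_single _ 0]
    · simp
    · intro j hj
      rw [coeff_one, if_neg hj, zero_smul]
  have hcomm : ∀ a b μ p, V.normalProduct h k W a b (Finsupp.single μ p) =
      W.normalProduct h k V b a (Finsupp.single μ p) := by
    intro a b μ p
    rw [normalProduct_single, normalProduct_single, mode₂_comm, add_comm V.shift]
    congr 2
    ring
  intro a b
  constructor
  · refine Finsupp.lhom_ext fun μ p => ?_
    rw [Module.End.mul_apply, key V W h1 h3 h4]
  · refine Finsupp.lhom_ext fun μ p => ?_
    rw [Module.End.mul_apply, key W V h2 h5 h6, hcomm]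

theorem creC_re_nonneg {V : VertexOp} {s : ℂ} (hs : V.creC s ≠ 0) : 0 ≤ s.re := by
  by_contra h0
  refine hs (creC_eq_zero V fun n hn => h0 ?_)
  rw [← hn, Complex.natCast_re]
  exact n.cast_nonneg

theorem finite_support_mode₂_shift (V W : VertexOp) (s t : ℂ) (p : Poly) :
    (Function.support fun n : ℤ => mode₂ h k V W (s - n) (t + n) p).Finite := by
  refine (Set.Finite.biUnion (finite_support_lower₂ h k V W p) fun x _ =>
    Set.finite_Icc ⌊-(t + x.2).re⌋ ⌈(s + x.1).re⌉).subset fun n hn => ?_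
  obtain ⟨x, hx⟩ : ∃ x : ℕ × ℕ, V.creC (s - n + x.1) * W.creC (t + n + x.2) *
      V.lower h k x.1 (W.lower h k x.2 p) ≠ 0 := by
    by_contra h0
    push Not at h0
    exact hn (finsum_eq_zero_of_forall_eq_zero h0)
  refine Set.mem_biUnion (x := x) (right_ne_zero_of_mul hx) ?_
  have h1 := creC_re_nonneg (left_ne_zero_of_mul (left_ne_zero_of_mul hx))
  have h2 := creC_re_nonneg (right_ne_zero_of_mul (left_ne_zero_of_mul hx))
  simp only [Complex.add_re, Complex.sub_re, Complex.intCast_re, Complex.natCast_re] at h1 h2 ⊢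
  constructor
  · have : ((⌊-(t.re + x.2)⌋ : ℤ) : ℝ) ≤ n := (Int.floor_le _).trans (by linarith)
    exact_mod_cast this
  · have : (n : ℝ) ≤ (⌈s.re + x.1⌉ : ℤ) := le_trans (by linarith) (Int.le_ceil _)
    exact_mod_cast this

theorem finsum_comp_eq_indicator {α β M : Type*} [AddCommMonoid M] {g : β → α}
    (hg : Function.Injective g) (f : α → M) :
    ∑ᶠ j, f (g j) = ∑ᶠ i, (Set.range g).indicator f i := by
  rw [← finsum_mem_range hg, finsum_mem_def]

-- This is the substitution property of the delta function: summing over all shifts with weights `q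
-- ^ (τ n)` evaluates the normally ordered product at `w = q ^ τ z`. For non-integral `t` every mode
-- vanishes.
open Classical in
theorem finsum_mode₂_shift (V W : VertexOp) (τ s t : ℂ) (p : Poly) :
    ∑ᶠ n : ℤ, qPow h (τ * n) • mode₂ h k V W (s - n) (t + n) p =
      (if ∃ n : ℤ, t = n then qPow h (-(τ * t)) else 0) •
        mode h k (V * W.at_qPow h τ) (s + t) p := by
  split_ifs with ht
  · obtain ⟨m, rfl⟩ := ht
    rw [mode_mul, ← finsum_comp_equiv (Equiv.subRight m), smul_finsum']
    · refine finsum_congr fun n => ?_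
      rw [mode₂_at_qPow, smul_smul, ← qPow_add]
      simp only [Equiv.subRight_apply]
      push_cast
      congr 2 <;> ring
    · refine (finite_support_mode₂_shift h k V (W.at_qPow h τ) (s + m) 0 p).subset
        fun n hn h0 => hn ?_
      simp only [zero_add] at h0 ⊢
      exact h0
  · rw [zero_smul]
    refine finsum_eq_zero_of_forall_eq_zero fun n => ?_
    rw [mode₂, finsum_eq_zero_of_forall_eq_zero, smul_zero]
    intro x
    rw [creC_eq_zero W, mul_zero, zero_mul]
    intro l hl
    exact ht ⟨l - n - x.2, by push_cast; rw [hl]; ring⟩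

open Classical in
/-- The commutator of two vertex operators whose products in both orders are expansions of the same
rational function with one simple pole. -/
theorem commutator_single {V W : VertexOp} {τ σ : ℂ} (hshift : V.shift = 0) (hz : V.zExp = 0)
    (hq : V.qExponent W.shift = σ - τ)
    (hWV : contraction h k W V = logSeries (qPow h τ) - logSeries (qPow h σ))
    (hVW : contraction h k V W = logSeries (qPow h (-τ)) - logSeries (qPow h (-σ)))
    (a b : ℂ) (μ : Charge) (p : Poly) :
    V.current h k a (W.current h k b (Finsupp.single μ p)) -
        W.current h k b (V.current h k a (Finsupp.single μ p)) =
      ((qPow h (σ - τ) - 1) * (if ∃ n : ℤ, b - W.zExponent μ = n then qPow h (-(τ * b)) else 0)) •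
        (V * W.at_qPow h τ).current h k (a + b) (Finsupp.single μ p) := by
  have hz0 : ∀ ν, V.zExponent ν = 0 := fun ν => by simp [zExponent, hz]
  have hW0 : W.zExponent V.shift = 0 := by
    rw [hshift]; simp only [zExponent]
    refine Finset.sum_eq_zero fun b _ => ?_
    cases b <;> simp [zeroMode]
  have hW0' : W.qExponent V.shift = 0 := by
    rw [hshift]; simp only [qExponent]
    refine Finset.sum_eq_zero fun b _ => ?_
    cases b <;> simp [zeroMode]
  set B := b - W.zExponent μ with hB
  set N : ℤ → Poly := fun n => mode₂ h k V W (a - n) (B + n) p with hN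
  have hNfin : (Function.support N).Finite := finite_support_mode₂_shift h k V W a B p
  set g : ℕ → ℂ := fun j => coeff j (expSeries (contraction h k V W)) with hg
  set g' : ℕ → ℂ := fun j => coeff j (expSeries (contraction h k W V)) with hg'
  -- Reindexed by `n = -j` here and by `n = j` in `e2`, the two products become sums of the same
  -- family `N` over the two half lines.
  have e1 : ∑ᶠ j : ℕ, g j • mode₂ h k V W (a + j) (B - j) p =
      ∑ᶠ n : ℤ, (Set.range fun j : ℕ => -(j : ℤ)).indicator (fun n => g (-n).toNat • N n) n := by
    rw [← finsum_comp_eq_indicator fun i j hij => by simpa using hij]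
    refine finsum_congr fun j => ?_
    simp [hN, sub_eq_add_neg]
  have e2 : ∑ᶠ j : ℕ, g' j • mode₂ h k W V (B + j) (a - j) p =
      ∑ᶠ n : ℤ, (Set.range fun j : ℕ => (j : ℤ)).indicator (fun n => g' n.toNat • N n) n := by
    rw [← finsum_comp_eq_indicator Nat.cast_injective]
    refine finsum_congr fun j => ?_
    simp [hN, mode₂_comm h k W V]
  have hind : ∀ (S : Set ℤ) (f : ℤ → ℂ),
      (Function.support (S.indicator fun n => f n • N n)).Finite := fun S f =>
    hNfin.subset fun n hn h0 => hn (by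
      by_cases hS : n ∈ S
      · rw [Set.indicator_of_mem hS, h0, smul_zero]
      · rw [Set.indicator_of_notMem hS])
  -- On both half lines the coefficient of `N n` is `(q ^ (σ - τ) - 1) q ^ (τ n)`, and at `n = 0`
  -- the two constant terms combine to the same expression. The expansions thus merge into one
  -- two-sided series.
  have key : qPow h (σ - τ) • ∑ᶠ j : ℕ, g j • mode₂ h k V W (a + j) (B - j) p -
      ∑ᶠ j : ℕ, g' j • mode₂ h k W V (B + j) (a - j) p =
      (qPow h (σ - τ) - 1) • ∑ᶠ n : ℤ, qPow h (τ * n) • N n := by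
    rw [e1, e2, smul_finsum' _ (hind _ _), smul_finsum', ← finsum_sub_distrib]
    · refine finsum_congr fun n => ?_
      have hqq : qPow h (σ - τ) * qPow h τ = qPow h σ := by rw [← qPow_add]; congr 1; ring
      have hg0 : g 0 = 1 := coeff_zero_expSeries _
      have hg0' : g' 0 = 1 := coeff_zero_expSeries _
      rcases lt_trichotomy n 0 with hn | rfl | hn
      · obtain ⟨j, rfl⟩ : ∃ j : ℕ, n = -((j + 1 : ℕ) : ℤ) := ⟨(-n).toNat - 1, by omega⟩
        rw [Set.indicator_of_mem (s := Set.range fun j : ℕ => -(j : ℤ)) ⟨j + 1, rfl⟩,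
            Set.indicator_of_notMem (by
          rintro ⟨i, hi⟩; simp only at hi; omega), sub_zero, neg_neg, Int.toNat_natCast, smul_smul,
          smul_smul]
        congr 1
        have h1 : qPow h (τ * ((-((j + 1 : ℕ) : ℤ) : ℤ) : ℂ)) = (qPow h τ)⁻¹ ^ (j + 1) := by
          rw [← qPow_neg, ← qPow_mul_natCast]; congr 1; push_cast; ring
        rw [h1, hg]
        simp only
        rw [hVW, coeff_succ_expSeries_logSeries_sub, qPow_neg, qPow_neg, ← hqq]
        have hcc := mul_inv_cancel₀ (qPow_ne_zero h (σ - τ))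
        rw [mul_inv]
        linear_combination (-((qPow h τ)⁻¹ ^ (j + 1))) * hcc
      · rw [Set.indicator_of_mem (s := Set.range fun j : ℕ => -(j : ℤ)) ⟨0, by simp⟩,
          Set.indicator_of_mem (s := Set.range fun j : ℕ => (j : ℤ)) ⟨0, by simp⟩]
        simp [hg0, hg0', qPow_zero, sub_smul]
      · obtain ⟨j, rfl⟩ : ∃ j : ℕ, n = ((j + 1 : ℕ) : ℤ) := ⟨n.toNat - 1, by omega⟩
        rw [Set.indicator_of_mem (s := Set.range fun j : ℕ => (j : ℤ)) ⟨j + 1, rfl⟩,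
          Set.indicator_of_notMem (by
          rintro ⟨i, hi⟩; simp only at hi; omega), smul_zero, zero_sub, Int.toNat_natCast,
          smul_smul, ← neg_smul]
        congr 1
        have h1 : qPow h (τ * (((j + 1 : ℕ) : ℤ) : ℂ)) = qPow h τ ^ (j + 1) := by
          rw [← qPow_mul_natCast]; congr 1
        rw [h1, hg']
        simp only
        rw [hWV, coeff_succ_expSeries_logSeries_sub, ← hqq]
        ring
    · exact (hind _ _).subset fun n hn h0 => hn (by simp only at h0 ⊢; rw [h0, smul_zero])
    · exact hind _ _
    · exact hNfin.subset fun n hn h0 => hn (by simp only at h0 ⊢; rw [h0, smul_zero])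
  rw [finsum_mode₂_shift] at key
  rw [current_current_single, current_current_single, current_single, hz0, hz0, hW0, hW0', hq,
    sub_zero, sub_zero, sub_zero, ← hB, zExponent_mul, zExponent_at_qPow, qExponent_mul,
    qExponent_at_qPow, hz0, add_comm W.shift, ← Finsupp.single_sub, Finsupp.smul_single]
  congr 1
  have hc : V.scalar * W.scalar * (qPow h (V.qExponent μ) * qPow h (W.qExponent μ) *
      qPow h (σ - τ)) = (V.scalar * W.scalar * (qPow h (V.qExponent μ) * qPow h (W.qExponent μ))) *
      qPow h (σ - τ) := by ring
  have hc' : W.scalar * V.scalar * (qPow h (W.qExponent μ) * qPow h (V.qExponent μ) *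
      qPow h 0) = (V.scalar * W.scalar * (qPow h (V.qExponent μ) * qPow h (W.qExponent μ))) := by
    rw [qPow_zero]; ring
  rw [hc, hc', mul_smul, ← smul_sub, key, smul_smul, smul_smul, smul_smul, zero_add, hB,
    ← add_sub_assoc]
  congr 1
  change _ = _ * (V.scalar * W.scalar * _)
  split_ifs
  · rw [qPow_add, qPow_add, show -(τ * (b - W.zExponent μ)) = -(τ * b) + τ * W.zExponent μ by ring,
      qPow_add]
    ring
  · ring

end VertexOp

/-! ### The contractions of the currents -/

section Nonvanishing

theorem qPow_ne_qPow_neg {h x : ℂ} (hx : (h * x).re < 0) : qPow h x ≠ qPow h (-x) := by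
  intro h0
  have h1 := congrArg norm h0
  rw [qPow, qPow, Complex.norm_exp, Complex.norm_exp, Real.exp_eq_exp, mul_neg,
      Complex.neg_re] at h1
  linarith

theorem qPow_pow_four_sub_one_ne_zero {h x : ℂ} (hx : (h * x).re < 0) : qPow h x ^ 4 - 1 ≠ 0 := by
  intro h0
  have h1 := congrArg norm (sub_eq_zero.1 h0)
  rw [norm_pow, norm_one, qPow, Complex.norm_exp] at h1
  have h2 : Real.exp (h * x).re < 1 := Real.exp_zero ▸ Real.exp_lt_exp.2 hx
  exact (pow_lt_one₀ (Real.exp_pos _).le h2 (by norm_num)).ne h1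

end Nonvanishing

theorem sum_boson {M : Type*} [AddCommMonoid M] (f : Boson → M) :
    ∑ b, f b = f .alpha + f .alphaBar + f .beta := by
  change ∑ b ∈ ({.alpha, .alphaBar, .beta} : Finset Boson), f b = _
  rw [Finset.sum_insert (by simp), Finset.sum_insert (by simp), Finset.sum_singleton, add_assoc]

namespace VertexOp

section Fields

variable (h x c : ℂ) (V W : VertexOp)

@[simp] theorem mul_scalar : (V * W).scalar = V.scalar * W.scalar := rfl
@[simp] theorem mul_create (b m) : (V * W).create b m = V.create b m + W.create b m := rfl
@[simp] theorem mul_annih (b m) : (V * W).annih b m = V.annih b m + W.annih b m := rfl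
@[simp] theorem mul_shift (b) : (V * W).shift b = V.shift b + W.shift b := rfl
@[simp] theorem mul_zExp (b) : (V * W).zExp b = V.zExp b + W.zExp b := rfl
@[simp] theorem mul_qExp (b) : (V * W).qExp b = V.qExp b + W.qExp b := rfl
@[simp] theorem inv_scalar : (V⁻¹).scalar = V.scalar⁻¹ := rfl
@[simp] theorem inv_create (b m) : (V⁻¹).create b m = -V.create b m := rfl
@[simp] theorem inv_annih (b m) : (V⁻¹).annih b m = -V.annih b m := rfl
@[simp] theorem inv_shift (b) : (V⁻¹).shift b = -V.shift b := rfl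
@[simp] theorem inv_zExp (b) : (V⁻¹).zExp b = -V.zExp b := rfl
@[simp] theorem inv_qExp (b) : (V⁻¹).qExp b = -V.qExp b := rfl
@[simp] theorem scale_scalar : (V.scale c).scalar = c * V.scalar := rfl
@[simp] theorem scale_create (b m) : (V.scale c).create b m = V.create b m := rfl
@[simp] theorem scale_annih (b m) : (V.scale c).annih b m = V.annih b m := rfl
@[simp] theorem scale_shift (b) : (V.scale c).shift b = V.shift b := rfl
@[simp] theorem scale_zExp (b) : (V.scale c).zExp b = V.zExp b := rfl
@[simp] theorem scale_qExp (b) : (V.scale c).qExp b = V.qExp b := rfl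
@[simp] theorem at_qPow_scalar : (V.at_qPow h x).scalar = V.scalar := rfl
@[simp] theorem at_qPow_create (b) (m : ℕ+) :
    (V.at_qPow h x).create b m = qPow h (x * (m : ℂ)) * V.create b m := rfl
@[simp] theorem at_qPow_annih (b) (m : ℕ+) :
    (V.at_qPow h x).annih b m = qPow h (-(x * (m : ℂ))) * V.annih b m := rfl
@[simp] theorem at_qPow_shift (b) : (V.at_qPow h x).shift b = V.shift b := rfl
@[simp] theorem at_qPow_zExp (b) : (V.at_qPow h x).zExp b = V.zExp b := rfl
@[simp] theorem at_qPow_qExp (b) : (V.at_qPow h x).qExp b = V.qExp b + x * V.zExp b := rfl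

end Fields

end VertexOp

/-- `: Φ^-_1(q^{k+2} z) Φ^+_1(z) :` without the scalar prefactors. -/
def lambda₁₁ (h k : ℂ) : VertexOp := (phiMinus₁ h k).at_qPow h (k + 2) * phiPlus₁ h k

/-- `: Φ^-_1(q^{k+2} z) Φ^+_2(z) :` without the scalar prefactors. -/
def lambda₁₂ (h k : ℂ) : VertexOp := (phiMinus₁ h k).at_qPow h (k + 2) * phiPlus₂ h k

/-- `: Φ^-_2(q^{k+2} z) Φ^+_1(z) :` without the scalar prefactors. -/
def lambda₂₁ (h k : ℂ) : VertexOp := (phiMinus₂ h k).at_qPow h (k + 2) * phiPlus₁ h k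

/-! ### Exponents as monomials in `K = q ^ (k m / 2)` and `Q = q ^ m`, turning mode identities into
rational ones -/

section Exponents

variable (h k : ℂ) (m : ℕ)

theorem qPow_mode₁ : qPow h (k / 2 * m) = qPow h (k * m / 2) := by congr 1; ring
theorem qPow_mode₂ : qPow h ((k + 2) / 2 * m) = qPow h (k * m / 2) * qPow h m := by
  rw [← qPow_add]; congr 1; ring
theorem qPow_mode₃ : qPow h ((k + 2) * m) = qPow h (k * m / 2) ^ 2 * qPow h m ^ 2 := by
  simp only [sq, ← qPow_add]; congr 1; ring
theorem qPow_mode₄ : qPow h (k * m) = qPow h (k * m / 2) ^ 2 := by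
  simp only [sq, ← qPow_add]; congr 1; ring
theorem qPow_mode₅ : qPow h (2 * m) = qPow h m ^ 2 := by
  simp only [sq, ← qPow_add]; congr 1; ring
theorem qPow_mode₆ : qPow h ((k + 1) * m) = qPow h (k * m / 2) ^ 2 * qPow h m := by
  simp only [sq, ← qPow_add]; congr 1; ring
theorem qPow_mode₇ : qPow h ((k + 3) * m) = qPow h (k * m / 2) ^ 2 * qPow h m ^ 3 := by
  simp only [pow_succ, pow_zero, one_mul, ← qPow_add]; congr 1; ring
theorem qPow_mode₈ : qPow h ((2 * k + 3) * m) = qPow h (k * m / 2) ^ 4 * qPow h m ^ 3 := by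
  simp only [pow_succ, pow_zero, one_mul, ← qPow_add]; congr 1; ring

end Exponents

namespace VertexOp

/-- The coefficient of `(w / z) ^ m` in the exponent of the contraction of `V(z) W(w)`, when no
`α` modes are present. -/
def pairing (h k : ℂ) (V W : VertexOp) (m : ℕ+) : ℂ :=
  V.annih .alphaBar m * bracket h k .alphaBar m * W.create .alphaBar m +
    V.annih .beta m * bracket h k .beta m * W.create .beta m

theorem contraction_eq_posSeries {h k : ℂ} {V W : VertexOp} (h0 : ∀ m, V.annih .alpha m = 0) :
    contraction h k V W = posSeries (pairing h k V W) := by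
  rw [contraction]
  congr 1
  funext m
  rw [sum_boson, h0, zero_mul, zero_mul, zero_add, pairing]

theorem logSeries_sub_logSeries (t s : ℂ) :
    logSeries t - logSeries s = posSeries fun m => (t ^ (m : ℕ) - s ^ (m : ℕ)) / (m : ℂ) := by
  rw [sub_eq_iff_eq_add, logSeries, logSeries, ← posSeries_add]
  congr 1
  funext m
  rw [Pi.add_apply]
  ring

end VertexOp

open VertexOp

section Contractions

variable {h k : ℂ} (hq : h.re < 0) (hk : (h * k).re < 0)

theorem one_re (m : ℕ+) (hq : h.re < 0) : (h * (m : ℕ)).re < 0 := by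
  have : (0 : ℝ) < (m : ℕ) := by exact_mod_cast m.pos
  rw [Complex.mul_re, Complex.natCast_re, Complex.natCast_im, mul_zero, sub_zero]
  exact mul_neg_of_neg_of_pos hq this

theorem k_re (m : ℕ+) (hk : (h * k).re < 0) : (h * (k * (m : ℕ) / 2)).re < 0 := by
  have h1 : h * (k * (m : ℕ) / 2) = (h * k) * ((m : ℕ) / 2 : ℝ) := by push_cast; ring
  have : (0 : ℝ) < (m : ℕ) := by exact_mod_cast m.pos
  rw [h1, Complex.re_mul_ofReal]
  exact mul_neg_of_neg_of_pos hk (by positivity)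

-- These are the denominators of the modes: up to the common factor `q - q⁻¹`, `[2m]` is `(Q ^ 4 -
-- 1) / Q ^ 2` and `[km]` is `(K ^ 4 - 1) / K ^ 2`.
include hq hk in
theorem nonvanishing (m : ℕ+) : qPow h (m : ℕ) ^ 4 - 1 ≠ 0 ∧ qPow h (k * (m : ℕ) / 2) ^ 4 - 1 ≠ 0 ∧
    qPow h 1 - (qPow h 1)⁻¹ ≠ 0 :=
  ⟨qPow_pow_four_sub_one_ne_zero (one_re m hq), qPow_pow_four_sub_one_ne_zero (k_re m hk), by
    rw [← qPow_neg]; exact sub_ne_zero.2 (qPow_ne_qPow_neg (by rwa [mul_one]))⟩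

-- Each nonzero value has the shape `(t ^ m - s ^ m) / m`, the exponent of a function with one
-- simple pole. The poles are at `w = q^{k+1} z` for Λ_11 and at `w = q^{k+3} z` for Λ_21.
set_option maxHeartbeats 1000000 in
include hq hk in
theorem pairing_Sminus (m : ℕ+) :
    let K := qPow h (k * (m : ℕ) / 2)
    let Q := qPow h (m : ℕ)
    pairing h k (lambda₁₁ h k) (Sminus h k) m = ((K ^ 2 * Q)⁻¹ - K ^ 2 * Q) / (m : ℕ) ∧
    pairing h k (Sminus h k) (lambda₁₁ h k) m = (K ^ 2 * Q - (K ^ 2 * Q)⁻¹) / (m : ℕ) ∧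
    pairing h k (lambda₂₁ h k) (Sminus h k) m = ((K ^ 2 * Q ^ 3)⁻¹ - K ^ 2 * Q) / (m : ℕ) ∧
    pairing h k (Sminus h k) (lambda₂₁ h k) m = (K ^ 2 * Q ^ 3 - (K ^ 2 * Q)⁻¹) / (m : ℕ) ∧
    pairing h k (lambda₃ h k) (Sminus h k) m = 0 ∧
    pairing h k (Sminus h k) (lambda₃ h k) m = 0 := by
  obtain ⟨h1, h2, h3⟩ := nonvanishing hq hk m
  have := qPow_ne_zero h (m : ℕ)
  have := qPow_ne_zero h (k * (m : ℕ) / 2)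
  have hm : ((m : ℕ) : ℂ) ≠ 0 := by exact_mod_cast m.pos.ne'
  simp [pairing, lambda₁₁, lambda₂₁, lambda₃, phiMinus₁, phiMinus₂, phiPlus₁, phiPlus₂, Sminus,
    YbarPlus, YbarMinus, Zplus, Wplus, Zminus, Wminus, plusPart, minusPart,
    bracket, qNum, qPow_neg, qPow_mode₁ h k m, qPow_mode₂ h k m, qPow_mode₃ h k m,
    qPow_mode₄ h k m, qPow_mode₅ h m]
  generalize qPow h (m : ℕ) = Q at *
  generalize qPow h (k * (m : ℕ) / 2) = K at *
  generalize qPow h 1 - (qPow h 1)⁻¹ = D at *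
  refine ⟨?_, ?_, ?_, ?_, ?_, ?_⟩
  · field_simp
    ring
  · field_simp
    ring
  · field_simp
    ring
  · field_simp
    ring
  · field_simp
    ring
  · field_simp
    ring

end Contractions

section Contractions

variable {h k : ℂ} (hq : h.re < 0) (hk : (h * k).re < 0)

set_option maxHeartbeats 1000000 in
include hq hk in
theorem pairing_Splus (m : ℕ+) :
    let K := qPow h (k * (m : ℕ) / 2)
    let Q := qPow h (m : ℕ)
    pairing h k (lambda₁₁ h k) (Splus h k) m = (Q⁻¹ - (K ^ 4 * Q ^ 3)⁻¹) / (m : ℕ) ∧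
    pairing h k (Splus h k) (lambda₁₁ h k) m = (Q - K ^ 4 * Q ^ 3) / (m : ℕ) ∧
    pairing h k (lambda₁₂ h k) (Splus h k) m = (Q - (K ^ 4 * Q ^ 3)⁻¹) / (m : ℕ) ∧
    pairing h k (Splus h k) (lambda₁₂ h k) m = (Q⁻¹ - K ^ 4 * Q ^ 3) / (m : ℕ) ∧
    pairing h k (lambda₂ h k) (Splus h k) m = 0 ∧
    pairing h k (Splus h k) (lambda₂ h k) m = 0 := by
  obtain ⟨h1, h2, h3⟩ := nonvanishing hq hk m
  have := qPow_ne_zero h (m : ℕ)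
  have := qPow_ne_zero h (k * (m : ℕ) / 2)
  have hm : ((m : ℕ) : ℂ) ≠ 0 := by exact_mod_cast m.pos.ne'
  simp [pairing, lambda₁₁, lambda₁₂, lambda₂, phiMinus₁, phiMinus₂, phiPlus₁, phiPlus₂, Splus,
    YbarPlus, YbarMinus, Zplus, Wplus, Zminus, Wminus, plusPart, minusPart,
    bracket, qNum, qPow_neg, qPow_mode₁ h k m, qPow_mode₂ h k m, qPow_mode₃ h k m,
    qPow_mode₄ h k m, qPow_mode₅ h m]
  generalize qPow h (m : ℕ) = Q at *
  generalize qPow h (k * (m : ℕ) / 2) = K at *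
  generalize qPow h 1 - (qPow h 1)⁻¹ = D at *
  refine ⟨?_, ?_, ?_, ?_, ?_, ?_⟩
  · field_simp
    ring
  · field_simp
    ring
  · field_simp
    ring
  · field_simp
    ring
  · field_simp
    ring
  · field_simp
    ring

/-- The exponent of the contraction of `Ȳ^-(z) Ȳ^+(w)`, as a series in `w / z`. -/
def ybarSeries (h k : ℂ) : PowerSeries ℂ := posSeries fun m =>
  -((qNum h (2 * (m : ℂ)) / qNum h (k * (m : ℂ))) / (m : ℂ))

-- All four products share the contraction `Y` of `Ȳ^- Ȳ^+`. The diagonal ones carry an additional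
-- rational factor: that of 22 vanishes at the pole of the `Ȳ` contraction, and that of 11 produces
-- the constant κ.
set_option maxHeartbeats 1000000 in
include hq hk in
theorem pairing_phi (m : ℕ+) :
    let K := qPow h (k * (m : ℕ) / 2)
    let Q := qPow h (m : ℕ)
    let Y := -((qNum h (2 * (m : ℂ)) / qNum h (k * (m : ℂ))) / (m : ℂ))
    pairing h k (phiMinus₁ h k) (phiPlus₁ h k) m = Y + ((K ^ 2)⁻¹ - (K ^ 2 * Q ^ 2)⁻¹) / (m : ℕ) ∧
    pairing h k (phiMinus₁ h k) (phiPlus₂ h k) m = Y ∧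
    pairing h k (phiMinus₂ h k) (phiPlus₁ h k) m = Y ∧
    pairing h k (phiMinus₂ h k) (phiPlus₂ h k) m = Y + (K ^ 2 - K ^ 2 * Q ^ 2) / (m : ℕ) := by
  obtain ⟨h1, h2, h3⟩ := nonvanishing hq hk m
  have := qPow_ne_zero h (m : ℕ)
  have := qPow_ne_zero h (k * (m : ℕ) / 2)
  have hm : ((m : ℕ) : ℂ) ≠ 0 := by exact_mod_cast m.pos.ne'
  simp [pairing, phiMinus₁, phiMinus₂, phiPlus₁, phiPlus₂,
    YbarPlus, YbarMinus, Zplus, Wplus, Zminus, Wminus, plusPart, minusPart,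
    bracket, qNum, qPow_neg, qPow_mode₁ h k m, qPow_mode₂ h k m, qPow_mode₃ h k m,
    qPow_mode₄ h k m, qPow_mode₅ h m]
  generalize qPow h (m : ℕ) = Q at *
  generalize qPow h (k * (m : ℕ) / 2) = K at *
  generalize qPow h 1 - (qPow h 1)⁻¹ = D at *
  refine ⟨?_, ?_, ?_, ?_⟩
  · field_simp
    ring
  · field_simp
    ring
  · field_simp
  · field_simp
    ring

-- Λ_11 and Λ_21 have different poles against S^-, but the normally ordered products there coincide.
-- Hence a single current multiplies both delta functions.
set_option maxHeartbeats 1000000 in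
include hq hk in
theorem lambda_mul_Sminus : lambda₁₁ h k * (Sminus h k).at_qPow h (k + 1) =
    lambda₂₁ h k * (Sminus h k).at_qPow h (k + 3) := by
  refine VertexOp.ext (by simp [lambda₁₁, lambda₂₁, phiMinus₁, phiMinus₂, YbarMinus, Zplus, Wplus,
      Zminus, Wminus, plusPart, minusPart]) ?_ ?_ ?_ ?_ ?_
  · funext b m
    obtain ⟨h1, h2, h3⟩ := nonvanishing hq hk m
    have := qPow_ne_zero h (m : ℕ)
    have := qPow_ne_zero h (k * (m : ℕ) / 2)
    have hm : ((m : ℕ) : ℂ) ≠ 0 := by exact_mod_cast m.pos.ne'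
    cases b <;> simp [lambda₁₁, lambda₂₁, phiMinus₁, phiMinus₂, phiPlus₁, Sminus,
      YbarPlus, YbarMinus, Zplus, Wplus, Zminus, Wminus, plusPart, minusPart,
      qNum, qPow_neg, qPow_mode₁ h k m, qPow_mode₂ h k m, qPow_mode₃ h k m,
      qPow_mode₄ h k m, qPow_mode₅ h m, qPow_mode₆ h k m, qPow_mode₇ h k m]
    all_goals
      generalize qPow h (m : ℕ) = Q at *
      generalize qPow h (k * (m : ℕ) / 2) = K at *
      generalize qPow h 1 - (qPow h 1)⁻¹ = D at *
      field_simp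
      ring
  · funext b m
    obtain ⟨h1, h2, h3⟩ := nonvanishing hq hk m
    have := qPow_ne_zero h (m : ℕ)
    have := qPow_ne_zero h (k * (m : ℕ) / 2)
    have hm : ((m : ℕ) : ℂ) ≠ 0 := by exact_mod_cast m.pos.ne'
    cases b <;> simp [lambda₁₁, lambda₂₁, phiMinus₁, phiMinus₂, phiPlus₁, Sminus,
      YbarPlus, YbarMinus, Zplus, Wplus, Zminus, Wminus, plusPart, minusPart,
      qNum, qPow_neg, qPow_mode₁ h k m, qPow_mode₂ h k m, qPow_mode₃ h k m,
      qPow_mode₄ h k m, qPow_mode₅ h m, qPow_mode₆ h k m, qPow_mode₇ h k m]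
    all_goals
      generalize qPow h (m : ℕ) = Q at *
      generalize qPow h (k * (m : ℕ) / 2) = K at *
      generalize qPow h 1 - (qPow h 1)⁻¹ = D at *
      field_simp
      ring
  · funext b
    simp [lambda₁₁, lambda₂₁, phiMinus₁, phiMinus₂, YbarMinus, Zplus, Wplus, Zminus, Wminus,
        plusPart, minusPart]
  · funext b
    simp [lambda₁₁, lambda₂₁, phiMinus₁, phiMinus₂, YbarMinus, Zplus, Wplus, Zminus, Wminus,
        plusPart, minusPart]
  · funext b
    cases b <;> simp [lambda₁₁, lambda₂₁, phiMinus₁, phiMinus₂, phiPlus₁, Sminus,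
      YbarPlus, YbarMinus, Zplus, Wplus, Zminus, Wminus, plusPart, minusPart]
    all_goals ring

-- The analogous coincidence of Λ_11 and Λ_12 at their poles against S^+.
set_option maxHeartbeats 1000000 in
include hq hk in
theorem lambda_mul_Splus : lambda₁₁ h k * (Splus h k).at_qPow h 1 =
    lambda₁₂ h k * (Splus h k).at_qPow h (-1) := by
  refine VertexOp.ext (by simp [lambda₁₁, lambda₁₂, phiPlus₁, phiPlus₂, YbarPlus, Zplus, Wplus,
      Zminus, Wminus, plusPart, minusPart]) ?_ ?_ ?_ ?_ ?_
  · funext b m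
    obtain ⟨h1, h2, h3⟩ := nonvanishing hq hk m
    have := qPow_ne_zero h (m : ℕ)
    have := qPow_ne_zero h (k * (m : ℕ) / 2)
    have hm : ((m : ℕ) : ℂ) ≠ 0 := by exact_mod_cast m.pos.ne'
    cases b <;> simp [lambda₁₁, lambda₁₂, phiMinus₁, phiPlus₂, phiPlus₁, Splus,
      YbarPlus, YbarMinus, Zplus, Wplus, Zminus, Wminus, plusPart, minusPart,
      qNum, qPow_neg, qPow_mode₁ h k m, qPow_mode₂ h k m, qPow_mode₃ h k m,
      qPow_mode₄ h k m, qPow_mode₅ h m]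
    all_goals
      generalize qPow h (m : ℕ) = Q at *
      generalize qPow h (k * (m : ℕ) / 2) = K at *
      generalize qPow h 1 - (qPow h 1)⁻¹ = D at *
      field_simp
      ring
  · funext b m
    obtain ⟨h1, h2, h3⟩ := nonvanishing hq hk m
    have := qPow_ne_zero h (m : ℕ)
    have := qPow_ne_zero h (k * (m : ℕ) / 2)
    have hm : ((m : ℕ) : ℂ) ≠ 0 := by exact_mod_cast m.pos.ne'
    cases b <;> simp [lambda₁₁, lambda₁₂, phiMinus₁, phiPlus₂, phiPlus₁, Splus,
      YbarPlus, YbarMinus, Zplus, Wplus, Zminus, Wminus, plusPart, minusPart,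
      qNum, qPow_neg, qPow_mode₁ h k m, qPow_mode₂ h k m, qPow_mode₃ h k m,
      qPow_mode₄ h k m, qPow_mode₅ h m]
    all_goals
      generalize qPow h (m : ℕ) = Q at *
      generalize qPow h (k * (m : ℕ) / 2) = K at *
      generalize qPow h 1 - (qPow h 1)⁻¹ = D at *
      field_simp
      ring
  · funext b
    simp [lambda₁₁, lambda₁₂, phiPlus₁, phiPlus₂, YbarPlus, Zplus, Wplus, Zminus, Wminus,
        plusPart, minusPart]
  · funext b
    simp [lambda₁₁, lambda₁₂, phiPlus₁, phiPlus₂, YbarPlus, Zplus, Wplus, Zminus, Wminus,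
        plusPart, minusPart]
  · funext b
    cases b <;> simp [lambda₁₁, lambda₁₂, phiMinus₁, phiPlus₂, phiPlus₁, Splus,
      YbarPlus, YbarMinus, Zplus, Wplus, Zminus, Wminus, plusPart, minusPart]
    all_goals ring

end Contractions

/-! ### Commutators with the screening currents -/

theorem annih_alpha_lambda (h k : ℂ) (m : ℕ+) :
    (lambda₁₁ h k).annih .alpha m = 0 ∧ (lambda₁₂ h k).annih .alpha m = 0 ∧
    (lambda₂₁ h k).annih .alpha m = 0 := by
  simp [lambda₁₁, lambda₁₂, lambda₂₁, phiMinus₁, phiMinus₂, phiPlus₁, phiPlus₂,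
    YbarPlus, YbarMinus, Zplus, Wplus, Zminus, Wminus, plusPart, minusPart]

theorem shift_lambda (h k : ℂ) : (lambda₁₁ h k).shift = 0 ∧ (lambda₁₂ h k).shift = 0 ∧
    (lambda₂₁ h k).shift = 0 := by
  refine ⟨?_, ?_, ?_⟩ <;> funext b <;> cases b <;>
  simp [lambda₁₁, lambda₁₂, lambda₂₁, phiMinus₁, phiMinus₂, phiPlus₁, phiPlus₂,
    YbarPlus, YbarMinus, Zplus, Wplus, Zminus, Wminus, plusPart, minusPart]

theorem zExp_lambda (h k : ℂ) : (lambda₁₁ h k).zExp = 0 ∧ (lambda₁₂ h k).zExp = 0 ∧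
    (lambda₂₁ h k).zExp = 0 := by
  refine ⟨?_, ?_, ?_⟩ <;> funext b <;> cases b <;>
  simp [lambda₁₁, lambda₁₂, lambda₂₁, phiMinus₁, phiMinus₂, phiPlus₁, phiPlus₂,
    YbarPlus, YbarMinus, Zplus, Wplus, Zminus, Wminus, plusPart, minusPart]

/-- These zero-mode powers of `q` are what `commutator_single` needs to make the two orders
expansions of one function. They are written as σ - τ for the pole τ and zero σ of the contraction.
-/
theorem qExponent_lambda (h : ℂ) {k : ℂ} (hk : k ≠ 0) :
    (lambda₁₁ h k).qExponent (Sminus h k).shift = -(k + 1) - (k + 1) ∧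
    (lambda₂₁ h k).qExponent (Sminus h k).shift = -(k + 1) - (k + 3) ∧
    (lambda₁₂ h k).qExponent (Sminus h k).shift = 0 ∧
    (lambda₁₁ h k).qExponent (Splus h k).shift = 2 * k + 3 - 1 ∧
    (lambda₁₂ h k).qExponent (Splus h k).shift = 2 * k + 3 - -1 ∧
    (lambda₂₁ h k).qExponent (Splus h k).shift = 0 := by
  simp [lambda₁₁, lambda₁₂, lambda₂₁, phiMinus₁, phiMinus₂, phiPlus₁, phiPlus₂, qExponent,
    sum_boson, zeroMode, Sminus, Splus,
    YbarPlus, YbarMinus, Zplus, Wplus, Zminus, Wminus, plusPart, minusPart]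
  refine ⟨?_, ?_, ?_, ?_, ?_, ?_⟩ <;> field_simp <;> ring

theorem zExponent_zero (V : VertexOp) : V.zExponent 0 = 0 := by
  simp [zExponent, sum_boson, zeroMode]

theorem qExponent_zero (V : VertexOp) : V.qExponent 0 = 0 := by
  simp [qExponent, sum_boson, zeroMode]

theorem annih_alpha_S (h k : ℂ) (m : ℕ+) :
    (Sminus h k).annih .alpha m = 0 ∧ (Splus h k).annih .alpha m = 0 := ⟨rfl, rfl⟩

theorem contraction_eq_zero {h k : ℂ} {V W : VertexOp} (h0 : ∀ m, V.annih .alpha m = 0)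
    (h1 : ∀ m, pairing h k V W m = 0) : contraction h k V W = 0 := by
  rw [contraction_eq_posSeries h0, funext h1]
  ext n
  simp [posSeries]

theorem contraction_eq_logSeries {h k : ℂ} {V W : VertexOp} {t s : ℂ}
    (h0 : ∀ m, V.annih .alpha m = 0)
    (h1 : ∀ m : ℕ+, pairing h k V W m = (qPow h t ^ (m : ℕ) - qPow h s ^ (m : ℕ)) / (m : ℂ)) :
    contraction h k V W = logSeries (qPow h t) - logSeries (qPow h s) := by
  rw [contraction_eq_posSeries h0, logSeries_sub_logSeries, funext h1]

theorem qPow_one_pow (h : ℂ) (m : ℕ) : qPow h 1 ^ m = qPow h m := by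
  rw [← qPow_mul_natCast, one_mul]

section Commutators

variable {h k : ℂ} (hq : h.re < 0) (hk : (h * k).re < 0)

include hk in
theorem k_ne_zero : k ≠ 0 := by
  rintro rfl
  simp at hk

include hq hk in
theorem trivialContraction_Sminus : TrivialContraction h k (lambda₁₂ h k) (Sminus h k) ∧
    TrivialContraction h k (lambda₃ h k) (Sminus h k) := by
  have h1 := contraction_eq_zero (V := lambda₁₂ h k) (W := Sminus h k)
    (fun m => (annih_alpha_lambda h k m).2.1) (fun m => (pairing_Sminus hq hk m).2.2.2.2.1)
  have h2 := contraction_eq_zero (V := Sminus h k) (W := lambda₁₂ h k)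
    (fun m => (annih_alpha_S h k m).1) (fun m => (pairing_Sminus hq hk m).2.2.2.2.2)
  have h3 : (lambda₁₂ h k).zExponent (Sminus h k).shift = 0 := by
    simp [zExponent, (zExp_lambda h k).2.1]
  have h4 := (qExponent_lambda h (k_ne_zero hk)).2.2.1
  have h5 : (Sminus h k).zExponent (lambda₁₂ h k).shift = 0 := by
    rw [(shift_lambda h k).2.1, zExponent_zero]
  have h6 : (Sminus h k).qExponent (lambda₁₂ h k).shift = 0 := by
    rw [(shift_lambda h k).2.1, qExponent_zero]
  -- `lambda₃` differs from `lambda₁₂` only in its scalar, which enters none of the six conditions,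
  -- so the same proofs serve for both.
  exact ⟨trivialContraction h k h1 h2 h3 h4 h5 h6, trivialContraction h k h1 h2 h3 h4 h5 h6⟩

include hq hk in
theorem trivialContraction_Splus : TrivialContraction h k (lambda₂₁ h k) (Splus h k) ∧
    TrivialContraction h k (lambda₂ h k) (Splus h k) := by
  have h1 := contraction_eq_zero (V := lambda₂₁ h k) (W := Splus h k)
    (fun m => (annih_alpha_lambda h k m).2.2) (fun m => (pairing_Splus hq hk m).2.2.2.2.1)
  have h2 := contraction_eq_zero (V := Splus h k) (W := lambda₂₁ h k)
    (fun m => (annih_alpha_S h k m).2) (fun m => (pairing_Splus hq hk m).2.2.2.2.2)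
  have h3 : (lambda₂₁ h k).zExponent (Splus h k).shift = 0 := by
    simp [zExponent, (zExp_lambda h k).2.2]
  have h4 := (qExponent_lambda h (k_ne_zero hk)).2.2.2.2.2
  have h5 : (Splus h k).zExponent (lambda₂₁ h k).shift = 0 := by
    rw [(shift_lambda h k).2.2, zExponent_zero]
  have h6 : (Splus h k).qExponent (lambda₂₁ h k).shift = 0 := by
    rw [(shift_lambda h k).2.2, qExponent_zero]
  exact ⟨trivialContraction h k h1 h2 h3 h4 h5 h6, trivialContraction h k h1 h2 h3 h4 h5 h6⟩

-- Here σ = -(k+1) in both cases, with τ = k+1 and τ = k+3. By `lambda_mul_Sminus` both right-hand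
-- sides are written with the same vertex operator.
open Classical in
include hq hk in
theorem commutator_lambda_Sminus (a b : ℂ) (μ : Charge) (p : Poly) :
    (lambda₁₁ h k).current h k a ((Sminus h k).current h k b (Finsupp.single μ p)) -
        (Sminus h k).current h k b ((lambda₁₁ h k).current h k a (Finsupp.single μ p)) =
      ((qPow h (-(k + 1) - (k + 1)) - 1) * (if ∃ n : ℤ, b - (Sminus h k).zExponent μ = n then
        qPow h (-((k + 1) * b)) else 0)) • (lambda₁₁ h k *
          (Sminus h k).at_qPow h (k + 1)).current h k (a + b) (Finsupp.single μ p) ∧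
    (lambda₂₁ h k).current h k a ((Sminus h k).current h k b (Finsupp.single μ p)) -
        (Sminus h k).current h k b ((lambda₂₁ h k).current h k a (Finsupp.single μ p)) =
      ((qPow h (-(k + 1) - (k + 3)) - 1) * (if ∃ n : ℤ, b - (Sminus h k).zExponent μ = n then
        qPow h (-((k + 3) * b)) else 0)) • (lambda₁₁ h k *
          (Sminus h k).at_qPow h (k + 1)).current h k (a + b) (Finsupp.single μ p) := by
  have hk0 := k_ne_zero hk
  constructor
  · refine commutator_single h k (shift_lambda h k).1 (zExp_lambda h k).1
      (qExponent_lambda h hk0).1 (contraction_eq_logSeries (fun m => rfl) fun m => ?_)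
      (contraction_eq_logSeries (fun m => (annih_alpha_lambda h k m).1) fun m => ?_) a b μ p
    · rw [(pairing_Sminus hq hk m).2.1, qPow_neg, inv_pow, ← qPow_mul_natCast h (k + 1), qPow_mode₆]
    · rw [(pairing_Sminus hq hk m).1, neg_neg, qPow_neg, inv_pow, ← qPow_mul_natCast h (k + 1),
          qPow_mode₆]
  · rw [lambda_mul_Sminus hq hk]
    refine commutator_single h k (shift_lambda h k).2.2 (zExp_lambda h k).2.2
      (qExponent_lambda h hk0).2.1 (contraction_eq_logSeries (fun m => rfl) fun m => ?_)
      (contraction_eq_logSeries (fun m => (annih_alpha_lambda h k m).2.2) fun m => ?_) a b μ p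
    · rw [(pairing_Sminus hq hk m).2.2.2.1, qPow_neg, inv_pow, ← qPow_mul_natCast h (k + 1),
        ← qPow_mul_natCast h (k + 3), qPow_mode₆, qPow_mode₇]
    · rw [(pairing_Sminus hq hk m).2.2.1, neg_neg, qPow_neg, inv_pow, ← qPow_mul_natCast h (k + 1),
        ← qPow_mul_natCast h (k + 3), qPow_mode₆, qPow_mode₇]

open Classical in
include hq hk in
theorem commutator_lambda_Splus (a b : ℂ) (μ : Charge) (p : Poly) :
    (lambda₁₁ h k).current h k a ((Splus h k).current h k b (Finsupp.single μ p)) -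
        (Splus h k).current h k b ((lambda₁₁ h k).current h k a (Finsupp.single μ p)) =
      ((qPow h (2 * k + 3 - 1) - 1) * (if ∃ n : ℤ, b - (Splus h k).zExponent μ = n then
        qPow h (-(1 * b)) else 0)) • (lambda₁₁ h k *
          (Splus h k).at_qPow h 1).current h k (a + b) (Finsupp.single μ p) ∧
    (lambda₁₂ h k).current h k a ((Splus h k).current h k b (Finsupp.single μ p)) -
        (Splus h k).current h k b ((lambda₁₂ h k).current h k a (Finsupp.single μ p)) =
      ((qPow h (2 * k + 3 - -1) - 1) * (if ∃ n : ℤ, b - (Splus h k).zExponent μ = n then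
        qPow h (-(-1 * b)) else 0)) • (lambda₁₁ h k *
          (Splus h k).at_qPow h 1).current h k (a + b) (Finsupp.single μ p) := by
  have hk0 := k_ne_zero hk
  constructor
  · refine commutator_single h k (shift_lambda h k).1 (zExp_lambda h k).1
      (qExponent_lambda h hk0).2.2.2.1 (contraction_eq_logSeries (fun m => rfl) fun m => ?_)
      (contraction_eq_logSeries (fun m => (annih_alpha_lambda h k m).1) fun m => ?_) a b μ p
    · rw [(pairing_Splus hq hk m).2.1, ← qPow_mul_natCast h (2 * k + 3), qPow_one_pow,
        qPow_mode₈]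
    · rw [(pairing_Splus hq hk m).1, qPow_neg, qPow_neg, inv_pow, inv_pow,
        ← qPow_mul_natCast h (2 * k + 3), qPow_one_pow, qPow_mode₈]
  · rw [lambda_mul_Splus hq hk]
    refine commutator_single h k (shift_lambda h k).2.1 (zExp_lambda h k).2.1
      (qExponent_lambda h hk0).2.2.2.2.1 (contraction_eq_logSeries (fun m => rfl) fun m => ?_)
      (contraction_eq_logSeries (fun m => (annih_alpha_lambda h k m).2.1) fun m => ?_) a b μ p
    · rw [(pairing_Splus hq hk m).2.2.2.1, qPow_neg, inv_pow, ← qPow_mul_natCast h (2 * k + 3),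
        qPow_one_pow, qPow_mode₈]
    · rw [(pairing_Splus hq hk m).2.2.1, neg_neg, qPow_neg, inv_pow,
        ← qPow_mul_natCast h (2 * k + 3), qPow_one_pow, qPow_mode₈]

/-- `R z^{1 + 2/k} (q κ Λ_{11}(z) - q Λ_{12}(z) - q⁻¹ Λ_{21}(z))`, with
`κ = (1 - q^{-2k-4}) / (1 - q^{-2k-2})`; for a suitable constant `R` this is `L(z)`. -/
def lCurrent (h k R : ℂ) : Current := fun a => R •
  ((qPow h 1 * ((1 - qPow h (-(2 * k + 4))) / (1 - qPow h (-(2 * k + 2))))) •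
      (lambda₁₁ h k).current h k (a - (1 + 2 / k)) -
    qPow h 1 • (lambda₁₂ h k).current h k (a - (1 + 2 / k)) -
    qPow h (-1) • (lambda₂₁ h k).current h k (a - (1 + 2 / k)))

theorem scale_current (c : ℂ) (V : VertexOp) (a : ℂ) :
    (V.scale c).current h k a = c • V.current h k a :=
  mul_smul c V.scalar _

-- The prefactor `w⁻¹` of the total difference moves the exponent of `z / w` from `-b` to `-(b +
-- 1)`. This is the source of the additional factor `q ^ (-x)`.
open Classical in
theorem deltaCoeff_neg (e x b : ℂ) : deltaCoeff (-e) (h * x) (-(b + 1)) =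
    (if ∃ n : ℤ, b - e = n then qPow h (-(x * b)) else 0) * qPow h (-x) := by
  have hiff : (∃ n : ℤ, -(b + 1) = -e + n) ↔ ∃ n : ℤ, b - e = n :=
    ⟨fun ⟨n, hn⟩ => ⟨-n - 1, by push_cast; linear_combination -hn⟩,
      fun ⟨n, hn⟩ => ⟨-n - 1, by push_cast; linear_combination -hn⟩⟩
  rw [deltaCoeff]
  simp only [hiff]
  split_ifs
  · rw [← qPow_add, qPow]
    ring_nf
  · rw [zero_mul]

include hq hk in
theorem one_sub_qPow_ne_zero : (1 : ℂ) - qPow h (-(2 * k + 2)) ≠ 0 := by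
  intro h0
  have h1 := congrArg norm (sub_eq_zero.1 h0)
  rw [norm_one, qPow, Complex.norm_exp, eq_comm, Real.exp_eq_one_iff] at h1
  have : h * -(2 * k + 2) = -(2 * (h * k) + 2 * h) := by ring
  rw [this] at h1
  simp only [Complex.neg_re, Complex.add_re, Complex.mul_re h k, Complex.mul_re 2, Complex.re_ofNat,
    Complex.im_ofNat, zero_mul, sub_zero] at h1 hk
  linarith

theorem exp_ne_exp_of_re {x y : ℂ} (hxy : x.re ≠ y.re) : Complex.exp x ≠ Complex.exp y := by
  intro h0
  have h1 := congrArg norm h0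
  rw [Complex.norm_exp, Complex.norm_exp, Real.exp_eq_exp] at h1
  exact hxy h1

theorem smul_sub_smul_sub_smul (α β γ : ℂ) (x x' y y' z z' : Fock) :
    α • x - β • y - γ • z - (α • x' - β • y' - γ • z') =
      α • (x - x') - β • (y - y') - γ • (z - z') := by
  module

theorem qPow_two_mul_add_two (h k : ℂ) : qPow h (2 * k + 2) = qPow h k ^ 2 * qPow h 1 ^ 2 := by
  simp only [sq, ← qPow_add]; congr 1; ring

theorem qPow_two_mul_add_four (h k : ℂ) : qPow h (2 * k + 4) = qPow h k ^ 2 * qPow h 1 ^ 4 := by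
  simp only [pow_succ, pow_zero, one_mul, ← qPow_add]; congr 1; ring

theorem qPow_add_two (h k : ℂ) : qPow h (k + 2) = qPow h k * qPow h 1 ^ 2 := by
  simp only [sq, ← qPow_add]; congr 1; ring

theorem qPow_add_three (h k : ℂ) : qPow h (k + 3) = qPow h k * qPow h 1 ^ 3 := by
  simp only [pow_succ, pow_zero, one_mul, ← qPow_add]; congr 1; ring

include hq hk in
theorem lCurrent_commutes_Sminus (R : ℂ) :
    CommutesUpToTotalDifference h k (lCurrent h k R) (Sminus h k) := by
  classical
  set V := lambda₁₁ h k * (Sminus h k).at_qPow h (k + 1) with hV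
  -- The delta terms have coefficients -Rq(1 - q^{-2k-4}) and Rq⁻¹(1 - q^{-2k-4}). Dividing by
  -- q^{-(k+1)} and -q^{-(k+3)} leaves this common value. It goes into the scalar of the current, so
  -- r = 1 works for every R.
  set c : ℂ := R * (qPow h (-(k + 2)) - qPow h (k + 2)) with hc
  -- The two ρ's are the logarithms of the pole positions `w / z`. The power `2 + 2 / k` is the `1 +
  -- 2 / k` of `lCurrent` plus one more power of `z`, which compensates `w⁻¹`.
  refine ⟨1, h * (k + 1), h * (k + 3), fun a => (V.scale c).current h k (a - (2 + 2 / k)),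
    one_ne_zero, exp_ne_exp_of_re ?_, ⟨V.scale c, 2 + 2 / k, fun a => rfl⟩, fun μ p a b => ?_⟩
  · intro h0
    have : h * (k + 3) = h * (k + 1) + 2 * h := by ring
    rw [this] at h0
    simp at h0
    linarith
  · have h1 := commutator_lambda_Sminus hq hk (a - (1 + 2 / k)) b μ p
    have h2 : (lambda₁₂ h k).current h k (a - (1 + 2 / k))
        ((Sminus h k).current h k b (Finsupp.single μ p)) -
        (Sminus h k).current h k b
          ((lambda₁₂ h k).current h k (a - (1 + 2 / k)) (Finsupp.single μ p)) = 0 := by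
      obtain ⟨e1, e2⟩ := (trivialContraction_Sminus hq hk).1 (a - (1 + 2 / k)) b
      exact sub_eq_zero.2 (congrArg (fun f : Module.End ℂ Fock => f (Finsupp.single μ p))
        (e1.trans e2.symm))
    simp only [lCurrent, LinearMap.smul_apply, LinearMap.sub_apply, map_smul, map_sub]
    rw [← smul_sub, smul_sub_smul_sub_smul, h1.1, h1.2, h2, smul_zero, sub_zero, scale_current,
      LinearMap.smul_apply, deltaCoeff_neg, deltaCoeff_neg,
      show a - (1 + 2 / k) + b = a + (b + 1) - (2 + 2 / k) by ring,
      smul_smul, smul_smul, ← sub_smul, smul_smul, smul_smul]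
    congr 1
    have h3 := one_sub_qPow_ne_zero hq hk
    split_ifs
    · generalize qPow h (-((k + 1) * b)) = E
      generalize qPow h (-((k + 3) * b)) = E'
      rw [hc]
      have hv := qPow_ne_zero h k
      have hu := qPow_ne_zero h 1
      rw [qPow_neg, qPow_two_mul_add_two] at h3
      simp only [show -(k + 1) - (k + 1) = -(2 * k + 2) by ring,
        show -(k + 1) - (k + 3) = -(2 * k + 4) by ring, qPow_neg, qPow_two_mul_add_two,
        qPow_two_mul_add_four, qPow_add_two h k, qPow_add_three h k, qPow_add h k 1]
      generalize qPow h 1 = u at *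
      generalize qPow h k = v at *
      have h4 : u ^ 2 * v ^ 2 - 1 ≠ 0 := fun h0 => h3 (by
        rw [mul_comm, sub_eq_zero.1 h0]; norm_num)
      field_simp
      ring
    · simp

-- Now Λ_21 drops out, and the same κ balances the rest: qκ(q^{2k+2} - 1) = q⁻¹(q^{2k+4} - 1),
-- against -q(q^{2k+4} - 1) from Λ_12.
include hq hk in
theorem lCurrent_commutes_Splus (R : ℂ) :
    CommutesUpToTotalDifference h k (lCurrent h k R) (Splus h k) := by
  classical
  set V := lambda₁₁ h k * (Splus h k).at_qPow h 1 with hV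
  set c : ℂ := R * (qPow h (2 * k + 4) - 1) with hc
  refine ⟨1, h * 1, h * -1, fun a => (V.scale c).current h k (a - (2 + 2 / k)),
    one_ne_zero, exp_ne_exp_of_re ?_, ⟨V.scale c, 2 + 2 / k, fun a => rfl⟩, fun μ p a b => ?_⟩
  · intro h0
    simp at h0
    linarith
  · have h1 := commutator_lambda_Splus hq hk (a - (1 + 2 / k)) b μ p
    have h2 : (lambda₂₁ h k).current h k (a - (1 + 2 / k))
        ((Splus h k).current h k b (Finsupp.single μ p)) -
        (Splus h k).current h k b
          ((lambda₂₁ h k).current h k (a - (1 + 2 / k)) (Finsupp.single μ p)) = 0 := by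
      obtain ⟨e1, e2⟩ := (trivialContraction_Splus hq hk).1 (a - (1 + 2 / k)) b
      exact sub_eq_zero.2 (congrArg (fun f : Module.End ℂ Fock => f (Finsupp.single μ p))
        (e1.trans e2.symm))
    simp only [lCurrent, LinearMap.smul_apply, LinearMap.sub_apply, map_smul, map_sub]
    rw [← smul_sub, smul_sub_smul_sub_smul, h1.1, h1.2, h2, smul_zero, sub_zero, scale_current,
      LinearMap.smul_apply, deltaCoeff_neg, deltaCoeff_neg,
      show a - (1 + 2 / k) + b = a + (b + 1) - (2 + 2 / k) by ring,
      smul_smul, smul_smul, ← sub_smul, smul_smul, smul_smul]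
    congr 1
    have h3 := one_sub_qPow_ne_zero hq hk
    split_ifs
    · generalize qPow h (-(1 * b)) = E
      generalize qPow h (-(-1 * b)) = E'
      rw [hc]
      have hv := qPow_ne_zero h k
      have hu := qPow_ne_zero h 1
      rw [qPow_neg, qPow_two_mul_add_two] at h3
      simp only [show 2 * k + 3 - 1 = 2 * k + 2 by ring, neg_neg,
        show 2 * k + 3 - -1 = 2 * k + 4 by ring, qPow_neg, qPow_two_mul_add_two,
        qPow_two_mul_add_four]
      generalize qPow h 1 = u at *
      generalize qPow h k = v at *
      have h4 : u ^ 2 * v ^ 2 - 1 ≠ 0 := fun h0 => h3 (by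
        rw [mul_comm, sub_eq_zero.1 h0]; norm_num)
      field_simp
    · simp

end Commutators

open Filter Topology

/-! ### Convergence of the contractions -/

theorem hasSum_coeff_mul {F G : PowerSeries ℂ} {x a b : ℂ}
    (hF : HasSum (fun n => coeff n F * x ^ n) a) (hG : HasSum (fun n => coeff n G * x ^ n) b) :
    HasSum (fun n => coeff n (F * G) * x ^ n) (a * b) := by
  have hF' := hF.summable.norm
  have hG' := hG.summable.norm
  have h1 := (summable_norm_sum_mul_antidiagonal_of_summable_norm hF' hG').of_norm.hasSum
  rw [← tsum_mul_tsum_eq_tsum_sum_antidiagonal_of_summable_norm hF' hG', hF.tsum_eq,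
    hG.tsum_eq] at h1
  refine h1.congr_fun fun n => ?_
  rw [coeff_mul, Finset.sum_mul]
  refine Finset.sum_congr rfl fun y hy => ?_
  rw [← mem_antidiagonal.1 hy, pow_add]
  ring

theorem hasSum_coeff_geometric {t x : ℂ} (hx : ‖t * x‖ < 1) :
    HasSum (fun n => coeff n (PowerSeries.mk fun n => t ^ n) * x ^ n) (1 - t * x)⁻¹ := by
  simpa only [coeff_mk, mul_pow] using hasSum_geometric_of_norm_lt_one hx

theorem hasSum_coeff_one_sub (s x : ℂ) :
    HasSum (fun n => coeff n (1 - C s * X : PowerSeries ℂ) * x ^ n) (1 - s * x) := by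
  have h1 := hasSum_sum_of_ne_finset_zero (s := Finset.range 2)
    (f := fun n => coeff n (1 - C s * X : PowerSeries ℂ) * x ^ n) (L := .unconditional _) fun n hn
        => by
      obtain ⟨m, rfl⟩ : ∃ m, n = m + 2 := ⟨n - 2, by simp at hn; omega⟩
      simp [coeff_one, coeff_succ_mul_X]
  simpa [Finset.sum_range_succ, coeff_one, coeff_X, sub_eq_add_neg] using h1

/-! ### The contraction of `Ȳ^-` with `Ȳ^+` and its q-difference equation -/

section Ybar

variable {h k : ℂ}

theorem norm_qPow_lt_one {h x : ℂ} (hx : (h * x).re < 0) : ‖qPow h x‖ < 1 := by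
  rw [qPow, Complex.norm_exp]
  rwa [Real.exp_lt_one_iff]

/-- The coefficients of the contraction of `Ȳ^-(z) Ȳ^+(w)`. -/
def ybarCoeff (h k : ℂ) (n : ℕ) : ℂ := coeff n (expSeries (ybarSeries h k))

/-- Multiplying `-[2m]/[km]` by `1 - q^{2km}` cancels the denominator and leaves `q^{(k+2)m} -
q^{(k-2)m}`. Exponentiated, this is the q-difference equation. -/
theorem ybarSeries_eq (hq : h.re < 0) (hk : (h * k).re < 0) (n : ℕ) :
    coeff n (ybarSeries h k - (logSeries (qPow h (k + 2)) - logSeries (qPow h (k - 2)))) =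
      qPow h (2 * k) ^ n • coeff n (ybarSeries h k) := by
  rw [logSeries_sub_logSeries]
  rcases Nat.eq_zero_or_pos n with rfl | hn
  · rw [map_sub, ybarSeries, coeff_zero_posSeries, coeff_zero_posSeries, smul_zero, sub_zero]
  obtain ⟨m, rfl⟩ : ∃ m : ℕ+, (m : ℕ) = n := ⟨⟨n, hn⟩, rfl⟩
  rw [map_sub, ybarSeries, coeff_posSeries, coeff_posSeries]
  obtain ⟨h1, h2, h3⟩ := nonvanishing hq hk m
  have := qPow_ne_zero h (m : ℕ)
  have := qPow_ne_zero h (k * (m : ℕ) / 2)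
  have hm : ((m : ℕ) : ℂ) ≠ 0 := by exact_mod_cast m.pos.ne'
  simp only [← qPow_mul_natCast]
  rw [show (k - 2) * (m : ℂ) = k * m - 2 * m by ring,
    show 2 * k * ((m : ℕ) : ℂ) = k * m + k * m by ring, qPow_sub, qPow_add]
  simp only [qNum, qPow_neg, qPow_mode₃ h k m, qPow_mode₄ h k m, qPow_mode₅ h m, smul_eq_mul]
  generalize qPow h (m : ℕ) = Q at *
  generalize qPow h (k * (m : ℕ) / 2) = K at *
  generalize qPow h 1 - (qPow h 1)⁻¹ = D at *
  field_simp
  ring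

theorem ybarCoeff_series (hq : h.re < 0) (hk : (h * k).re < 0) :
    expSeries (ybarSeries h k) * (1 - C (qPow h (k + 2)) * X) =
      (PowerSeries.mk fun n => qPow h (2 * k) ^ n * ybarCoeff h k n) *
        (1 - C (qPow h (k - 2)) * X) := by
  set l := logSeries (qPow h (k + 2)) - logSeries (qPow h (k - 2)) with hl
  have h0 : coeff 0 (ybarSeries h k) = 0 := coeff_zero_posSeries _
  have hl0 : coeff 0 l = 0 := by
    rw [hl, map_sub, coeff_zero_logSeries, coeff_zero_logSeries, sub_zero]
  have h1 : expSeries (ybarSeries h k - l) =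
      PowerSeries.mk fun n => qPow h (2 * k) ^ n * ybarCoeff h k n := by
    ext n
    rw [coeff_mk, coeff_expSeries_rescale h0 (fun _ _ => Commute.all _ _) _
      (ybarSeries_eq hq hk), smul_eq_mul, ybarCoeff]
  have h2 : (PowerSeries.mk fun n => qPow h (k + 2) ^ n) * (1 - C (qPow h (k + 2)) * X) = 1 := by
    rw [← expSeries_logSeries_sub, sub_self, expSeries_zero]
  conv_lhs => rw [← sub_add_cancel (ybarSeries h k) l]
  rw [expSeries_add (by rw [map_sub, h0, hl0, sub_zero]) hl0 (fun _ _ => Commute.all _ _)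
    (fun _ _ => Commute.all _ _) (fun _ _ => Commute.all _ _), h1, hl, expSeries_logSeries_sub]
  linear_combination (PowerSeries.mk fun n => qPow h (2 * k) ^ n * ybarCoeff h k n) *
    (1 - C (qPow h (k - 2)) * X) * h2

theorem ybarCoeff_succ (hq : h.re < 0) (hk : (h * k).re < 0) (n : ℕ) :
    (1 - qPow h (2 * k) ^ (n + 1)) * ybarCoeff h k (n + 1) =
      (qPow h (k + 2) - qPow h (k - 2) * qPow h (2 * k) ^ n) * ybarCoeff h k n := by
  have h1 := congrArg (coeff (n + 1)) (ybarCoeff_series hq hk)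
  simp only [mul_sub, mul_one, map_sub, ← mul_assoc, mul_comm _ (C _), coeff_succ_mul_X,
    coeff_C_mul, coeff_mk] at h1
  rw [← ybarCoeff, ← ybarCoeff] at h1
  linear_combination h1

theorem re_two_mul (hk : (h * k).re < 0) : (h * (2 * k)).re < 0 := by
  have : (h * (2 * k)).re = 2 * (h * k).re := by
    rw [show h * (2 * k) = (2 : ℝ) * (h * k) by push_cast; ring, Complex.re_ofReal_mul]
  rw [this]; linarith

/-- The q-difference equation is a first-order recursion for the coefficients. Their ratio tends to
`q ^ (k + 2)` because `q ^ (2 k n)` tends to `0`, so the ratio test applies. -/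
theorem summable_ybarCoeff (hq : h.re < 0) (hk : (h * k).re < 0) {x : ℂ}
    (hx : ‖qPow h (k + 2) * x‖ < 1) : Summable fun n => ybarCoeff h k n * x ^ n := by
  obtain ⟨r, hr, hr1⟩ := exists_between hx
  have hp := norm_qPow_lt_one (re_two_mul hk)
  have hp0 := tendsto_pow_atTop_nhds_zero_of_norm_lt_one hp
  have hlim : Tendsto (fun n : ℕ => ‖(qPow h (k + 2) - qPow h (k - 2) * qPow h (2 * k) ^ n) /
      (1 - qPow h (2 * k) ^ (n + 1)) * x‖) atTop (𝓝 ‖qPow h (k + 2) * x‖) := by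
    have h1 := (((tendsto_const_nhds (x := qPow h (k + 2))).sub (hp0.const_mul (qPow h (k -
        2)))).div
      ((tendsto_const_nhds (x := (1 : ℂ))).sub (hp0.comp (tendsto_add_atTop_nat 1))) (by
          simp)).mul_const x
    simpa using h1.norm
  refine summable_of_ratio_norm_eventually_le hr1 ?_
  filter_upwards [hlim.eventually_le_const hr] with n hn
  have hne : 1 - qPow h (2 * k) ^ (n + 1) ≠ 0 := by
    intro h0
    have h1 := congrArg norm (sub_eq_zero.1 h0)
    rw [norm_one, norm_pow] at h1
    exact (pow_lt_one₀ (norm_nonneg _) hp n.succ_ne_zero).ne' h1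
  have h2 : ybarCoeff h k (n + 1) * x ^ (n + 1) =
      ((qPow h (k + 2) - qPow h (k - 2) * qPow h (2 * k) ^ n) /
      (1 - qPow h (2 * k) ^ (n + 1)) * x) * (ybarCoeff h k n * x ^ n) := by
    rw [div_mul_eq_mul_div, div_mul_eq_mul_div, eq_div_iff hne]
    linear_combination (x ^ (n + 1)) * ybarCoeff_succ hq hk n
  rw [h2, norm_mul]
  gcongr

/-- The contraction of `Ȳ^-(z) Ȳ^+(w)` as a function of `w / z`. -/
def ybarFun (h k x : ℂ) : ℂ := ∑' n, ybarCoeff h k n * x ^ n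

theorem hasSum_ybarFun (hq : h.re < 0) (hk : (h * k).re < 0) {x : ℂ}
    (hx : ‖qPow h (k + 2) * x‖ < 1) :
    HasSum (fun n => coeff n (expSeries (ybarSeries h k)) * x ^ n) (ybarFun h k x) :=
  (summable_ybarCoeff hq hk hx).hasSum

/-- The right-hand side already makes sense in a disc larger by the factor |q^{-2k}|, so it
continues the left-hand side past x = q^{-k-2}. -/
theorem ybarFun_eq (hq : h.re < 0) (hk : (h * k).re < 0) {x : ℂ}
    (hx : ‖qPow h (k + 2) * x‖ < 1) :
    ybarFun h k x * (1 - qPow h (k + 2) * x) =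
      ybarFun h k (qPow h (2 * k) * x) * (1 - qPow h (k - 2) * x) := by
  have hp := norm_qPow_lt_one (re_two_mul hk)
  have hx' : ‖qPow h (k + 2) * (qPow h (2 * k) * x)‖ < 1 := by
    rw [mul_left_comm, norm_mul]
    exact mul_lt_one_of_nonneg_of_lt_one_left (norm_nonneg _) hp hx.le
  have h1 := hasSum_coeff_mul (hasSum_ybarFun hq hk hx) (hasSum_coeff_one_sub (qPow h (k + 2)) x)
  rw [ybarCoeff_series hq hk] at h1
  refine h1.unique (hasSum_coeff_mul ?_ (hasSum_coeff_one_sub _ x))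
  refine (hasSum_ybarFun hq hk hx').congr_fun fun n => ?_
  rw [coeff_mk, ybarCoeff, mul_pow]
  ring

theorem analyticAt_ybarFun (hq : h.re < 0) (hk : (h * k).re < 0) {x : ℂ}
    (hx : ‖qPow h (k + 2) * x‖ < 1) : AnalyticAt ℂ (ybarFun h k) x := by
  have ht : 0 < ‖qPow h (k + 2)‖ := norm_pos_iff.2 (qPow_ne_zero _ _)
  obtain ⟨r, hr, hr1⟩ := exists_between hx
  have hU : IsOpen {y : ℂ | ‖qPow h (k + 2) * y‖ < r} :=
    isOpen_lt (by fun_prop) continuous_const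
  have hr0 : 0 ≤ r := (norm_nonneg _).trans hr.le
  set ρ : ℝ := r / ‖qPow h (k + 2)‖ with hρ
  have hρ0 : 0 ≤ ρ := by positivity
  have hs : Summable fun n => ‖ybarCoeff h k n * (ρ : ℂ) ^ n‖ := by
    refine (summable_ybarCoeff hq hk ?_).norm
    rw [norm_mul, Complex.norm_of_nonneg hρ0, hρ, mul_div_cancel₀ _ ht.ne']
    exact hr1
  refine (Complex.differentiableOn_tsum_of_summable_norm hs (F := fun n y => ybarCoeff h k n * y ^
      n)
    (fun n => by fun_prop) hU fun n y hy => ?_).analyticAt (hU.mem_nhds hr)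
  rw [norm_mul, norm_mul, norm_pow, norm_pow, Complex.norm_of_nonneg hρ0]
  gcongr
  rw [hρ, le_div_iff₀ ht, mul_comm, ← norm_mul]
  exact hy.le

end Ybar

/-! ### Uniqueness of contour integrals -/

theorem exp_injective_param {a b : ℂ} (hab : ∀ ζ : ℂ, Complex.exp (a * ζ) = Complex.exp (b * ζ)) :
    a = b := by
  by_contra hne
  have h1 := hab (1 / (a - b))
  have h2 : a * (1 / (a - b)) = b * (1 / (a - b)) + (1 : ℝ) := by
    have := sub_ne_zero.2 hne
    push_cast
    field_simp
    ring
  rw [h2, Complex.exp_add] at h1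
  have h3 := mul_left_cancel₀ (Complex.exp_ne_zero _) (h1.trans (mul_one _).symm)
  rw [← Complex.ofReal_exp, Complex.ofReal_eq_one, Real.exp_eq_one_iff] at h3
  exact one_ne_zero h3

/-- The functions e^{aζ} for distinct `a` are distinct characters of the additive group `ℂ`, hence
linearly independent by Dedekind's lemma. -/
theorem eq_zero_of_finsum_mul_exp {l : ℂ → ℂ} (hl : (Function.support l).Finite)
    (h0 : ∀ ζ : ℂ, ∑ᶠ a, l a * Complex.exp (a * ζ) = 0) : l = 0 := by
  let χ : ℂ → (Multiplicative ℂ →* ℂ) := fun a =>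
    { toFun := fun ζ => Complex.exp (a * ζ.toAdd)
      map_one' := by simp
      map_mul' := fun x y => by rw [← Complex.exp_add, ← mul_add]; rfl }
  have hχ : Function.Injective χ := fun a b hab => exp_injective_param fun ζ =>
    DFunLike.congr_fun hab (Multiplicative.ofAdd ζ)
  have hli := (linearIndependent_monoidHom (Multiplicative ℂ) ℂ).comp χ hχ
  rw [linearIndependent_iff'] at hli
  have h1 := hli hl.toFinset l (by
    funext ζ
    rw [Finset.sum_apply, Pi.zero_apply, ← h0 ζ.toAdd, finsum_eq_sum_of_support_subset]
    · rfl
    · intro a ha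
      simpa using left_ne_zero_of_mul ha)
  funext a
  by_contra ha
  exact ha (h1 a (by simpa using ha))

theorem isPreconnected_halfPlane (r : ℝ) : IsPreconnected {ω : ℂ | r < ω.re} :=
  (convex_halfSpace_re_gt r).isPreconnected

/-- Identity theorem: the difference has infinite order at a point far to the right, and infinite
order propagates through the connected half plane. Values at poles are arbitrary, so agreement is
only on punctured neighbourhoods. -/
theorem eventually_eq_of_halfPlane {f g : ℂ → ℂ} {r R : ℝ}
    (hf : MeromorphicOn f {ω : ℂ | r < ω.re}) (hg : MeromorphicOn g {ω : ℂ | r < ω.re})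
    (hfg : ∀ ω : ℂ, R < ω.re → f ω = g ω) {ω₀ : ℂ} (h0 : r < ω₀.re) : f =ᶠ[𝓝[≠] ω₀] g := by
  have h1 : meromorphicOrderAt (f - g) ω₀ = ⊤ := by
    by_contra hne
    set ω₁ : ℂ := ((max r R + 1 : ℝ) : ℂ) with hω
    have hr1 : ω₁.re = max r R + 1 := Complex.ofReal_re _
    have h2 := (hf.sub hg).meromorphicOrderAt_ne_top_of_isPreconnected (y := ω₁)
      (isPreconnected_halfPlane r) h0
      (by rw [Set.mem_ofPred_eq, hr1]; linarith [le_max_left r R]) hne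
    refine h2 (meromorphicOrderAt_eq_top_iff.2 ?_)
    have h3 : ∀ᶠ ω in 𝓝 ω₁, R < ω.re :=
      (isOpen_lt continuous_const Complex.continuous_re).mem_nhds
        (by rw [Set.mem_ofPred_eq, hr1]; linarith [le_max_right r R])
    filter_upwards [nhdsWithin_le_nhds h3] with ω hω
    rw [Pi.sub_apply, hfg ω hω, sub_self]
  filter_upwards [meromorphicOrderAt_eq_top_iff.1 h1] with ω hω
  exact sub_eq_zero.1 hω

theorem eventually_circleIntegral_congr {f g : ℂ → ℂ} {ω₀ : ℂ} (hfg : f =ᶠ[𝓝[≠] ω₀] g) :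
    ∀ᶠ ε : ℝ in 𝓝[>] 0, (∮ ω in C(ω₀, ε), f ω) = ∮ ω in C(ω₀, ε), g ω := by
  rw [EventuallyEq, eventually_nhdsWithin_iff, Metric.eventually_nhds_iff] at hfg
  obtain ⟨δ, hδ, hδ'⟩ := hfg
  filter_upwards [Ioo_mem_nhdsGT hδ] with ε hε
  refine circleIntegral.integral_congr hε.1.le fun ω hω => hδ' ?_ ?_
  · rw [mem_sphere_iff_norm, ← dist_eq_norm] at hω
    rw [hω]
    exact hε.2
  · rintro rfl
    simp at hω
    exact hε.1.ne hω

theorem matrixElement_ext {v w : Fock} (hvw : ∀ ν d, matrixElement ν d v = matrixElement ν d w) :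
    v = w :=
  Finsupp.ext fun ν => MvPolynomial.ext _ _ fun d => hvw ν d

/-- For each ζ the two continuations agree near the centre, so small circles give equal integrals.
The resulting exponential sums in ζ then agree coefficientwise. -/
theorem IsContourIntegral.unique {A B : Current} {c : ℂ} {L L' : Current}
    (hL : IsContourIntegral A B c L) (hL' : IsContourIntegral A B c L') : L = L' := by
  funext a
  refine LinearMap.ext fun v => matrixElement_ext fun ν d => ?_
  obtain ⟨hfin, h1⟩ := hL v ν d
  obtain ⟨hfin', h1'⟩ := hL' v ν d
  have h2 := eq_zero_of_finsum_mul_exp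
    (l := fun a => matrixElement ν d (L a v) - matrixElement ν d (L' a v))
    ((hfin.union hfin').subset fun a ha => by
      by_contra h0
      simp only [Set.mem_union, Set.mem_ofPred_eq, not_or, not_not] at h0
      exact ha (by simp only [h0.1, h0.2, sub_zero])) fun ζ => by
    obtain ⟨f, η, R, hη, hf, hs, hi⟩ := h1 ζ
    obtain ⟨f', η', R', hη', hf', hs', hi'⟩ := h1' ζ
    have h3 : f =ᶠ[𝓝[≠] (ζ + c)] f' :=
      eventually_eq_of_halfPlane (r := (ζ + c).re - min η η') (R := max R R')
        (hf.mono_set fun ω hω => by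
          rw [Set.mem_ofPred_eq] at hω ⊢; linarith [min_le_left η η'])
        (hf'.mono_set fun ω hω => by
          rw [Set.mem_ofPred_eq] at hω ⊢; linarith [min_le_right η η'])
        (fun ω hω => (hs ω ((le_max_left _ _).trans_lt hω)).unique
          (hs' ω ((le_max_right _ _).trans_lt hω)))
        (by linarith [lt_min hη hη'])
    have h4 := eventually_circleIntegral_congr
      (f := fun ω => f ω * Complex.exp ω) (g := fun ω => f' ω * Complex.exp ω)
      (h3.mono fun ω hω => by simp only [hω])
    obtain ⟨ε, e1, e2, e3⟩ := (hi.and (hi'.and h4)).exists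
    rw [e3, e2] at e1
    simp only [sub_mul]
    rw [finsum_sub_distrib, e1, sub_self]
    · exact hfin.subset fun a ha => left_ne_zero_of_mul ha
    · exact hfin'.subset fun a ha => left_ne_zero_of_mul ha
  exact sub_eq_zero.1 (congrFun h2 a)

/-! ### Residues -/

theorem analyticAt_dslope_exp (ω₀ : ℂ) :
    AnalyticAt ℂ (dslope (fun ω => 1 - Complex.exp (ω₀ - ω)) ω₀) ω₀ := by
  have h1 : DifferentiableOn ℂ (fun ω => 1 - Complex.exp (ω₀ - ω)) Set.univ := by fun_prop
  exact ((Complex.differentiableOn_dslope univ_mem).2 h1).analyticAt univ_mem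

theorem dslope_exp_self (ω₀ : ℂ) :
    dslope (fun ω => 1 - Complex.exp (ω₀ - ω)) ω₀ ω₀ = 1 := by
  have h1 : HasDerivAt (fun ω => 1 - Complex.exp (ω₀ - ω))
      (-(Complex.exp (ω₀ - ω₀) * (-1))) ω₀ := by
    simpa using ((((hasDerivAt_id ω₀).const_sub ω₀).cexp).const_sub 1)
  rw [dslope_same, h1.deriv]
  simp

/-- The residue at a simple pole, as an integral over small circles. -/
theorem eventually_circleIntegral_eq {F : ℂ → ℂ} {ω₀ : ℂ} (hF : AnalyticAt ℂ F ω₀) :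
    ∀ᶠ ε : ℝ in 𝓝[>] 0, (2 * (Real.pi : ℂ) * Complex.I)⁻¹ *
      (∮ ω in C(ω₀, ε), F ω / (1 - Complex.exp (ω₀ - ω)) * Complex.exp ω) =
        F ω₀ * Complex.exp ω₀ := by
  -- Here `1 - exp (ω₀ - ω) = (ω - ω₀) e(ω)` with `e(ω₀) = 1`, so Cauchy's formula applies to `F ·
  -- exp / e`.
  set e : ℂ → ℂ := dslope (fun ω => 1 - Complex.exp (ω₀ - ω)) ω₀ with he
  have he0 : e ω₀ = 1 := dslope_exp_self ω₀
  have hK : AnalyticAt ℂ (fun ω => F ω * Complex.exp ω / e ω) ω₀ :=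
    (hF.mul (by fun_prop)).div (analyticAt_dslope_exp ω₀) (by rw [he0]; exact one_ne_zero)
  obtain ⟨δ, hδ, hδ'⟩ := Metric.eventually_nhds_iff.1 hK.eventually_analyticAt
  filter_upwards [Ioo_mem_nhdsGT hδ] with ε hε
  have h1 : DiffContOnCl ℂ (fun ω => F ω * Complex.exp ω / e ω) (Metric.ball ω₀ ε) := by
    refine DifferentiableOn.diffContOnCl fun ω hω => ?_
    rw [closure_ball _ hε.1.ne'] at hω
    exact (hδ' (lt_of_le_of_lt hω hε.2)).differentiableAt.differentiableWithinAt
  have h2 := h1.circleIntegral_sub_inv_smul (Metric.mem_ball_self hε.1)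
  have h3 : (∮ ω in C(ω₀, ε), F ω / (1 - Complex.exp (ω₀ - ω)) * Complex.exp ω) =
      ∮ ω in C(ω₀, ε), (ω - ω₀)⁻¹ • (F ω * Complex.exp ω / e ω) := by
    refine circleIntegral.integral_congr hε.1.le fun ω hω => ?_
    have hne : ω ≠ ω₀ := by
      rintro rfl
      simp at hω
      exact hε.1.ne hω
    rw [he, dslope_of_ne _ hne, slope_def_field, sub_self, Complex.exp_zero, sub_self, sub_zero,
      smul_eq_mul]
    have := sub_ne_zero.2 hne
    -- If the denominator has another zero on the circle, both integrands are `0` there by the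
    -- convention for division by zero.
    by_cases h0 : 1 - Complex.exp (ω₀ - ω) = 0
    · simp [h0]
    · field_simp
  rw [h3, h2, he0, smul_eq_mul, div_one, ← mul_assoc, inv_mul_cancel₀ Complex.two_pi_I_ne_zero,
    one_mul]

/-- The series `∑ m (a, b) e ^ {a ω + b ζ}` continues to `{Re ω > Re (ζ + c) - η}` with a simple
pole at `ω = ζ + c`, and its residue is `∑ l a e ^ {a ζ}`. -/
def HasResidue (c : ℂ) (η : ℝ) (m : ℂ × ℂ → ℂ) (l : ℂ → ℂ) : Prop :=
  (Function.support l).Finite ∧ ∀ ζ : ℂ, ∃ (F : ℂ → ℂ) (R : ℝ),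
    MeromorphicOn F {ω : ℂ | (ζ + c).re - η < ω.re} ∧ AnalyticAt ℂ F (ζ + c) ∧
    (∀ ω : ℂ, R < ω.re → HasSum (fun p : ℂ × ℂ => m p * Complex.exp (p.1 * ω + p.2 * ζ))
      (F ω / (1 - Complex.exp (ζ + c - ω)))) ∧
    F (ζ + c) * Complex.exp (ζ + c) = ∑ᶠ a : ℂ, l a * Complex.exp (a * ζ)

namespace HasResidue

variable {c : ℂ} {η : ℝ} {m m' : ℂ × ℂ → ℂ} {l l' : ℂ → ℂ}

theorem add (h1 : HasResidue c η m l) (h2 : HasResidue c η m' l') :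
    HasResidue c η (fun p => m p + m' p) (fun a => l a + l' a) := by
  refine ⟨(h1.1.union h2.1).subset (Function.support_add l l'), fun ζ => ?_⟩
  obtain ⟨F, R, e1, e2, e3, e4⟩ := h1.2 ζ
  obtain ⟨F', R', e1', e2', e3', e4'⟩ := h2.2 ζ
  refine ⟨F + F', max R R', e1.add e1', e2.add e2', fun ω hω => ?_, ?_⟩
  · simp only [Pi.add_apply, add_mul, add_div]
    exact (e3 ω ((le_max_left _ _).trans_lt hω)).add (e3' ω ((le_max_right _ _).trans_lt hω))
  · simp only [Pi.add_apply, add_mul]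
    rw [e4, e4', finsum_add_distrib]
    · exact h1.1.subset fun a ha => left_ne_zero_of_mul ha
    · exact h2.1.subset fun a ha => left_ne_zero_of_mul ha

theorem const_mul (r : ℂ) (h1 : HasResidue c η m l) :
    HasResidue c η (fun p => r * m p) (fun a => r * l a) := by
  refine ⟨h1.1.subset fun a ha => right_ne_zero_of_mul ha, fun ζ => ?_⟩
  obtain ⟨F, R, e1, e2, e3, e4⟩ := h1.2 ζ
  refine ⟨fun ω => r * F ω, R, (MeromorphicOn.const r).mul e1, analyticAt_const.mul e2,
    fun ω hω => ?_, ?_⟩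
  · simp only [mul_assoc, mul_div_assoc]
    exact (e3 ω hω).mul_left r
  · simp only [mul_assoc]
    rw [e4, mul_finsum']
    exact h1.1.subset fun a ha => left_ne_zero_of_mul ha

theorem zero : HasResidue c η (fun _ => 0) (fun _ => 0) := by
  refine ⟨by simp, fun ζ => ⟨fun _ => 0, 0, MeromorphicOn.const 0, analyticAt_const,
    fun ω _ => ?_, by simp⟩⟩
  simp only [zero_mul, zero_div]
  exact hasSum_zero

end HasResidue

theorem isContourIntegral_of_hasResidue {A B L : Current} {c : ℂ} {η : ℝ} (hη : 0 < η)
    (hs : ∀ μ p ν d, HasResidue c η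
      (fun x => matrixElement ν d (A x.1 (B x.2 (Finsupp.single μ p))))
      (fun a => matrixElement ν d (L a (Finsupp.single μ p)))) : IsContourIntegral A B c L := by
  intro v ν d
  have h1 : HasResidue c η (fun x => matrixElement ν d (A x.1 (B x.2 v)))
      (fun a => matrixElement ν d (L a v)) := by
    induction v using Finsupp.induction_linear with
    | zero => simpa [matrixElement] using HasResidue.zero
    | add v w hv hw => simpa [matrixElement] using hv.add hw
    | single μ p => exact hs μ p ν d
  refine ⟨h1.1, fun ζ => ?_⟩
  obtain ⟨F, R, e1, e2, e3, e4⟩ := h1.2 ζ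
  refine ⟨fun ω => F ω / (1 - Complex.exp (ζ + c - ω)), η, R, hη, ?_, e3, ?_⟩
  · exact e1.div fun ω _ => AnalyticAt.meromorphicAt (by fun_prop)
  · rw [← e4]
    exact eventually_circleIntegral_eq e2

/-! ### Matrix elements of products of two currents -/

theorem finite_support_shift_finsupp (N : ℂ × ℂ →₀ ℂ) (g : ℕ → ℂ) (P : ℂ × ℂ) :
    (Function.support fun j : ℕ => g j * N (P.1 + j, P.2 - j)).Finite := by
  have hinj : Function.Injective fun j : ℕ => (P.1 + (j : ℂ), P.2 - (j : ℂ)) := fun i j hij => by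
    simpa using (Prod.mk.inj hij).1
  exact (N.hasFiniteSupport.preimage hinj.injOn).subset fun j hj => right_ne_zero_of_mul hj

/-- Each point of the finitely supported `N` contributes the contraction series along one ray of
exponents, that is, `G` times a monomial. The general case follows by linearity in `N`. -/
theorem hasSum_shift_finsupp {g : ℕ → ℂ} {G ω ζ : ℂ}
    (hg : HasSum (fun j => g j * Complex.exp (ζ - ω) ^ j) G) (N : ℂ × ℂ →₀ ℂ) :
    HasSum (fun P : ℂ × ℂ => (∑ᶠ j : ℕ, g j * N (P.1 + j, P.2 - j)) *
      Complex.exp (P.1 * ω + P.2 * ζ))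
      (G * N.sum fun P r => r * Complex.exp (P.1 * ω + P.2 * ζ)) := by
  induction N using Finsupp.induction_linear with
  | zero => simp
  | add N N' hN hN' =>
    rw [Finsupp.sum_add_index' (by simp) (by intros; ring), mul_add]
    refine (hN.add hN').congr_fun fun P => ?_
    rw [← add_mul, ← finsum_add_distrib (finite_support_shift_finsupp N g P)
      (finite_support_shift_finsupp N' g P)]
    simp only [Finsupp.add_apply, mul_add]
  | single Q r =>
    rw [Finsupp.sum_single_index (by simp)]
    have hinj : Function.Injective fun j : ℕ => (Q.1 - (j : ℂ), Q.2 + (j : ℂ)) := fun i j hij => by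
      simpa using (Prod.mk.inj hij).1
    refine (hinj.hasSum_iff fun P hP => ?_).1 ?_
    · rw [finsum_eq_zero_of_forall_eq_zero, zero_mul]
      intro j
      rw [Finsupp.single_apply, if_neg, mul_zero]
      rintro rfl
      exact hP ⟨j, by simp⟩
    · refine (hg.mul_right (r * Complex.exp (Q.1 * ω + Q.2 * ζ))).congr_fun fun j => ?_
      simp only [Function.comp_apply]
      rw [finsum_eq_single _ j]
      · rw [show (Q.1 - (j : ℂ) + j, Q.2 + (j : ℂ) - j) = Q by simp, Finsupp.single_eq_same,
          ← Complex.exp_nat_mul, show (Q.1 - j) * ω + (Q.2 + j) * ζ =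
            j * (ζ - ω) + (Q.1 * ω + Q.2 * ζ) by ring, Complex.exp_add]
        ring
      · intro i hi
        rw [Finsupp.single_apply, if_neg, mul_zero]
        intro h0
        have := (Prod.ext_iff.1 h0).1
        simp only at this
        refine hi (Nat.cast_injective (R := ℂ) ?_)
        linear_combination -this

namespace VertexOp

variable (h k : ℂ)

/-- The creation degrees are bounded by the weight of the target monomial, and the annihilation
degrees by local nilpotency on `p`. A matrix element of the normally ordered product is thus a
Laurent polynomial. -/
theorem support_coeff_mode₂ (V W : VertexOp) (p : Poly) (d : (Boson × ℕ+) →₀ ℕ) :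
    ∃ S : Finset (ℕ × ℕ × ℕ × ℕ), ∀ s t : ℂ, MvPolynomial.coeff d (mode₂ h k V W s t p) ≠ 0 →
      ∃ x ∈ S, s = x.1 - x.2.2.1 ∧ t = x.2.1 - x.2.2.2 := by
  set D := Finsupp.weight modeWeight d with hD
  set T := (finite_support_lower₂ h k V W p).toFinset with hT
  refine ⟨Finset.range (D + 1) ×ˢ Finset.range (D + 1) ×ˢ T, fun s t hst => ?_⟩
  rw [mode₂, ← MvPolynomial.lcoeff_apply,
    map_finsum (MvPolynomial.lcoeff ℂ d) (finite_support_mode₂ h k V W s t p)] at hst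
  obtain ⟨x, hx⟩ := not_forall.1 (mt finsum_eq_zero_of_forall_eq_zero hst)
  rw [MvPolynomial.lcoeff_apply] at hx
  obtain ⟨i, hi⟩ : ∃ i : ℕ, (i : ℂ) = s + x.1 := by
    by_contra h0
    push Not at h0
    rw [creC_eq_zero V h0] at hx
    simp at hx
  obtain ⟨j, hj⟩ : ∃ j : ℕ, (j : ℂ) = t + x.2 := by
    by_contra h0
    push Not at h0
    rw [creC_eq_zero W h0] at hx
    simp at hx
  rw [← hi, ← hj, creC_natCast, creC_natCast] at hx
  refine ⟨(i, j, x.1, x.2), ?_, by rw [hi]; ring, by rw [hj]; ring⟩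
  simp only [Finset.mem_product, Finset.mem_range, hT, Set.Finite.mem_toFinset,
    Function.mem_support]
  refine ⟨?_, ?_, fun h0 => hx ?_⟩
  · by_contra h0
    refine hx ?_
    rw [mul_assoc]
    exact coeff_cre_mul_eq_zero V (by omega) _
  · by_contra h0
    refine hx ?_
    rw [mul_comm (V.cre i), mul_assoc]
    exact coeff_cre_mul_eq_zero W (by omega) _
  · rw [h0, mul_zero, MvPolynomial.coeff_zero]

theorem finite_support_coeff_mode₂ (V W : VertexOp) (p : Poly) (d : (Boson × ℕ+) →₀ ℕ) :
    (Function.support fun P : ℂ × ℂ =>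
      MvPolynomial.coeff d (mode₂ h k V W P.1 P.2 p)).Finite := by
  obtain ⟨S, hS⟩ := support_coeff_mode₂ h k V W p d
  refine (S.finite_toSet.image fun x : ℕ × ℕ × ℕ × ℕ =>
    (((x.1 : ℂ) - x.2.2.1, (x.2.1 : ℂ) - x.2.2.2) : ℂ × ℂ)).subset fun P hP => ?_
  obtain ⟨x, hx, h1, h2⟩ := hS P.1 P.2 hP
  exact ⟨x, hx, Prod.ext h1.symm h2.symm⟩

/-- The matrix elements of `mode₂`. -/
def coeffMode₂ (V W : VertexOp) (p : Poly) (d : (Boson × ℕ+) →₀ ℕ) : ℂ × ℂ →₀ ℂ :=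
  Finsupp.ofSupportFinite _ (finite_support_coeff_mode₂ h k V W p d)

theorem coeffMode₂_apply (V W : VertexOp) (p : Poly) (d : (Boson × ℕ+) →₀ ℕ) (P : ℂ × ℂ) :
    coeffMode₂ h k V W p d P = MvPolynomial.coeff d (mode₂ h k V W P.1 P.2 p) := rfl

theorem exists_int_of_coeffMode₂_ne_zero {V W : VertexOp} {p : Poly} {d : (Boson × ℕ+) →₀ ℕ}
    {P : ℂ × ℂ} (hP : coeffMode₂ h k V W p d P ≠ 0) : ∃ n : ℤ, P.2 = n := by
  obtain ⟨S, hS⟩ := support_coeff_mode₂ h k V W p d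
  obtain ⟨x, -, -, h2⟩ := hS P.1 P.2 hP
  exact ⟨x.2.1 - x.2.2.2, by rw [h2]; push_cast; rfl⟩

end VertexOp

theorem finsum_finsum_int {f : ℂ × ℂ → ℂ} (hf : (Function.support f).Finite)
    (hn : ∀ P, f P ≠ 0 → ∃ n : ℤ, P.2 = n) :
    ∑ᶠ u : ℂ, ∑ᶠ n : ℤ, f (u - n, n) = ∑ᶠ P, f P := by
  have hinj : Function.Injective fun y : ℂ × ℤ => (y.1 - (y.2 : ℂ), (y.2 : ℂ)) := by
    rintro ⟨u, n⟩ ⟨u', n'⟩ hy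
    simp only [Prod.mk.injEq, Int.cast_inj] at hy
    obtain ⟨h1, rfl⟩ := hy
    rw [sub_left_inj.1 h1]
  rw [← finsum_curry (fun y : ℂ × ℤ => f (y.1 - (y.2 : ℂ), (y.2 : ℂ)))
    (hf.preimage hinj.injOn), finsum_comp_eq_indicator hinj f, Set.indicator_eq_self.2]
  intro P hP
  obtain ⟨n, h0⟩ := hn P hP
  exact ⟨(P.1 + n, n), Prod.ext (by simp) h0.symm⟩

theorem sum_mul_eq_finsum (N : ℂ × ℂ →₀ ℂ) (φ : ℂ × ℂ → ℂ) :
    N.sum (fun P r => r * φ P) = ∑ᶠ P, N P * φ P := by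
  rw [Finsupp.sum, finsum_eq_sum_of_support_subset]
  intro P hP
  simpa using left_ne_zero_of_mul hP

/-- The series sums to contraction times zero-mode monomial times Laurent polynomial, and only the
contraction can have a pole at the centre. The `1` in `1 + A` comes from `dw = e ^ ω dω`. -/
theorem hasResidue_of_finsupp {c : ℂ} {η R : ℝ} {Γ : ℂ → ℂ} {g : ℕ → ℂ}
    (hm : MeromorphicOn Γ {u : ℂ | c.re - η < u.re}) (ha : AnalyticAt ℂ Γ c)
    (hs : ∀ u : ℂ, R < u.re → HasSum (fun j => g j * Complex.exp (-u) ^ j)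
      (Γ u / (1 - Complex.exp (c - u))))
    (N : ℂ × ℂ →₀ ℂ) (hN : ∀ P, N P ≠ 0 → ∃ n : ℤ, P.2 = n) (A B : ℂ) :
    HasResidue c η (fun y => ∑ᶠ j : ℕ, g j * N (y.1 - A + j, y.2 - B - j))
      (fun a => Γ c * Complex.exp (c * (1 + A)) * ∑ᶠ n : ℤ,
        Complex.exp (c * (a - (1 + A + B) - n)) * N (a - (1 + A + B) - n, n)) := by
  have hfin : (Function.support fun u : ℂ => ∑ᶠ n : ℤ,
      Complex.exp (c * (u - n)) * N (u - n, n)).Finite := by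
    refine (N.hasFiniteSupport.image fun P => P.1 + P.2).subset fun u hu => ?_
    obtain ⟨n, hn⟩ := not_forall.1 (mt finsum_eq_zero_of_forall_eq_zero hu)
    exact ⟨(u - n, n), right_ne_zero_of_mul hn, by simp⟩
  have hfin' : (Function.support fun a : ℂ => ∑ᶠ n : ℤ,
      Complex.exp (c * (a - (1 + A + B) - n)) * N (a - (1 + A + B) - n, n)).Finite :=
    hfin.preimage (f := fun a => a - (1 + A + B)) (sub_left_injective).injOn
  refine ⟨hfin'.subset fun a ha => right_ne_zero_of_mul ha, fun ζ => ?_⟩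
  refine ⟨fun ω => Γ (ω - ζ) * (Complex.exp (A * ω + B * ζ) *
    N.sum fun P r => r * Complex.exp (P.1 * ω + P.2 * ζ)), R + ζ.re, ?_, ?_, fun ω hω => ?_, ?_⟩
  · intro ω hω
    have h1 : MeromorphicAt Γ (ω - ζ) := hm _ (by
      simp only [Set.mem_ofPred_eq, Complex.add_re, Complex.sub_re] at hω ⊢
      linarith)
    have h2 : MeromorphicAt (fun ω => Γ (ω - ζ)) ω :=
      h1.comp_analyticAt (g := fun ω => ω - ζ) (by fun_prop)
    refine h2.mul (AnalyticAt.meromorphicAt ?_)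
    unfold Finsupp.sum
    fun_prop
  · have h1 : AnalyticAt ℂ (fun ω => Γ (ω - ζ)) (ζ + c) :=
      AnalyticAt.comp_of_eq (g := Γ) (f := fun ω => ω - ζ) ha (by fun_prop) (by ring)
    refine h1.mul ?_
    unfold Finsupp.sum
    fun_prop
  · have h1 := hs (ω - ζ) (by rw [Complex.sub_re]; linarith)
    rw [neg_sub] at h1
    have h2 := (hasSum_shift_finsupp h1 N).mul_left (Complex.exp (A * ω + B * ζ))
    rw [← (Equiv.prodCongr (Equiv.subRight A) (Equiv.subRight B)).hasSum_iff] at h2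
    have h3 : Γ (ω - ζ) * (Complex.exp (A * ω + B * ζ) *
        N.sum fun P r => r * Complex.exp (P.1 * ω + P.2 * ζ)) / (1 - Complex.exp (ζ + c - ω)) =
        Complex.exp (A * ω + B * ζ) * (Γ (ω - ζ) / (1 - Complex.exp (c - (ω - ζ))) *
          N.sum fun P r => r * Complex.exp (P.1 * ω + P.2 * ζ)) := by
      rw [show c - (ω - ζ) = ζ + c - ω by ring]
      ring
    simp only [h3]
    refine h2.congr_fun fun y => ?_
    simp only [Function.comp_apply, Equiv.prodCongr_apply, Prod.map_fst, Prod.map_snd,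
      Equiv.subRight_apply]
    rw [mul_left_comm, ← Complex.exp_add]
    congr 2
    ring
  · rw [← finsum_comp_equiv (Equiv.addRight (1 + A + B))]
    have h1 : ∀ u : ℂ, Γ c * Complex.exp (c * (1 + A)) * (∑ᶠ n : ℤ,
        Complex.exp (c * (u - n)) * N (u - n, n)) * Complex.exp ((u + (1 + A + B)) * ζ) =
        (Γ c * Complex.exp (c * (1 + A) + (1 + A + B) * ζ)) * ∑ᶠ n : ℤ,
          N (u - n, n) * Complex.exp ((u - n) * (ζ + c) + n * ζ) := by
      intro u
      have h2 : ∑ᶠ n : ℤ, N (u - n, n) * Complex.exp ((u - n) * (ζ + c) + n * ζ) =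
          (∑ᶠ n : ℤ, Complex.exp (c * (u - n)) * N (u - n, n)) * Complex.exp (u * ζ) := by
        rw [finsum_mul']
        · refine finsum_congr fun n => ?_
          rw [show (u - n) * (ζ + c) + n * ζ = c * (u - n) + u * ζ by ring, Complex.exp_add]
          ring
        · refine (N.hasFiniteSupport.preimage (f := fun n : ℤ => (u - n, (n : ℂ))) ?_).subset
            fun n hn => right_ne_zero_of_mul hn
          intro i _ j _ hij
          simpa using (Prod.mk.inj hij).2
      rw [h2, add_mul u, Complex.exp_add, Complex.exp_add]
      ring
    simp only [Equiv.coe_addRight, add_sub_cancel_right, h1]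
    rw [← mul_finsum',
      finsum_finsum_int (f := fun P => N P * Complex.exp (P.1 * (ζ + c) + P.2 * ζ))
        (N.hasFiniteSupport.subset fun P hP => left_ne_zero_of_mul hP)
        (fun P hP => hN P (left_ne_zero_of_mul hP)),
      sum_mul_eq_finsum N fun P => Complex.exp (P.1 * (ζ + c) + P.2 * ζ), add_sub_cancel_left,
      show c * (1 + A) + (1 + A + B) * ζ = A * (ζ + c) + B * ζ + (ζ + c) by ring,
      Complex.exp_add _ (ζ + c)]
    · ring
    · refine (N.hasFiniteSupport.image fun P => P.1 + P.2).subset fun u hu => ?_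
      obtain ⟨n, hn⟩ := not_forall.1 (mt finsum_eq_zero_of_forall_eq_zero hu)
      exact ⟨(u - n, n), left_ne_zero_of_mul hn, by simp⟩

section

variable {h k : ℂ}

theorem matrixElement_single (ν μ : Charge) (d : (Boson × ℕ+) →₀ ℕ) (r : Poly)
    [Decidable (μ = ν)] :
    matrixElement ν d (Finsupp.single μ r) =
      (if μ = ν then 1 else 0) * MvPolynomial.coeff d r := by
  classical
  rw [matrixElement, Finsupp.single_apply]
  split_ifs <;> simp

theorem finite_support_ope_mode₂ (V W : VertexOp) (g : ℕ → ℂ) (s t : ℂ) (p : Poly) :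
    (Function.support fun j : ℕ => g j • mode₂ h k V W (s + j) (t - j) p).Finite := by
  refine ((finite_support_ope h k V W g s t p).image Prod.fst).subset fun j hj => ?_
  have h1 : mode₂ h k V W (s + j) (t - j) p ≠ 0 := right_ne_zero_of_smul hj
  obtain ⟨x, hx⟩ := not_forall.1 (mt finsum_eq_zero_of_forall_eq_zero h1)
  exact ⟨(j, x), smul_ne_zero (left_ne_zero_of_smul hj) hx, rfl⟩

/-- The Laurent polynomial evaluated at `w = q ^ x z` reassembles into the vertex operator
`V.at_qPow h x * W`. The remaining constant collects the numerator at the pole and the zero-mode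
factors. -/
theorem hasResidue_current_current {V W : VertexOp} {x : ℂ} {η R : ℝ} {Γ : ℂ → ℂ}
    (hm : MeromorphicOn Γ {u : ℂ | (h * x).re - η < u.re}) (ha : AnalyticAt ℂ Γ (h * x))
    (hs : ∀ u : ℂ, R < u.re → HasSum
      (fun j => coeff j (expSeries (contraction h k V W)) * Complex.exp (-u) ^ j)
      (Γ u / (1 - Complex.exp (h * x - u)))) (μ ν : Charge) (p : Poly) (d : (Boson × ℕ+) →₀ ℕ) :
    HasResidue (h * x) η
      (fun y => matrixElement ν d
        (V.current h k y.1 (W.current h k y.2 (Finsupp.single μ p))))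
      (fun a => (Γ (h * x) *
          qPow h (x * (1 + V.zExponent W.shift) + V.qExponent W.shift)) *
        matrixElement ν d ((V.at_qPow h x * W).current h k
          (a - (1 + V.zExponent W.shift)) (Finsupp.single μ p))) := by
  classical
  have h1 := (hasResidue_of_finsupp hm ha hs (coeffMode₂ h k V W p d)
    (fun P hP => exists_int_of_coeffMode₂_ne_zero h k hP)
    (V.zExponent μ + V.zExponent W.shift) (W.zExponent μ)).const_mul
      ((if μ + (V.shift + W.shift) = ν then 1 else 0) * (V.scalar * W.scalar *
        (qPow h (V.qExponent μ) * qPow h (W.qExponent μ) * qPow h (V.qExponent W.shift))))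
  convert h1 using 1
  · funext y
    rw [current_current_single, matrixElement_single, MvPolynomial.coeff_smul, smul_eq_mul,
      ← MvPolynomial.lcoeff_apply, map_finsum (MvPolynomial.lcoeff ℂ d)
        (finite_support_ope_mode₂ V W _ _ _ p), ← mul_assoc, sub_sub]
    simp only [map_smul, smul_eq_mul, MvPolynomial.lcoeff_apply, coeffMode₂_apply]
  · funext a
    rw [current_single, matrixElement_single, MvPolynomial.coeff_smul, smul_eq_mul, mode_mul,
      ← MvPolynomial.lcoeff_apply, map_finsum (MvPolynomial.lcoeff ℂ d), zExponent_mul,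
      zExponent_at_qPow, qExponent_mul, qExponent_at_qPow,
      show a - (1 + V.zExponent W.shift) - (V.zExponent μ + W.zExponent μ) =
        a - (1 + (V.zExponent μ + V.zExponent W.shift) + W.zExponent μ) by ring]
    · generalize a - (1 + (V.zExponent μ + V.zExponent W.shift) + W.zExponent μ) = u
      have h2 : ∀ n : ℤ, (MvPolynomial.lcoeff ℂ d)
          (mode₂ h k (V.at_qPow h x) W (u - n) n p) =
          Complex.exp (h * x * (u - n)) * coeffMode₂ h k V W p d (u - n, n) := by
        intro n
        rw [mode₂_comm, mode₂_at_qPow, mode₂_comm, map_smul, smul_eq_mul, coeffMode₂_apply,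
          MvPolynomial.lcoeff_apply, qPow, mul_assoc]
      simp only [h2]
      have h3 : (V.at_qPow h x * W).shift = V.shift + W.shift := rfl
      have h4 : (V.at_qPow h x * W).scalar = V.scalar * W.scalar := rfl
      rw [h3, h4, mul_assoc h x (1 + _), ← qPow, show x * (1 + (V.zExponent μ + V.zExponent
          W.shift)) =
        x * (1 + V.zExponent W.shift) + x * V.zExponent μ by ring]
      simp only [qPow_add]
      ring
    · have := finite_support_mode₂_shift h k (V.at_qPow h x) W
        (a - (1 + V.zExponent W.shift) - (V.at_qPow h x * W).zExponent μ) 0 p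
      simp only [zero_add] at this
      exact this

end

/-! ### Existence of `L(z)` -/

section

variable {h k : ℂ} (hq : h.re < 0) (hk : (h * k).re < 0)

/-- The numerator of the continuation of the contraction of `Ȳ^-(z) Ȳ^+(w)`, where
`z / w = e ^ u`. -/
def ybarNum (h k u : ℂ) : ℂ :=
  ybarFun h k (qPow h (2 * k) * Complex.exp (-u)) * (1 - qPow h (k - 2) * Complex.exp (-u))

-- The factor `q ^ (2 k)` in the argument gains exactly the strip of width `-(h * (2 * k)).re` to
-- the left of the pole.
include hq hk in
theorem analyticAt_ybarNum {u : ℂ} (hu : (h * (k + 2)).re - -(h * (2 * k)).re < u.re) :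
    AnalyticAt ℂ (ybarNum h k) u := by
  have h1 : ‖qPow h (k + 2) * (qPow h (2 * k) * Complex.exp (-u))‖ < 1 := by
    rw [qPow, qPow, ← Complex.exp_add, ← Complex.exp_add, Complex.norm_exp, Real.exp_lt_one_iff]
    simp only [Complex.add_re, Complex.neg_re]
    linarith
  refine AnalyticAt.mul ?_ (by fun_prop)
  exact AnalyticAt.comp (g := ybarFun h k) (f := fun u => qPow h (2 * k) * Complex.exp (-u))
    (analyticAt_ybarFun hq hk h1) (by fun_prop)

include hq hk in
theorem hasSum_ybarNum {u : ℂ} (hu : (h * (k + 2)).re < u.re) :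
    HasSum (fun j => coeff j (expSeries (ybarSeries h k)) * Complex.exp (-u) ^ j)
      (ybarNum h k u / (1 - Complex.exp (h * (k + 2) - u))) := by
  have he : Complex.exp (h * (k + 2) - u) = qPow h (k + 2) * Complex.exp (-u) := by
    rw [qPow, ← Complex.exp_add, sub_eq_add_neg]
  have h1 : ‖qPow h (k + 2) * Complex.exp (-u)‖ < 1 := by
    rw [← he, Complex.norm_exp, Real.exp_lt_one_iff, Complex.sub_re]
    linarith
  have h2 : 1 - qPow h (k + 2) * Complex.exp (-u) ≠ 0 := fun h0 => by
    rw [← sub_eq_zero.1 h0, norm_one] at h1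
    exact lt_irrefl _ h1
  rw [he, ybarNum, ← ybarFun_eq hq hk h1, mul_div_cancel_right₀ _ h2]
  exact hasSum_ybarFun hq hk h1

-- The contraction is that of `Ȳ^- Ȳ^+` times (1 - σx)/(1 - τx), with τ = σ = 0 when there is no
-- additional factor. A pole of this factor may lie in the half plane, but `hτ` keeps it away from
-- the centre.
include hq hk in
theorem hasResidue_phi {V W : VertexOp} {τ σ e : ℂ} (h0 : ∀ m, V.annih .alpha m = 0)
    (hp : ∀ m : ℕ+, pairing h k V W m = -((qNum h (2 * (m : ℂ)) / qNum h (k * (m : ℂ))) / (m : ℂ)) +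
      (τ ^ (m : ℕ) - σ ^ (m : ℕ)) / (m : ℂ))
    (hz : V.zExponent W.shift = 2 / k) (he : V.qExponent W.shift = e)
    (hτ : 1 - τ * Complex.exp (-(h * (k + 2))) ≠ 0) (μ ν : Charge) (p : Poly)
    (d : (Boson × ℕ+) →₀ ℕ) :
    HasResidue (h * (k + 2)) (-(h * (2 * k)).re)
      (fun y => matrixElement ν d
        (V.current h k y.1 (W.current h k y.2 (Finsupp.single μ p))))
      (fun a => (ybarNum h k (h * (k + 2)) * ((1 - τ * Complex.exp (-(h * (k + 2))))⁻¹ *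
          (1 - σ * Complex.exp (-(h * (k + 2))))) * qPow h ((k + 2) * (1 + 2 / k) + e)) *
        matrixElement ν d ((V.at_qPow h (k + 2) * W).current h k
          (a - (1 + 2 / k)) (Finsupp.single μ p))) := by
  have hη : 0 < -(h * (2 * k)).re := neg_pos.2 (re_two_mul hk)
  rw [← hz, ← he]
  -- Beyond this bound, `e ^ (Re u) ≥ 1 + Re u > ‖τ‖`, so the geometric series for the additional
  -- pole converges too.
  refine hasResidue_current_current (R := max (h * (k + 2)).re ‖τ‖)
    (Γ := fun u => ybarNum h k u * ((1 - τ * Complex.exp (-u))⁻¹ * (1 - σ * Complex.exp (-u))))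
    (fun u hu => ?_) ?_ (fun u hu => ?_) μ ν p d
  · refine (analyticAt_ybarNum hq hk hu).meromorphicAt.mul (MeromorphicAt.mul ?_ ?_)
    · exact MeromorphicAt.inv (AnalyticAt.meromorphicAt (by fun_prop))
    · exact AnalyticAt.meromorphicAt (by fun_prop)
  · refine (analyticAt_ybarNum hq hk (by linarith)).mul (AnalyticAt.mul ?_ (by fun_prop))
    exact AnalyticAt.inv (by fun_prop) hτ
  · have h1 : contraction h k V W = ybarSeries h k + (logSeries τ - logSeries σ) := by
      rw [contraction_eq_posSeries h0, logSeries_sub_logSeries, ybarSeries, ← posSeries_add]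
      congr 1
      funext m
      exact hp m
    have h2 : ‖τ * Complex.exp (-u)‖ < 1 := by
      rw [norm_mul, Complex.norm_exp, Complex.neg_re, Real.exp_neg, ← div_eq_mul_inv,
        div_lt_one (Real.exp_pos _)]
      linarith [Real.add_one_le_exp u.re, (le_max_right (h * (k + 2)).re ‖τ‖).trans_lt hu]
    have h3 : coeff 0 (ybarSeries h k) = 0 := coeff_zero_posSeries _
    have h4 : coeff 0 (logSeries τ - logSeries σ) = 0 := by
      rw [map_sub, coeff_zero_logSeries, coeff_zero_logSeries, sub_zero]
    rw [h1, expSeries_add h3 h4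
      (fun _ _ => Commute.all _ _) (fun _ _ => Commute.all _ _) (fun _ _ => Commute.all _ _),
      expSeries_logSeries_sub, mul_div_right_comm]
    exact hasSum_coeff_mul (hasSum_ybarNum hq hk ((le_max_left _ _).trans_lt hu))
      (hasSum_coeff_mul (hasSum_coeff_geometric h2) (hasSum_coeff_one_sub σ _))

theorem exponents_phi (h k : ℂ) :
    (phiMinus₁ h k).zExponent (phiPlus₁ h k).shift = 2 / k ∧
    (phiMinus₁ h k).zExponent (phiPlus₂ h k).shift = 2 / k ∧
    (phiMinus₂ h k).zExponent (phiPlus₁ h k).shift = 2 / k ∧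
    (phiMinus₂ h k).zExponent (phiPlus₂ h k).shift = 2 / k ∧
    (phiMinus₁ h k).qExponent (phiPlus₁ h k).shift = 1 ∧
    (phiMinus₁ h k).qExponent (phiPlus₂ h k).shift = 1 ∧
    (phiMinus₂ h k).qExponent (phiPlus₁ h k).shift = -1 ∧
    (phiMinus₂ h k).qExponent (phiPlus₂ h k).shift = -1 := by
  refine ⟨?_, ?_, ?_, ?_, ?_, ?_, ?_, ?_⟩ <;>
  · simp [zExponent, qExponent, sum_boson, zeroMode, phiMinus₁, phiMinus₂, phiPlus₁, phiPlus₂,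
      YbarPlus, YbarMinus, Zplus, Wplus, Zminus, Wminus, plusPart, minusPart]
    try ring

include hq hk in
theorem isL_lCurrent : ∃ R, IsL h k (lCurrent h k R) := by
  set t := Complex.exp (-(h * (k + 2))) with ht
  set D := 1 / (qPow h 1 - qPow h (-1)) with hD
  set G := ybarNum h k (h * (k + 2)) with hG
  obtain ⟨z1, z2, z3, z4, q1, q2, q3, q4⟩ := exponents_phi h k
  -- The constant collects the prefactors of the two currents, the numerator of the `Ȳ` contraction
  -- at the pole, and the common zero-mode power there.
  refine ⟨D * D * (G * qPow h ((k + 2) * (1 + 2 / k))), isContourIntegral_of_hasResidue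
    (neg_pos.2 (re_two_mul hk)) fun μ p ν d => ?_⟩
  have htq : ∀ x, qPow h x * t = qPow h (x - (k + 2)) := fun x => by
    rw [ht, qPow, ← Complex.exp_add, qPow]
    congr 1
    ring
  have hK : ∀ m : ℕ+, qPow h (k * (m : ℕ) / 2) ^ 2 = qPow h k ^ (m : ℕ) := fun m => by
    rw [← qPow_mode₄, qPow_mul_natCast]
  have hQ : ∀ m : ℕ+, qPow h (k * (m : ℕ) / 2) ^ 2 * qPow h (m : ℕ) ^ 2 =
      qPow h (k + 2) ^ (m : ℕ) := fun m => by
    rw [← qPow_mode₃, qPow_mul_natCast]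
  have r11 := hasResidue_phi hq hk (V := phiMinus₁ h k) (W := phiPlus₁ h k) (τ := qPow h (-k))
    (σ := qPow h (-(k + 2))) (fun m => by simp [phiMinus₁, YbarMinus, Zplus, Wplus, plusPart])
    (fun m => by
      rw [(pairing_phi hq hk m).1, qPow_neg, qPow_neg, hQ, hK, inv_pow, inv_pow]) z1 q1
    (by
      rw [← ht, htq, show -k - (k + 2) = -(2 * k + 2) by ring]
      exact one_sub_qPow_ne_zero hq hk) μ ν p d
  have r12 := hasResidue_phi hq hk (V := phiMinus₁ h k) (W := phiPlus₂ h k) (τ := 0) (σ := 0)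
    (fun m => by simp [phiMinus₁, YbarMinus, Zplus, Wplus, plusPart])
    (fun m => by rw [(pairing_phi hq hk m).2.1, sub_self, zero_div, add_zero]) z2 q2
    (by simp) μ ν p d
  have r21 := hasResidue_phi hq hk (V := phiMinus₂ h k) (W := phiPlus₁ h k) (τ := 0) (σ := 0)
    (fun m => by simp [phiMinus₂, YbarMinus, Zminus, Wminus, minusPart])
    (fun m => by rw [(pairing_phi hq hk m).2.2.1, sub_self, zero_div, add_zero]) z3 q3
    (by simp) μ ν p d
  -- Here σ e^{-h(k+2)} = 1, so the residue of this term is zero and Λ_22 is absent from `lCurrent`.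
  have r22 := hasResidue_phi hq hk (V := phiMinus₂ h k) (W := phiPlus₂ h k) (τ := qPow h k)
    (σ := qPow h (k + 2)) (fun m => by simp [phiMinus₂, YbarMinus, Zminus, Wminus, minusPart])
    (fun m => by rw [(pairing_phi hq hk m).2.2.2, hQ, hK]) z4 q4
    (by
      rw [← ht, htq, show k - (k + 2) = -2 by ring]
      intro h0
      have h1 := norm_qPow_lt_one (h := h) (x := 2) (by simp; linarith)
      rw [← inv_inv (qPow h 2), ← qPow_neg, ← sub_eq_zero.1 h0] at h1
      simp at h1) μ ν p d
  have h1 := ((r11.add (r12.const_mul (-1))).add ((r21.const_mul (-1)).add r22)).const_mul (D * D)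
  convert h1 using 1
  · funext y
    simp only [PhiMinus, PhiPlus, matrixElement, LinearMap.smul_apply, LinearMap.sub_apply,
      map_smul, map_sub, Finsupp.smul_apply, Finsupp.sub_apply, MvPolynomial.coeff_smul,
      MvPolynomial.coeff_sub, smul_eq_mul]
    ring
  · funext a
    simp only [lCurrent, lambda₁₁, lambda₁₂, lambda₂₁, matrixElement, LinearMap.smul_apply,
      LinearMap.sub_apply, Finsupp.smul_apply, Finsupp.sub_apply, MvPolynomial.coeff_smul,
      MvPolynomial.coeff_sub, smul_eq_mul, ← ht, htq, sub_self, qPow_zero, mul_zero, zero_mul]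
    rw [show -k - (k + 2) = -(2 * k + 2) by ring, show -(k + 2) - (k + 2) = -(2 * k + 4) by ring,
      qPow_add h _ 1, qPow_add h _ (-1)]
    ring

end

end

end QParafermion

/-! ### Assembly of the theorem -/

theorem mainTheorem3 (h k : ℂ) (hq : h.re < 0) (hk : (h * k).re < 0) :
    QParafermion.TrivialContraction h k (QParafermion.lambda₃ h k) (QParafermion.Sminus h k) ∧
    QParafermion.TrivialContraction h k (QParafermion.lambda₂ h k) (QParafermion.Splus h k) ∧
    (∃! L : QParafermion.Current, QParafermion.IsL h k L) ∧
    ∀ L : QParafermion.Current, QParafermion.IsL h k L →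
      QParafermion.CommutesUpToTotalDifference h k L (QParafermion.Sminus h k) ∧
      QParafermion.CommutesUpToTotalDifference h k L (QParafermion.Splus h k) := by
  refine ⟨(QParafermion.trivialContraction_Sminus hq hk).2,
    (QParafermion.trivialContraction_Splus hq hk).2, ?_⟩
  obtain ⟨R, hR⟩ := QParafermion.isL_lCurrent hq hk
  refine ⟨⟨_, hR, fun L hL => hL.unique hR⟩, fun L hL => ?_⟩
  rw [hL.unique hR]
  exact ⟨QParafermion.lCurrent_commutes_Sminus hq hk R,
    QParafermion.lCurrent_commutes_Splus hq hk R⟩
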